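/- Let $n\ge 2$, let $Q^{2n}=V\bigl(\sum_{i=0}^{n}x_{2i}x_{2i+1}\bigr)\subset\mathbb P^{2n+1}_{\mathbb C}$, and for $i=0,\dots,n$ let $Z_i=V(x_{2i},x_{2i+1})\subset Q^{2n}$. Let $$W^{2n}=\mathrm{Bl}_{\tilde Z_n}\cdots \mathrm{Bl}_{\tilde Z_1}\mathrm{Bl}_{Z_0}\,Q^{2n}$$ be the wonderful compactification of the arrangement of subvarieties of $Q^{2n}$ built by $Z_0,\dots,Z_n$, i.e. the variety obtained from $Q^{2n}$ by blowing up $Z_0$, then the strict transform of $Z_1$, and so on up to the strict transform of $Z_n$. Then $W^{2n}$ exists (as an iterated blow-up of schemes, each blow-up being characterized by its universal property) and is a Fano variety of dimension $2n$: it is an integral scheme, smooth of relative dimension $2n$ and proper over $\mathbb C$, and its anticanonical divisor $-K_{W^{2n}}$ is ample. -/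

import Mathlib

open CategoryTheory AlgebraicGeometry TopologicalSpace

namespace WonderfulQuadric

noncomputable section

universe u

/-! ### Blow-ups -/

section Blowup

/-- The closed subscheme defined by `I` is an effective Cartier divisor: locally on `X`, the ideal
sheaf `I` is generated by one non-zero-divisor. -/
def IsInvertibleIdeal {X : Scheme.{u}} (I : X.IdealSheafData) : Prop :=
  ∀ x : X, ∃ U : X.affineOpens, x ∈ U.1 ∧
    ∃ g ∈ nonZeroDivisors Γ(X, U.1), I.ideal U = Ideal.span {g}

/-- `π : X' ⟶ X` is the blow-up of `X` along the ideal sheaf `I`: the inverse image ideal sheaf of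
`I` on `X'` is invertible, and `π` is universal (terminal) among all morphisms with this
property. (`I.comap f` is the inverse image ideal sheaf, i.e. the ideal sheaf of the
scheme-theoretic preimage under `f` of the closed subscheme defined by `I`.) -/
def IsBlowup {X' X : Scheme.{u}} (I : X.IdealSheafData) (π : X' ⟶ X) : Prop :=
  IsInvertibleIdeal (I.comap π) ∧
    ∀ (T : Scheme.{u}) (f : T ⟶ X), IsInvertibleIdeal (I.comap f) → ∃! g : T ⟶ X', g ≫ π = f

/-- The blow-up of `X` along a closed subset `C`, regarded as a reduced closed subscheme. -/
def IsBlowupAlong {X' X : Scheme.{u}} (C : Closeds X) (π : X' ⟶ X) : Prop :=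
  IsBlowup (Scheme.IdealSheafData.vanishingIdeal C) π

/-- The strict transform of `Z` under a blow-up `π` with centre `C`: the closure of the preimage
of `Z \ C`. -/
def strictTransform {X' X : Scheme.{u}} (π : X' ⟶ X) (C Z : Closeds X) : Closeds X' :=
  Closeds.closure (π ⁻¹' ((Z : Set X) \ C))

/-- `IsIteratedBlowup [Z₀, …, Zₖ] π` says that `π : W ⟶ X` is the iterated blow-up
`Bl_{Z̃ₖ} ⋯ Bl_{Z̃₁} Bl_{Z₀} X ⟶ X`: first `Z₀` is blown up, then the strict transform of `Z₁`, and
so on; at each stage all remaining centres are replaced by their strict transforms. -/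
inductive IsIteratedBlowup : {W X : Scheme.{u}} → List (Closeds X) → (W ⟶ X) → Prop
  | nil (X : Scheme.{u}) : IsIteratedBlowup [] (𝟙 X)
  | cons {W X' X : Scheme.{u}} (C : Closeds X) (L : List (Closeds X)) (π : X' ⟶ X) (ρ : W ⟶ X')
      (hπ : IsBlowupAlong C π) (hρ : IsIteratedBlowup (L.map (strictTransform π C)) ρ) :
      IsIteratedBlowup (C :: L) (ρ ≫ π)

end Blowup

/-! ### Rational differential forms, Cartier divisors, Fano varieties -/

section Fano

variable {k : Type u} [Field k] {X : Scheme.{u}}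

/-- The function field of the integral `k`-scheme `f : X ⟶ Spec k`, with its `k`-algebra
structure. -/
def FunctionField (_f : X ⟶ Spec (.of k)) [IsIntegral X] : Type u := X.functionField

variable (f : X ⟶ Spec (.of k)) [IsIntegral X]

instance : Field (FunctionField f) := inferInstanceAs (Field X.functionField)

instance : Algebra k (FunctionField f) :=
  RingHom.toAlgebra <| (X.presheaf.germ ⊤ (genericPoint X) trivial).hom.comp <|
    f.appTop.hom.comp (Scheme.ΓSpecIso (.of k)).inv.hom

/-- The local ring `𝒪_{X,x}` as a subring of the function field. -/
def localRing (x : X) : Subring (FunctionField f) :=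
  RingHom.range (algebraMap (X.presheaf.stalk x) X.functionField)

/-- The rational function `g` is a unit of the local ring at `x`. -/
def IsUnitAt (x : X) (g : FunctionField f) : Prop :=
  g ≠ 0 ∧ g ∈ localRing f x ∧ g⁻¹ ∈ localRing f x

/-- Rational differential `d`-forms on `X` over `k`. -/
abbrev RationalForms (d : ℕ) : Type u :=
  ⋀[FunctionField f]^d Ω[FunctionField f⁄k]

/-- The `𝒪_{X,x}`-module of rational `d`-forms which are regular at `x`: it is generated by the
forms `da₁ ∧ ⋯ ∧ da_d` with `a₁, …, a_d ∈ 𝒪_{X,x}`. If `X` is smooth of dimension `d` at `x`, this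
is the stalk at `x` of the canonical sheaf `ω_X = ⋀ᵈ Ω_{X/k}`. -/
def regularForms (d : ℕ) (x : X) : Submodule (localRing f x) (RationalForms f d) :=
  Submodule.span (localRing f x)
    {ω | ∃ a : Fin d → FunctionField f, (∀ i, a i ∈ localRing f x) ∧
      ω = exteriorPower.ιMulti (FunctionField f) d
        (fun i => KaehlerDifferential.D k (FunctionField f) (a i))}

/-- A Cartier divisor on `X`, i.e. a global section of `𝒦*/𝒪*`, given by its local equations: at
every point `x` a nonzero rational function `eqn x` (of which only the class modulo units of
`𝒪_{X,x}` matters), such that `eqn x` is also a local equation at all points `y` near `x`. -/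
structure CartierDivisor where
  /-- the local equation at each point -/
  eqn : X → FunctionField f
  eqn_ne_zero : ∀ x, eqn x ≠ 0
  locally_eq : ∀ x, ∃ U : X.Opens, x ∈ U ∧ ∀ y ∈ U, IsUnitAt f y (eqn y / eqn x)

variable {f}

/-- The divisor `-D`. -/
def CartierDivisor.neg (D : CartierDivisor f) : CartierDivisor f where
  eqn x := (D.eqn x)⁻¹
  eqn_ne_zero x := inv_ne_zero (D.eqn_ne_zero x)
  locally_eq x := by
    obtain ⟨U, hx, hU⟩ := D.locally_eq x
    refine ⟨U, hx, fun y hy => ?_⟩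
    obtain ⟨h0, h1, h2⟩ := hU y hy
    have e : (D.eqn y)⁻¹ / (D.eqn x)⁻¹ = (D.eqn y / D.eqn x)⁻¹ := by
      rw [inv_div_inv, inv_div]
    rw [e]
    exact ⟨inv_ne_zero h0, h2, by rwa [inv_inv]⟩

/-- `s` is a global section of `𝒪_X(mD)`: in terms of local equations `g` of `D`, the product
`s * g ^ m` is regular at every point. -/
def CartierDivisor.IsSection (D : CartierDivisor f) (m : ℕ) (s : FunctionField f) : Prop :=
  ∀ x, s * D.eqn x ^ m ∈ localRing f x

/-- `D` is ample (for quasi-compact `X`): every point has an affine open neighbourhood which is the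
non-vanishing locus `X_s` of a global section `s` of `𝒪_X(mD)` for some `m ≥ 1`. -/
def CartierDivisor.IsAmple (D : CartierDivisor f) : Prop :=
  ∀ x : X, ∃ m : ℕ, 1 ≤ m ∧ ∃ s : FunctionField f, D.IsSection m s ∧
    ∃ U : X.Opens, IsAffineOpen U ∧ x ∈ U ∧ ∀ y, y ∈ U ↔ IsUnitAt f y (s * D.eqn y ^ m)

/-- `K` is a canonical divisor of the smooth `d`-dimensional variety `X`: it is the divisor of a
nonzero rational `d`-form `η`. That is, at each point `x` the regular `d`-forms are generated by
one form `θ`, and `η = g θ` with `g` the local equation of `K` at `x`. -/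
def IsCanonicalDivisor (d : ℕ) (K : CartierDivisor f) : Prop :=
  ∃ η : RationalForms f d, η ≠ 0 ∧ ∀ x : X, ∃ θ : RationalForms f d,
    regularForms f d x = Submodule.span (localRing f x) {θ} ∧ η = K.eqn x • θ

end Fano

/-- `f : X ⟶ Spec k` is a (smooth) Fano variety of dimension `d` over `k`: `X` is integral, smooth
of relative dimension `d` and proper over `k`, and the anticanonical divisor `-K_X` is ample. (In
particular `X` is projective, being proper with an ample divisor.) -/
structure IsFano {k : Type u} [Field k] {X : Scheme.{u}} (f : X ⟶ Spec (.of k)) (d : ℕ) : Prop where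
  [isIntegral : IsIntegral X]
  [smooth : SmoothOfRelativeDimension d f]
  [proper : IsProper f]
  ample_neg_canonical : ∃ K : CartierDivisor f, IsCanonicalDivisor d K ∧ K.neg.IsAmple

/-! ### The quadric and the subvarieties -/

section Quadric

attribute [local instance] MvPolynomial.gradedAlgebra

/-- The homogeneous coordinate ring of `ℙ^{2n+1}`. The `2n+2` variables are labelled by pairs:
`X (i, 0)` is `x_{2i}` and `X (i, 1)` is `x_{2i+1}`, for `i = 0, …, n`. -/
abbrev Coord (n : ℕ) : Type := MvPolynomial (Fin (n + 1) × Fin 2) ℂ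

/-- The standard grading of the coordinate ring by degree. -/
abbrev grading (n : ℕ) : ℕ → Submodule ℂ (Coord n) :=
  MvPolynomial.homogeneousSubmodule (Fin (n + 1) × Fin 2) ℂ

/-- The projective space `ℙ^{2n+1}` over `ℂ`. -/
def projSpace (n : ℕ) : Scheme.{0} := Proj (grading n)

/-- The structure morphism of `ℙ^{2n+1}`. -/
def projSpaceToSpec (n : ℕ) : projSpace n ⟶ Spec (.of ℂ) :=
  Proj.toSpecZero (grading n) ≫ Spec.map (CommRingCat.ofHom (algebraMap ℂ (grading n 0)))

/-- The closed subset `V(S)` of `ℙ^{2n+1}` defined by a set `S` of homogeneous polynomials. -/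
def projZeros {n : ℕ} (S : Set (Coord n)) : Closeds (projSpace n) :=
  ⟨ProjectiveSpectrum.zeroLocus (grading n) S,
    ProjectiveSpectrum.isClosed_zeroLocus (grading n) S⟩

/-- The quadratic form `∑ x_{2i} x_{2i+1}`. -/
def quadraticForm (n : ℕ) : Coord n :=
  ∑ i : Fin (n + 1), MvPolynomial.X (i, 0) * MvPolynomial.X (i, 1)

/-- The ideal sheaf of the quadric hypersurface in `ℙ^{2n+1}` (with its reduced structure). -/
def quadricIdeal (n : ℕ) : (projSpace n).IdealSheafData :=
  Scheme.IdealSheafData.vanishingIdeal (projZeros {quadraticForm n})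

/-- The quadric `Q^{2n} = V(∑ x_{2i} x_{2i+1}) ⊂ ℙ^{2n+1}`. -/
def quadric (n : ℕ) : Scheme.{0} := (quadricIdeal n).subscheme

/-- The inclusion of the quadric in projective space. -/
def quadricι (n : ℕ) : quadric n ⟶ projSpace n := (quadricIdeal n).subschemeι

/-- The structure morphism of the quadric. -/
def quadricToSpec (n : ℕ) : quadric n ⟶ Spec (.of ℂ) := quadricι n ≫ projSpaceToSpec n

/-- The subvariety `Z_i = V(x_{2i}, x_{2i+1}) ⊂ Q^{2n}`. -/
def center (n : ℕ) (i : Fin (n + 1)) : Closeds (quadric n) :=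
  (projZeros {MvPolynomial.X (i, 0), MvPolynomial.X (i, 1)}).preimage (quadricι n).continuous

/-- `π : W ⟶ Q^{2n}` is the wonderful compactification of the arrangement of subvarieties of
`Q^{2n}` built by `Z_0, …, Z_n`: the iterated blow-up `Bl_{Z̃_n} ⋯ Bl_{Z̃_1} Bl_{Z_0} Q^{2n}`. -/
def IsWonderfulCompactification {n : ℕ} {W : Scheme.{0}} (π : W ⟶ quadric n) : Prop :=
  IsIteratedBlowup (List.ofFn (center n)) π

end Quadric

end

end WonderfulQuadric

/-! Let $K$ be the function field of the quadric and $x_{i,s}\in K$ the homogeneous coordinates of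
its generic point. Every stage of the iterated blow-up is covered by copies of $\mathbb A^{2n}$
whose rings are explicit subrings of $K$. A chart is given by an index $j$ and a choice
$\varepsilon(i)\in\{0,1\}$ for every $i$. For $i\ne j$ its coordinates are
$x_{i,\varepsilon(i)}/x_{j,\varepsilon(j)}$ and the partner $x_{i,1-\varepsilon(i)}$, divided by
$x_{i,\varepsilon(i)}$ if $Z_i$ has been blown up and by $x_{j,\varepsilon(j)}$ otherwise. The
quadratic equation gives the remaining ratio $x_{j,1-\varepsilon(j)}/x_{j,\varepsilon(j)}$. These
$2n$ functions generate $K$, so they are algebraically independent.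

On such a chart a centre not yet blown up is empty or cut out by two of the coordinates, and blowing
it up adjoins the quotient of the two. Globally the blow-up is the closure of the graph of
$[x_{k,0}:x_{k,1}]$ in $X\times\mathbb P^1$, so it stays proper. `Stage` records the charts,
`nonempty_stage_blowup` passes to the next stage, and `isBlowup_of_charts` verifies the universal
property. Blow-ups being unique (`IsIteratedBlowup.exists_iso`), every wonderful compactification
has these charts, which show that it is integral and smooth.

For the anticanonical divisor, let $\theta$ be the wedge of the coordinate differentials of a chart
and $g=x_{j,\varepsilon(j)}^{n-1}\prod_i x_{i,\varepsilon(i)}$. Up to sign, $g\theta$ is the same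
form for all charts (`chartEqn_smul_chartForm_eq_or_eq_neg`): expressed in the $d\log x_{i,s}$, this
is a symmetry forced by the relation $d\bigl(\sum x_{i,0}x_{i,1}\bigr)=0$. Hence the $g$ are local
equations of $K_W$. Geometrically $-K_W=(n-1)H+\sum_i(H-E_i)$, and the $g$ are global sections of
it. The locus where such a section does not vanish is exactly its chart, because $n-1\ge 1$ makes
every factor of $g$ count (`chartHom_mem_of_chartEqn_div_mem`). So $-K_W$ is ample, already with
$m=1$. -/

open Limits

namespace WonderfulQuadric

noncomputable section

universe u

/-! ### Ideal sheaves in terms of ideals on affine charts. -/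

section IdealLayer

open Scheme

/-- The ideal of `A` corresponding to an ideal sheaf on `Spec A`. -/
def specIdeal {A : CommRingCat.{u}} (J : (Spec A).IdealSheafData) : Ideal A :=
  (J.ideal ⟨⊤, isAffineOpen_top _⟩).comap (ΓSpecIso A).inv.hom

lemma specIdeal_le {A : CommRingCat.{u}} {J J' : (Spec A).IdealSheafData} :
    specIdeal J ≤ specIdeal J' ↔ J ≤ J' := by
  constructor
  · intro h
    refine IdealSheafData.le_of_isAffine fun x hx => ?_
    have := @h ((ΓSpecIso A).hom x) (by simpa [specIdeal] using hx)
    simpa [specIdeal] using this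
  · intro h
    exact Ideal.comap_mono (h _)

lemma specIdeal_injective {A : CommRingCat.{u}} :
    Function.Injective (specIdeal (A := A)) := fun _ _ h =>
  le_antisymm (specIdeal_le.1 h.le) (specIdeal_le.1 h.ge)

lemma exists_specIdeal_eq {A : CommRingCat.{u}} (I : Ideal A) :
    ∃ J : (Spec A).IdealSheafData, specIdeal J = I := by
  refine ⟨IdealSheafData.ofIdealTop (I.comap (ΓSpecIso A).hom.hom), ?_⟩
  ext x
  simp [specIdeal]

lemma specIdeal_map {A B : CommRingCat.{u}} (α : A ⟶ B) (J : (Spec B).IdealSheafData) :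
    specIdeal (J.map (Spec.map α)) = (specIdeal J).comap α.hom := by
  ext x
  rw [specIdeal, IdealSheafData.ideal_map_of_isAffineHom]
  simp only [specIdeal, Ideal.mem_comap]
  have h := ConcreteCategory.congr_hom (ΓSpecIso_inv_naturality α) x
  simp only [CommRingCat.comp_apply] at h
  rw [h]
  rfl

/-- Inverse image of ideal sheaves is left adjoint to direct image, as extension of ideals is to
contraction, so this follows from `specIdeal_map`. -/
lemma specIdeal_comap {A B : CommRingCat.{u}} (α : A ⟶ B) (J : (Spec A).IdealSheafData) :
    specIdeal (J.comap (Spec.map α)) = (specIdeal J).map α.hom := by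
  apply le_antisymm
  · obtain ⟨J', hJ'⟩ := exists_specIdeal_eq ((specIdeal J).map α.hom)
    rw [← hJ', specIdeal_le, ← IdealSheafData.le_map_iff_comap_le, ← specIdeal_le, specIdeal_map,
      hJ', ← Ideal.map_le_iff_le_comap]
  · rw [Ideal.map_le_iff_le_comap, ← specIdeal_map, specIdeal_le]
    exact IdealSheafData.le_map_comap _ _

/-- The ideal of `A` generated by the pullback of `I` along `Spec A ⟶ X`. -/
def pullIdeal {X : Scheme.{u}} (I : X.IdealSheafData) {A : CommRingCat.{u}} (j : Spec A ⟶ X) :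
    Ideal A := specIdeal (I.comap j)

lemma pullIdeal_comap {X Y : Scheme.{u}} (I : X.IdealSheafData) (f : Y ⟶ X)
    {A : CommRingCat.{u}} (j : Spec A ⟶ Y) : pullIdeal (I.comap f) j = pullIdeal I (j ≫ f) := by
  simp [pullIdeal]

lemma pullIdeal_specMap_comp {X : Scheme.{u}} (I : X.IdealSheafData) {A B : CommRingCat.{u}}
    (j : Spec A ⟶ X) (α : A ⟶ B) :
    pullIdeal I (Spec.map α ≫ j) = (pullIdeal I j).map α.hom := by
  rw [pullIdeal, IdealSheafData.comap_comp, specIdeal_comap, pullIdeal]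

lemma pullIdeal_of_isOpenImmersion {X : Scheme.{u}} (I : X.IdealSheafData) {A : CommRingCat.{u}}
    (j : Spec A ⟶ X) [IsOpenImmersion j] :
    pullIdeal I j = (I.ideal ⟨j ''ᵁ ⊤, (isAffineOpen_top _).image_of_isOpenImmersion j⟩).comap
      ((ΓSpecIso A).inv ≫ (j.appIso ⊤).inv).hom := by
  rw [pullIdeal, specIdeal, IdealSheafData.ideal_comap_of_isOpenImmersion, Ideal.comap_comap]
  rfl

/-- For an open immersion `j : Spec A ⟶ X`, `A` is identified with the ring of sections on the
image of `j`. -/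
def chartIso {X : Scheme.{u}} {A : CommRingCat.{u}} (j : Spec A ⟶ X) [IsOpenImmersion j] :
    A ≃+* Γ(X, j ''ᵁ ⊤) :=
  ((ΓSpecIso A).symm ≪≫ (j.appIso ⊤).symm).commRingCatIsoToRingEquiv

lemma exists_ringEquiv_pullIdeal {X : Scheme.{u}} {A : CommRingCat.{u}}
    (j : Spec A ⟶ X) [IsOpenImmersion j] (U : X.affineOpens) (hU : j ''ᵁ ⊤ = U.1) :
    ∃ e : A ≃+* Γ(X, U.1), ∀ I : X.IdealSheafData, pullIdeal I j = (I.ideal U).comap e := by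
  obtain ⟨U, hU'⟩ := U
  subst hU
  exact ⟨chartIso j, fun I => pullIdeal_of_isOpenImmersion I j⟩

lemma mem_nonZeroDivisors_of_ringEquiv {A B : Type*} [CommRing A] [CommRing B] (e : A ≃+* B)
    {a : A} (ha : a ∈ nonZeroDivisors A) : e a ∈ nonZeroDivisors B := by
  rw [mem_nonZeroDivisors_iff_right] at ha ⊢
  intro y hy
  have := ha (e.symm y) (by rw [← e.injective.eq_iff]; simpa using hy)
  simpa using this

/-- Replaces the affine opens of the definition by open immersions from spectra, along which inverse
images of ideals are computed by ring maps. -/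
lemma isInvertibleIdeal_iff {X : Scheme.{u}} (I : X.IdealSheafData) :
    IsInvertibleIdeal I ↔ ∀ x : X, ∃ (A : CommRingCat.{u}) (j : Spec A ⟶ X)
      (_ : IsOpenImmersion j), x ∈ Set.range j ∧ ∃ h ∈ nonZeroDivisors A,
        pullIdeal I j = Ideal.span {h} := by
  refine forall_congr' fun x => ⟨?_, ?_⟩
  · rintro ⟨U, hx, g, hg, hI⟩
    have hU : IsAffineOpen U.1 := U.2
    obtain ⟨e, he⟩ := exists_ringEquiv_pullIdeal hU.fromSpec U (by simp)
    refine ⟨_, hU.fromSpec, inferInstance, by simpa using hx, e.symm g, ?_, ?_⟩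
    · exact mem_nonZeroDivisors_of_ringEquiv e.symm hg
    · rw [he, hI, ← Ideal.map_symm, Ideal.map_span, Set.image_singleton]
  · rintro ⟨A, j, hj, hx, h, hh, hI⟩
    obtain ⟨e, he⟩ := exists_ringEquiv_pullIdeal j
      ⟨j ''ᵁ ⊤, (isAffineOpen_top _).image_of_isOpenImmersion j⟩ rfl
    refine ⟨⟨j ''ᵁ ⊤, (isAffineOpen_top _).image_of_isOpenImmersion j⟩, by simpa using hx,
      e h, mem_nonZeroDivisors_of_ringEquiv e hh, ?_⟩
    rw [he] at hI
    rw [← Set.image_singleton, ← Ideal.map_span, ← hI, Ideal.map_comap_of_surjective _ e.surjective]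

lemma mem_range_specMap_away {A : CommRingCat.{u}} (e : A) (q : Spec A) :
    q ∈ Set.range (Spec.map (CommRingCat.ofHom (algebraMap A (Localization.Away e)))) ↔
      e ∉ q.asIdeal :=
  Set.ext_iff.mp (PrimeSpectrum.localization_away_comap_range (Localization.Away e) e) q

/-- An open immersion from an affine scheme can be shrunk to a basic open set. -/
lemma exists_away_range_subset {X : Scheme.{u}} {A : CommRingCat.{u}} (j : Spec A ⟶ X)
    (V : X.Opens) (x : X) (hx : x ∈ Set.range j) (hxV : x ∈ V) :
    ∃ e : A, x ∈ Set.range (Spec.map (CommRingCat.ofHom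
        (algebraMap A (Localization.Away e))) ≫ j) ∧
      Set.range (Spec.map (CommRingCat.ofHom (algebraMap A (Localization.Away e))) ≫ j) ⊆ V := by
  obtain ⟨p, rfl⟩ := hx
  obtain ⟨_, ⟨_, ⟨e, rfl⟩, rfl⟩, hpe, he⟩ :=
    PrimeSpectrum.isBasis_basic_opens.exists_subset_of_mem_open
    (show p ∈ (j ⁻¹ᵁ V : Set _) from hxV) (j ⁻¹ᵁ V).isOpen
  refine ⟨e, ?_, ?_⟩
  · obtain ⟨q, hq⟩ := (mem_range_specMap_away e p).2 hpe
    exact ⟨q, by simp [hq]⟩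
  · rintro _ ⟨q, rfl⟩
    exact he ((mem_range_specMap_away e _).1 ⟨q, rfl⟩)

lemma IsInvertibleIdeal.exists_chart {X : Scheme.{u}} {I : X.IdealSheafData}
    (hI : IsInvertibleIdeal I) (x : X) (V : X.Opens) (hxV : x ∈ V) :
    ∃ (A : CommRingCat.{u}) (j : Spec A ⟶ X)
      (_ : IsOpenImmersion j), x ∈ Set.range j ∧ Set.range j ⊆ V ∧ ∃ h ∈ nonZeroDivisors A,
        pullIdeal I j = Ideal.span {h} := by
  obtain ⟨A, j, hj, hx, h, hh, hI⟩ := (isInvertibleIdeal_iff I).1 hI x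
  obtain ⟨e, he, heV⟩ := exists_away_range_subset j V x hx hxV
  refine ⟨_, _, inferInstance, he, heV, algebraMap A _ h, ?_, ?_⟩
  · exact IsLocalization.map_nonZeroDivisors_le (Submonoid.powers e) (Localization.Away e)
      ⟨h, hh, rfl⟩
  · rw [pullIdeal_specMap_comp, hI, Ideal.map_span, Set.image_singleton]
    rfl

lemma IsInvertibleIdeal.comap_of_isOpenImmersion {X Y : Scheme.{u}} {I : X.IdealSheafData}
    (hI : IsInvertibleIdeal I) (f : Y ⟶ X) [IsOpenImmersion f] :
    IsInvertibleIdeal (I.comap f) := by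
  rw [isInvertibleIdeal_iff]
  intro y
  obtain ⟨A, j, hj, hy, hV, h, hh, hI⟩ := hI.exists_chart (f y) f.opensRange ⟨y, rfl⟩
  have hV' : Set.range j ⊆ Set.range f := hV
  refine ⟨A, IsOpenImmersion.lift f j hV', IsOpenImmersion.of_comp _ f, ?_, h, hh, ?_⟩
  · obtain ⟨a, ha⟩ := hy
    refine ⟨a, f.isOpenEmbedding.injective ?_⟩
    rw [← Scheme.Hom.comp_apply, IsOpenImmersion.lift_fac, ha]
  · rw [pullIdeal_comap, IsOpenImmersion.lift_fac, hI]

lemma specIdeal_le_asIdeal_iff {A : CommRingCat.{u}} (J : (Spec A).IdealSheafData) (p : Spec A) :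
    specIdeal J ≤ p.asIdeal ↔ p ∈ J.support := by
  rw [IdealSheafData.mem_support_iff_of_mem
    (U := ⟨⊤, isAffineOpen_top (Spec A)⟩) (x := p) trivial, Scheme.mem_zeroLocus_iff]
  constructor
  · intro h f hf
    have := @h ((ΓSpecIso A).hom f) (by simpa [specIdeal] using hf)
    have e : f = (ΓSpecIso A).inv ((ΓSpecIso A).hom f) := by simp
    rw [e, basicOpen_eq_of_affine]
    exact fun hn => hn this
  · intro h f hf
    have := h _ hf
    rw [basicOpen_eq_of_affine] at this
    exact not_not.1 this

lemma pullIdeal_le_asIdeal_iff {X : Scheme.{u}} (I : X.IdealSheafData) {A : CommRingCat.{u}}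
    (j : Spec A ⟶ X) (p : Spec A) : pullIdeal I j ≤ p.asIdeal ↔ j p ∈ I.support := by
  rw [pullIdeal, specIdeal_le_asIdeal_iff, IdealSheafData.support_comap]
  rfl

/-- The vanishing ideal of a closed set pulls back along an open immersion to the vanishing
ideal of the preimage. -/
lemma pullIdeal_vanishingIdeal {X : Scheme.{u}} (C : Closeds X) {A : CommRingCat.{u}}
    (j : Spec A ⟶ X) [IsOpenImmersion j] {I : Ideal A} (hI : I.IsRadical)
    (hC : ∀ p : Spec A, j p ∈ C ↔ I ≤ p.asIdeal) :
    pullIdeal (IdealSheafData.vanishingIdeal C) j = I := by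
  have h1 := pullIdeal_le_asIdeal_iff (IdealSheafData.vanishingIdeal C) j
  have h2 : (pullIdeal (IdealSheafData.vanishingIdeal C) j).IsRadical := by
    obtain ⟨e, he⟩ := exists_ringEquiv_pullIdeal j
      ⟨j ''ᵁ ⊤, (isAffineOpen_top _).image_of_isOpenImmersion j⟩ rfl
    rw [he]
    exact Ideal.IsRadical.comap _ (PrimeSpectrum.isRadical_vanishingIdeal _)
  have h3 : ∀ p : Spec A, p ∈ (IdealSheafData.vanishingIdeal C).support.preimage j.continuous ↔
      j p ∈ C := fun p => by
    rw [← SetLike.mem_coe, Closeds.coe_preimage, IdealSheafData.coe_support_vanishingIdeal]; rfl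
  have h4 : ∀ p : PrimeSpectrum A, pullIdeal (IdealSheafData.vanishingIdeal C) j ≤ p.asIdeal ↔
      I ≤ p.asIdeal := fun p => (h1 p).trans ((h3 p).trans (hC p))
  rw [← h2.radical, ← PrimeSpectrum.vanishingIdeal_zeroLocus_eq_radical, ← hI.radical,
    ← PrimeSpectrum.vanishingIdeal_zeroLocus_eq_radical]
  congr 1
  ext p
  exact h4 p

end IdealLayer

/-! ### A local criterion for a morphism to be a blow-up. -/

section BlowupCriterion

lemma finTwo_eq_or_rev (s t : Fin 2) : t = s ∨ t = s.rev := by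
  fin_cases s <;> fin_cases t <;> simp [Fin.rev]

/-- A cover of a scheme by open immersions, one for each point. -/
def pointCover (X : Scheme.{u}) (U : X → Scheme.{u}) (f : ∀ x, U x ⟶ X)
    [∀ x, IsOpenImmersion (f x)] (h : ∀ x, x ∈ Set.range (f x)) : X.OpenCover where
  I₀ := X
  X := U
  f := f
  mem₀ := by
    rw [Scheme.presieve₀_mem_precoverage_iff]
    exact ⟨fun x => ⟨x, h x⟩, inferInstance⟩

lemma hom_ext_of_charts {X Y : Scheme.{u}} (f g : X ⟶ Y)
    (H : ∀ x : X, ∃ (U : Scheme.{u}) (i : U ⟶ X) (_ : IsOpenImmersion i),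
      x ∈ Set.range i ∧ i ≫ f = i ≫ g) : f = g := by
  choose U i hi hx h using H
  exact (pointCover X U i hx).hom_ext _ _ h

lemma existsUnique_hom_of_cover {T X X' : Scheme.{u}} (π : X' ⟶ X) (f : T ⟶ X)
    (𝒰 : T.OpenCover) (g : ∀ x, 𝒰.X x ⟶ X') (hg : ∀ x, g x ≫ π = 𝒰.f x ≫ f)
    (huniq : ∀ (U : Scheme.{u}) (i : U ⟶ T) (_ : IsOpenImmersion i) (g g' : U ⟶ X'),
      g ≫ π = i ≫ f → g' ≫ π = i ≫ f → g = g') :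
    ∃! g : T ⟶ X', g ≫ π = f := by
  have hglue : ∀ x y, pullback.fst (𝒰.f x) (𝒰.f y) ≫ g x = pullback.snd _ _ ≫ g y := by
    intro x y
    refine huniq _ (pullback.fst (𝒰.f x) (𝒰.f y) ≫ 𝒰.f x) inferInstance _ _ ?_ ?_
    · rw [Category.assoc, hg, Category.assoc]
    · rw [pullback.condition, Category.assoc, hg, Category.assoc]
  refine ⟨𝒰.glueMorphisms g hglue, ?_, fun g' hg' => ?_⟩
  · refine 𝒰.hom_ext _ _ fun x => ?_
    rw [← Category.assoc, Scheme.Cover.ι_glueMorphisms, hg]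
  · refine huniq T (𝟙 T) inferInstance _ _ (by simpa using hg') ?_
    rw [Category.id_comp]
    refine 𝒰.hom_ext _ _ fun x => ?_
    rw [← Category.assoc, Scheme.Cover.ι_glueMorphisms, hg]

/-- Morphisms given locally glue if they are unique. -/
lemma existsUnique_hom_of_local {T X X' : Scheme.{u}} (π : X' ⟶ X) (f : T ⟶ X)
    (hex : ∀ t : T, ∃ (U : Scheme.{u}) (i : U ⟶ T) (_ : IsOpenImmersion i),
      t ∈ Set.range i ∧ ∃ g : U ⟶ X', g ≫ π = i ≫ f)
    (huniq : ∀ (U : Scheme.{u}) (i : U ⟶ T) (_ : IsOpenImmersion i) (g g' : U ⟶ X'),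
      g ≫ π = i ≫ f → g' ≫ π = i ≫ f → g = g') :
    ∃! g : T ⟶ X', g ≫ π = f := by
  choose U i hi hx g hg using hex
  exact existsUnique_hom_of_cover π f (pointCover T U i hx) g hg huniq

/-- Affine charts `Spec A` of `X` and `Spec (B 0)`, `Spec (B 1)` of `X'`, contained in a field `K`,
such that `I` is generated on `Spec A` by two elements `a 0`, `a 1`, and `B s` is generated over `A`
by the quotient of the two. -/
structure BlowupChart {X' X : Scheme.{u}} (π : X' ⟶ X) (I : X.IdealSheafData) (K : Type u)
    [Field K] where
  A : CommRingCat.{u}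
  j : Spec A ⟶ X
  [open_j : IsOpenImmersion j]
  φ : A →+* K
  φ_injective : Function.Injective φ
  a : Fin 2 → A
  a_ne_zero : ∀ s, a s ≠ 0
  pullIdeal_eq : pullIdeal I j = Ideal.span (Set.range a)
  B : Fin 2 → CommRingCat.{u}
  i : ∀ s, Spec (B s) ⟶ X'
  [open_i : ∀ s, IsOpenImmersion (i s)]
  ψ : ∀ s, B s →+* K
  ψ_injective : ∀ s, Function.Injective (ψ s)
  incl : ∀ s, A ⟶ B s
  ψ_incl : ∀ s, (ψ s).comp (incl s).hom = φ
  τ : ∀ s, B s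
  ψ_τ : ∀ s, ψ s (τ s) = φ (a s.rev) / φ (a s)
  surj : ∀ s (b : B s), ∃ F : Polynomial A, F.eval₂ (incl s).hom (τ s) = b
  comm : ∀ s, i s ≫ π = Spec.map (incl s) ≫ j
  cover : ∀ y : X', π y ∈ Set.range j → ∃ s, y ∈ Set.range (i s)
  overlap : ∀ s (q : Spec (B s)), τ s ∉ q.asIdeal → i s q ∈ Set.range (i s.rev)

attribute [instance] BlowupChart.open_j BlowupChart.open_i

namespace BlowupChart

variable {X' X : Scheme.{u}} {π : X' ⟶ X} {I : X.IdealSheafData} {K : Type u} [Field K]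
  (d : BlowupChart π I K)

lemma φ_a_ne_zero (s : Fin 2) : d.φ (d.a s) ≠ 0 :=
  (map_ne_zero_iff _ d.φ_injective).2 (d.a_ne_zero s)

lemma τ_mul (s : Fin 2) : (d.incl s).hom (d.a s) * d.τ s = (d.incl s).hom (d.a s.rev) := by
  apply d.ψ_injective s
  have h (x) : d.ψ s ((d.incl s).hom x) = d.φ x := DFunLike.congr_fun (d.ψ_incl s) x
  rw [map_mul, h, h, d.ψ_τ, mul_div_cancel₀ _ (d.φ_a_ne_zero s)]

/-- The image of `τ s` is forced by `τ_mul`, since the image of `a s` can be cancelled. -/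
lemma hom_ext_of_incl {s : Fin 2} {R : Type u} [CommRing R] {g g' : d.B s →+* R}
    (h : g.comp (d.incl s).hom = g'.comp (d.incl s).hom)
    (hs : g ((d.incl s).hom (d.a s)) ∈ nonZeroDivisors R) : g = g' := by
  have h' (x) : g ((d.incl s).hom x) = g' ((d.incl s).hom x) := DFunLike.congr_fun h x
  have hτ : g (d.τ s) = g' (d.τ s) := by
    have h1 := congrArg g (d.τ_mul s)
    have h2 := congrArg g' (d.τ_mul s)
    rw [map_mul] at h1 h2
    rw [← h', ← h', ← h1] at h2
    exact ((mul_cancel_left_mem_nonZeroDivisors hs).1 h2).symm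
  ext b
  obtain ⟨F, rfl⟩ := d.surj s b
  rw [Polynomial.hom_eval₂, Polynomial.hom_eval₂, h, hτ]

/-- `B s` is a quotient of `A[t]`, so it suffices that every relation $F(\tau)=0$ is respected by
`r`. Clearing denominators with `scaleRoots` turns the relation into an identity between `a s` and
`a s.rev` in `A`. Its image in `R` is $f(a_s)^{\deg F}F(r)=0$, and the power cancels. -/
lemma exists_lift {s : Fin 2} {R : Type u} [CommRing R] (f : d.A →+* R) (r : R)
    (hs : f (d.a s) ∈ nonZeroDivisors R) (hr : f (d.a s) * r = f (d.a s.rev)) :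
    ∃ g : d.B s →+* R, g.comp (d.incl s).hom = f := by
  let e : Polynomial d.A →+* d.B s := Polynomial.eval₂RingHom (d.incl s).hom (d.τ s)
  have he : Function.Surjective e := d.surj s
  have hker : RingHom.ker e ≤ RingHom.ker (Polynomial.eval₂RingHom f r) := by
    intro F hF
    rw [RingHom.mem_ker] at hF ⊢
    have h1 : (F.scaleRoots (d.a s)).eval (d.a s.rev) = 0 := by
      apply d.φ_injective
      rw [map_zero, ← Polynomial.eval₂_at_apply,
        show d.φ (d.a s.rev) = d.φ (d.a s) * (d.φ (d.a s.rev) / d.φ (d.a s)) by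
          rw [mul_div_cancel₀ _ (d.φ_a_ne_zero s)]]
      apply Polynomial.scaleRoots_eval₂_eq_zero
      rw [← d.ψ_τ, ← d.ψ_incl s, ← Polynomial.hom_eval₂]
      exact (congrArg _ hF).trans (map_zero _)
    have h2 : f (d.a s) ^ F.natDegree * F.eval₂ f r = 0 := by
      rw [← Polynomial.scaleRoots_eval₂_mul, hr, Polynomial.eval₂_at_apply, h1, map_zero]
    exact (mul_left_mem_nonZeroDivisors_eq_zero_iff (pow_mem hs _)).1 h2
  refine ⟨RingHom.liftOfSurjective e he ⟨_, hker⟩, ?_⟩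
  ext x
  have := RingHom.liftOfSurjective_comp_apply e he ⟨_, hker⟩ (Polynomial.C x)
  simpa [e] using this

lemma exists_factor {R : CommRingCat.{u}} {s : Fin 2} (α : d.A ⟶ R) (g : Spec R ⟶ X')
    (hg : g ≫ π = Spec.map α ≫ d.j) (hr : Set.range g ⊆ Set.range (d.i s)) :
    ∃ γ : d.B s ⟶ R, g = Spec.map γ ≫ d.i s ∧ d.incl s ≫ γ = α := by
  obtain ⟨γ, hγ⟩ := Spec.map_surjective (IsOpenImmersion.lift (d.i s) g hr)
  have h : g = Spec.map γ ≫ d.i s := by rw [hγ, IsOpenImmersion.lift_fac]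
  refine ⟨γ, h, ?_⟩
  apply Spec.map_injective
  rw [← cancel_mono d.j, ← hg, h, Category.assoc, d.comm, Spec.map_comp, Category.assoc]

section Local

variable {R : CommRingCat.{u}} (α : d.A ⟶ R) {h : R} {b : Fin 2 → R}

-- If `h` generates the inverse image ideal and $a_s=h\,b_s$, then the $b_s$ are homogeneous
-- coordinates of the map to the exceptional direction. Where $b_s\ne0$ the map must land in the
-- chart with index `s`.
include d in
lemma mem_range_of_notMem (hh : h ∈ nonZeroDivisors R) (hb : ∀ s, α.hom (d.a s) = h * b s)
    (g : Spec R ⟶ X') (hg : g ≫ π = Spec.map α ≫ d.j) {s : Fin 2} (p : Spec R)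
    (hp : b s ∉ p.asIdeal) : g p ∈ Set.range (d.i s) := by
  obtain ⟨s', hs'⟩ := d.cover (g p) (by
    rw [← Scheme.Hom.comp_apply, hg, Scheme.Hom.comp_apply]; exact ⟨_, rfl⟩)
  obtain rfl | rfl := finTwo_eq_or_rev s s'
  · exact hs'
  obtain ⟨e, ⟨q, hq⟩, he⟩ := exists_away_range_subset (𝟙 (Spec R))
    (g ⁻¹ᵁ (d.i s.rev).opensRange) p (by simp) hs'
  replace hq : Spec.map (CommRingCat.ofHom (algebraMap R (Localization.Away e))) q = p := hq
  let R' := CommRingCat.of (Localization.Away e)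
  let ρ : R ⟶ R' := CommRingCat.ofHom (algebraMap R (Localization.Away e))
  obtain ⟨γ, hγ, hγα⟩ := d.exists_factor (s := s.rev) (α ≫ ρ) (Spec.map ρ ≫ g)
    (by rw [Category.assoc, hg, Spec.map_comp, Category.assoc])
    (by rintro _ ⟨q, rfl⟩; exact he ⟨q, rfl⟩)
  have hh' : ρ.hom h ∈ nonZeroDivisors R' :=
    IsLocalization.map_nonZeroDivisors_le (Submonoid.powers e) (Localization.Away e) ⟨h, hh, rfl⟩
  have hγ' : ∀ x, γ.hom ((d.incl s.rev).hom x) = ρ.hom (α.hom x) :=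
    fun x => ConcreteCategory.congr_hom hγα x
  have h1 := congrArg γ.hom (d.τ_mul s.rev)
  rw [map_mul, hγ', hγ', Fin.rev_rev, hb, hb, map_mul, map_mul, mul_assoc,
    mul_cancel_left_mem_nonZeroDivisors hh'] at h1
  -- Cancelling `h` has given $b_{\mathrm{rev}\,s}\,\gamma(\tau)=b_s$, so `τ` cannot vanish where
  -- $b_s$ does not.
  have h2 : d.τ s.rev ∉ (Spec.map γ q).asIdeal := by
    intro hn
    have hn' : γ.hom (d.τ s.rev) ∈ q.asIdeal := hn
    have h3 : ρ.hom (b s) ∈ q.asIdeal := h1 ▸ Ideal.mul_mem_left _ _ hn'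
    apply hp
    rw [← hq]
    exact h3
  have h4 := d.overlap s.rev _ h2
  rw [Fin.rev_rev, ← Scheme.Hom.comp_apply, ← hγ, Scheme.Hom.comp_apply] at h4
  rw [← hq]
  exact h4

include d in
lemma hom_ext_of_local (hh : h ∈ nonZeroDivisors R) (hb : ∀ s, α.hom (d.a s) = h * b s)
    (hb1 : Ideal.span (Set.range b) = ⊤)
    (g g' : Spec R ⟶ X') (hg : g ≫ π = Spec.map α ≫ d.j) (hg' : g' ≫ π = Spec.map α ≫ d.j) :
    g = g' := by
  refine hom_ext_of_charts _ _ fun p => ?_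
  obtain ⟨s, hs⟩ : ∃ s, b s ∉ p.asIdeal := by
    by_contra! hn
    refine p.isPrime.ne_top (top_le_iff.1 (hb1 ▸ ?_))
    rw [Ideal.span_le]
    rintro _ ⟨s, rfl⟩
    exact hn s
  let R' := CommRingCat.of (Localization.Away (b s))
  let ρ : R ⟶ R' := CommRingCat.ofHom (algebraMap R (Localization.Away (b s)))
  have hρ : ∀ q, Spec.map ρ q ∈ Set.range (Spec.map ρ) := fun q => ⟨q, rfl⟩
  have key : ∀ g : Spec R ⟶ X', g ≫ π = Spec.map α ≫ d.j →
      ∃ γ : d.B s ⟶ R', Spec.map ρ ≫ g = Spec.map γ ≫ d.i s ∧ d.incl s ≫ γ = α ≫ ρ := by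
    intro g hg
    refine d.exists_factor (α ≫ ρ) _ (by rw [Category.assoc, hg, Spec.map_comp, Category.assoc]) ?_
    rintro _ ⟨q, rfl⟩
    rw [Scheme.Hom.comp_apply]
    exact d.mem_range_of_notMem α hh hb g hg _ ((mem_range_specMap_away _ _).1 (hρ q))
  obtain ⟨γ, h1, h2⟩ := key g hg
  obtain ⟨γ', h1', h2'⟩ := key g' hg'
  refine ⟨_, Spec.map ρ, inferInstance, (mem_range_specMap_away _ _).2 hs, ?_⟩
  have : γ = γ' := by
    ext1
    refine d.hom_ext_of_incl ?_ ?_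
    · rw [← CommRingCat.hom_comp, h2, ← h2', CommRingCat.hom_comp]
    · rw [← CommRingCat.comp_apply, h2, CommRingCat.comp_apply]
      change ρ.hom (α.hom (d.a s)) ∈ _
      rw [hb, map_mul]
      refine mul_mem ?_ (IsUnit.mem_nonZeroDivisors
        (IsLocalization.map_units (Localization.Away (b s)) ⟨b s, Submonoid.mem_powers _⟩))
      exact IsLocalization.map_nonZeroDivisors_le (Submonoid.powers (b s))
        (Localization.Away (b s)) ⟨h, hh, rfl⟩
  rw [h1, h1', this]

include d in
lemma exists_local_lift (hh : h ∈ nonZeroDivisors R) (hb : ∀ s, α.hom (d.a s) = h * b s)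
    (hb1 : Ideal.span (Set.range b) = ⊤) (p : Spec R) :
    ∃ (U : Scheme.{u}) (i : U ⟶ Spec R) (_ : IsOpenImmersion i),
      p ∈ Set.range i ∧ ∃ g : U ⟶ X', g ≫ π = i ≫ Spec.map α ≫ d.j := by
  obtain ⟨s, hs⟩ : ∃ s, b s ∉ p.asIdeal := by
    by_contra! hn
    refine p.isPrime.ne_top (top_le_iff.1 (hb1 ▸ ?_))
    rw [Ideal.span_le]
    rintro _ ⟨s, rfl⟩
    exact hn s
  let R' := CommRingCat.of (Localization.Away (b s))
  let ρ : R ⟶ R' := CommRingCat.ofHom (algebraMap R (Localization.Away (b s)))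
  have hu : IsUnit (ρ.hom (b s)) :=
    IsLocalization.map_units (Localization.Away (b s)) ⟨b s, Submonoid.mem_powers _⟩
  obtain ⟨r, hr⟩ := hu.exists_right_inv
  obtain ⟨γ, hγ⟩ := d.exists_lift (s := s) (α ≫ ρ).hom (ρ.hom (b s.rev) * r)
    (by
      change ρ.hom (α.hom (d.a s)) ∈ _
      rw [hb, map_mul]
      exact mul_mem (IsLocalization.map_nonZeroDivisors_le (Submonoid.powers (b s))
        (Localization.Away (b s)) ⟨h, hh, rfl⟩) hu.mem_nonZeroDivisors)
    (by
      change ρ.hom (α.hom (d.a s)) * _ = ρ.hom (α.hom (d.a s.rev))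
      rw [hb, hb, map_mul, map_mul]
      linear_combination (ρ.hom h * ρ.hom (b s.rev)) * hr)
  refine ⟨_, Spec.map ρ, inferInstance, (mem_range_specMap_away _ _).2 hs,
    Spec.map (CommRingCat.ofHom γ) ≫ d.i s, ?_⟩
  have : d.incl s ≫ CommRingCat.ofHom γ = α ≫ ρ := by
    ext1
    exact hγ
  rw [Category.assoc, d.comm, ← Category.assoc, ← Spec.map_comp, this, Spec.map_comp,
    Category.assoc]

end Local

/-- Near each point, a morphism with invertible inverse image ideal is given by ring maps. -/
lemma exists_local_data {T : Scheme.{u}} (f : T ⟶ X) (hI : IsInvertibleIdeal (I.comap f))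
    (hcov : ∀ x : X, ∃ d : BlowupChart π I K, x ∈ Set.range d.j) (t : T) :
    ∃ (R : CommRingCat.{u}) (i : Spec R ⟶ T) (_ : IsOpenImmersion i) (d : BlowupChart π I K)
      (α : d.A ⟶ R) (h : R) (b : Fin 2 → R), t ∈ Set.range i ∧ i ≫ f = Spec.map α ≫ d.j ∧
      h ∈ nonZeroDivisors R ∧ (∀ s, α.hom (d.a s) = h * b s) ∧
      Ideal.span (Set.range b) = ⊤ := by
  obtain ⟨d, hd⟩ := hcov (f t)
  obtain ⟨R, i, hi, ht, hV, h, hh, hI⟩ := hI.exists_chart t (f ⁻¹ᵁ d.j.opensRange) hd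
  have hr : Set.range (i ≫ f) ⊆ Set.range d.j := by
    rintro _ ⟨q, rfl⟩
    exact hV ⟨q, rfl⟩
  obtain ⟨α, hα⟩ := Spec.map_surjective (IsOpenImmersion.lift d.j (i ≫ f) hr)
  have hα' : i ≫ f = Spec.map α ≫ d.j := by rw [hα, IsOpenImmersion.lift_fac]
  rw [pullIdeal_comap, hα', pullIdeal_specMap_comp, d.pullIdeal_eq, Ideal.map_span] at hI
  have hb : ∀ s, ∃ b, α.hom (d.a s) = h * b := fun s => by
    have : α.hom (d.a s) ∈ Ideal.span {h} := hI ▸ Ideal.subset_span ⟨_, ⟨s, rfl⟩, rfl⟩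
    obtain ⟨b, hb⟩ := Ideal.mem_span_singleton'.1 this
    exact ⟨b, by rw [← hb, mul_comm]⟩
  choose b hb using hb
  refine ⟨R, i, hi, d, α, h, b, ht, hα', hh, hb, ?_⟩
  -- `h` is itself a combination of the products $h\,b_s$, and cancelling it writes 1 in terms of
  -- the $b_s$.
  have h1 : h ∈ Ideal.span (α.hom '' Set.range d.a) := hI ▸ Ideal.mem_span_singleton_self h
  rw [← Set.range_comp, Ideal.mem_span_range_iff_exists_fun] at h1
  obtain ⟨c, hc⟩ := h1
  rw [Ideal.eq_top_iff_one, Ideal.mem_span_range_iff_exists_fun]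
  refine ⟨c, (mul_cancel_left_mem_nonZeroDivisors hh).1 ?_⟩
  conv_rhs => rw [mul_one, ← hc]
  rw [Finset.mul_sum]
  refine Finset.sum_congr rfl fun s _ => ?_
  rw [Function.comp_apply, hb]
  ring

end BlowupChart

/-- A morphism covered by blow-up charts is a blow-up. -/
theorem isBlowup_of_charts {X' X : Scheme.{u}} {π : X' ⟶ X} {I : X.IdealSheafData}
    (K : Type u) [Field K] (hcov : ∀ x : X, ∃ d : BlowupChart π I K, x ∈ Set.range d.j) :
    IsBlowup I π := by
  refine ⟨?_, fun T f hf => existsUnique_hom_of_local π f ?_ ?_⟩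
  · rw [isInvertibleIdeal_iff]
    intro y
    obtain ⟨d, hd⟩ := hcov (π y)
    obtain ⟨s, hs⟩ := d.cover y hd
    refine ⟨d.B s, d.i s, inferInstance, hs, (d.incl s).hom (d.a s), ?_, ?_⟩
    · have : IsDomain (d.B s) := (d.ψ_injective s).isDomain (d.ψ s)
      refine mem_nonZeroDivisors_of_ne_zero fun h0 => d.φ_a_ne_zero s ?_
      rw [← d.ψ_incl s, RingHom.comp_apply, h0, map_zero]
    · rw [pullIdeal_comap, d.comm, pullIdeal_specMap_comp, d.pullIdeal_eq, Ideal.map_span]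
      apply le_antisymm <;> rw [Ideal.span_le]
      · rintro _ ⟨_, ⟨t, rfl⟩, rfl⟩
        rw [SetLike.mem_coe, Ideal.mem_span_singleton]
        obtain rfl | rfl := finTwo_eq_or_rev s t
        · exact dvd_rfl
        · exact ⟨_, (d.τ_mul s).symm⟩
      · rintro _ rfl
        exact Ideal.subset_span ⟨_, ⟨s, rfl⟩, rfl⟩
  · intro t
    obtain ⟨R, i, hi, d, α, h, b, ⟨p, rfl⟩, hα, hh, hb, hb1⟩ :=
      BlowupChart.exists_local_data f hf hcov t
    obtain ⟨U, i', hi', ⟨q, rfl⟩, g, hg⟩ := d.exists_local_lift α hh hb hb1 p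
    refine ⟨U, i' ≫ i, inferInstance, ⟨q, by simp⟩, g, ?_⟩
    rw [hg, ← hα, Category.assoc]
  · intro U i hi g g' hg hg'
    refine hom_ext_of_charts _ _ fun t => ?_
    have hI : IsInvertibleIdeal (I.comap (i ≫ f)) := by
      rw [Scheme.IdealSheafData.comap_comp]
      exact hf.comap_of_isOpenImmersion i
    obtain ⟨R, i', hi', d, α, h, b, ht, hα, hh, hb, hb1⟩ :=
      BlowupChart.exists_local_data (i ≫ f) hI hcov t
    refine ⟨_, i', hi', ht, d.hom_ext_of_local α hh hb hb1 _ _ ?_ ?_⟩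
    · rw [Category.assoc, hg, hα]
    · rw [Category.assoc, hg', hα]

end BlowupCriterion

/-! ### Affine charts of the closure of a field-valued point. -/

section ImageCharts

lemma isPullback_comp_mono {X Y Z : Scheme.{u}} (f : X ⟶ Y) (i : Y ⟶ Z) [Mono i] :
    IsPullback f (𝟙 X) i (f ≫ i) :=
  ⟨⟨by simp⟩, ⟨PullbackCone.IsLimit.mk _ (fun s => s.snd)
    (fun s => by rw [← cancel_mono i, s.condition, Category.assoc]) (fun s => by simp)
    (fun s m _ h => by simpa using h)⟩⟩

lemma specIdeal_ker {A B : CommRingCat.{u}} (α : A ⟶ B) :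
    specIdeal (Spec.map α).ker = RingHom.ker α.hom := by
  have : specIdeal (⊥ : (Spec B).IdealSheafData) = ⊥ := by
    ext x
    simp only [specIdeal, Scheme.IdealSheafData.ideal_bot, Pi.bot_apply, Ideal.mem_comap,
      Ideal.mem_bot]
    exact map_eq_zero_iff _ (ConcreteCategory.bijective_of_isIso (Scheme.ΓSpecIso B).inv).1
  rw [← Scheme.IdealSheafData.map_bot, specIdeal_map, this]
  rfl

lemma ker_comap_of_isOpenImmersion {X Y V : Scheme.{u}} (f : X ⟶ V) (i : V ⟶ Y)
    [IsOpenImmersion i] [QuasiCompact (f ≫ i)] : (f ≫ i).ker.comap i = f.ker := by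
  ext1
  funext W
  rw [Scheme.IdealSheafData.ideal_comap_of_isOpenImmersion,
    Scheme.ker_ideal_of_isPullback_of_isOpenImmersion _ _ _ _ (isPullback_comp_mono f i)]

lemma exists_hom_of_range_le {A B K : Type*} [CommRing A] [CommRing B] [CommRing K] (φ : A →+* K)
    (hφ : Function.Injective φ) (θ : B →+* K) (h : θ.range ≤ φ.range) :
    ∃ ρ : B →+* A, φ.comp ρ = θ := by
  let e : A ≃+* φ.range := RingEquiv.ofBijective φ.rangeRestrict
    ⟨fun a b hab => hφ (congrArg Subtype.val hab), φ.rangeRestrict_surjective⟩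
  refine ⟨e.symm.toRingHom.comp ((Subring.inclusion h).comp θ.rangeRestrict), ?_⟩
  ext b
  have := congrArg Subtype.val (e.apply_symm_apply (Subring.inclusion h (θ.rangeRestrict b)))
  exact this

/-- An affine chart of the scheme-theoretic image of a `K`-valued point. -/
lemma exists_image_chart {P : Scheme.{u}} {K : Type u} [Field K] (ζ : Spec (.of K) ⟶ P)
    [QuasiCompact ζ]
    {A B : CommRingCat.{u}} (i : Spec B ⟶ P) [IsOpenImmersion i] (θ : B →+* K)
    (hθ : Spec.map (CommRingCat.ofHom θ) ≫ i = ζ) (φ : A →+* K) (hφ : Function.Injective φ)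
    (h : φ.range = θ.range) :
    ∃ (j : Spec A ⟶ ζ.image) (_ : IsOpenImmersion j) (ρ : B ⟶ A), φ.comp ρ.hom = θ ∧
      j ≫ ζ.imageι = Spec.map ρ ≫ i ∧ Spec.map (CommRingCat.ofHom φ) ≫ j = ζ.toImage ∧
      ∀ y, y ∈ Set.range j ↔ ζ.imageι y ∈ Set.range i := by
  obtain ⟨ρ, hρ⟩ := exists_hom_of_range_le φ hφ θ h.ge
  have hρs : Function.Surjective ρ := by
    intro a
    obtain ⟨b, hb⟩ := h.le ⟨a, rfl⟩
    exact ⟨b, hφ (by rw [← hb, ← hρ]; rfl)⟩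
  have hker : RingHom.ker θ = RingHom.ker ρ := by
    ext b
    rw [RingHom.mem_ker, RingHom.mem_ker, ← hρ, RingHom.comp_apply, map_eq_zero_iff _ hφ]
  let ρ' : B ⟶ A := CommRingCat.ofHom ρ
  have hcl : IsClosedImmersion (Spec.map ρ') := IsClosedImmersion.spec_of_surjective ρ' hρs
  have hfac : Spec.map (CommRingCat.ofHom θ) =
      Spec.map (CommRingCat.ofHom φ) ≫ Spec.map ρ' := by
    rw [← Spec.map_comp, ← hρ]
    rfl
  have hcomap : ζ.ker.comap i = (Spec.map ρ').ker := by
    have : QuasiCompact (Spec.map (CommRingCat.ofHom θ) ≫ i) := hθ ▸ inferInstance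
    subst hθ
    rw [ker_comap_of_isOpenImmersion]
    apply specIdeal_injective
    rw [specIdeal_ker, specIdeal_ker]
    exact hker
  have hle : ζ.imageι.ker ≤ (Spec.map ρ' ≫ i).ker := by
    rw [Scheme.IdealSheafData.ker_subschemeι, Scheme.Hom.ker_comp,
      Scheme.IdealSheafData.le_map_iff_comap_le, hcomap]
  let j : Spec A ⟶ ζ.image := IsClosedImmersion.lift ζ.imageι (Spec.map ρ' ≫ i) hle
  have hj : j ≫ ζ.imageι = Spec.map ρ' ≫ i := IsClosedImmersion.lift_fac _ _ hle
  -- On the chart `i` the ideal sheaf of the closure restricts to the kernel of `ρ'`, so `Spec A` is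
  -- the whole preimage of that chart in the closure.
  have hpb : IsPullback (Spec.map ρ') j i ζ.imageι :=
    isPullback_of_isClosedImmersion _ _ _ _ hj.symm (by
      rw [Scheme.IdealSheafData.ker_subschemeι, hcomap])
  have hopen : IsOpenImmersion j := MorphismProperty.of_isPullback hpb inferInstance
  refine ⟨j, hopen, ρ', hρ, hj, ?_, fun y => ⟨?_, ?_⟩⟩
  · rw [← cancel_mono ζ.imageι, Category.assoc, hj, Scheme.Hom.toImage_imageι, ← hθ, hfac,
      Category.assoc]
  · rintro ⟨p, rfl⟩
    rw [← Scheme.Hom.comp_apply, hj]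
    exact ⟨_, rfl⟩
  · rintro ⟨q, hq⟩
    obtain ⟨p, -, hp⟩ := Scheme.exists_preimage_of_isPullback hpb q y hq
    exact ⟨p, hp⟩

end ImageCharts

/-! ### Field-valued points of projective space. -/

section ProjPoint

open HomogeneousLocalization

variable {A : Type u} [CommRing A] {σ : Type*} [SetLike σ A] [AddSubgroupClass σ A]
  (𝒜 : ℕ → σ) [GradedRing 𝒜] {K : Type u} [Field K] (ev : A →+* K)

/-- Evaluation of degree zero fractions at a point. -/
def evalAway (f : A) (hf : ev f ≠ 0) : Away 𝒜 f →+* K :=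
  (Localization.awayLift ev f (IsUnit.mk0 _ hf)).comp (algebraMap (Away 𝒜 f) (Localization.Away f))

lemma evalAway_mk {f : A} (hf : ev f ≠ 0) {d : ℕ} (hfd : f ∈ 𝒜 d) (m : ℕ) (a : A)
    (ha : a ∈ 𝒜 (m • d)) : evalAway 𝒜 ev f hf (Away.mk 𝒜 hfd m a ha) = ev a / ev f ^ m := by
  have h : ev f * (ev f)⁻¹ = 1 := mul_inv_cancel₀ hf
  simp only [evalAway, RingHom.comp_apply, HomogeneousLocalization.algebraMap_apply,
    Away.val_mk]
  rw [Localization.awayLift_mk (hv := h), inv_pow, div_eq_mul_inv]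

lemma evalAway_comp_awayMap {f g x : A} {d e : ℕ} (hfd : f ∈ 𝒜 d) (hg : g ∈ 𝒜 e) (hx : x = f * g)
    (hf : ev f ≠ 0) (hx0 : ev x ≠ 0) :
    (evalAway 𝒜 ev x hx0).comp (awayMap 𝒜 hg hx) = evalAway 𝒜 ev f hf := by
  ext z
  obtain ⟨m, a, ha, rfl⟩ := Away.mk_surjective 𝒜 hfd z
  rw [RingHom.comp_apply, awayMap_mk, evalAway_mk, evalAway_mk]
  subst hx
  have hg0 : ev g ≠ 0 := fun h => hx0 (by rw [map_mul, h, mul_zero])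
  simp only [map_mul, map_pow, mul_pow]
  rw [mul_div_mul_right _ _ (pow_ne_zero _ hg0)]

/-- The `K`-valued point of `Proj` with homogeneous coordinates `ev`. -/
def projPoint (f : A) {d : ℕ} (hfd : f ∈ 𝒜 d) (hd : 0 < d) (hf : ev f ≠ 0) :
    Spec (.of K) ⟶ Proj 𝒜 :=
  Spec.map (CommRingCat.ofHom (evalAway 𝒜 ev f hf)) ≫ Proj.awayι 𝒜 f hfd hd

/-- Shrinking to the smaller open set $D_+(fg)$ leaves the point unchanged. Comparing two charts on
their intersection then gives `projPoint_eq`. -/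
lemma projPoint_eq_mul {f g : A} {d e : ℕ} (hfd : f ∈ 𝒜 d) (hd : 0 < d) (hf : ev f ≠ 0)
    (hge : g ∈ 𝒜 e) (hg : ev g ≠ 0) :
    projPoint 𝒜 ev f hfd hd hf = projPoint 𝒜 ev (f * g) (SetLike.mul_mem_graded hfd hge)
      (hd.trans_le (d.le_add_right e)) (map_mul ev f g ▸ mul_ne_zero hf hg) := by
  rw [projPoint, projPoint, ← Proj.SpecMap_awayMap_awayι 𝒜 hfd hd hge rfl, ← Category.assoc,
    ← Spec.map_comp, ← evalAway_comp_awayMap 𝒜 ev hfd hge rfl hf]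
  · rfl
  · exact map_mul ev f g ▸ mul_ne_zero hf hg

lemma projPoint_eq {f g : A} {d e : ℕ} (hfd : f ∈ 𝒜 d) (hd : 0 < d) (hf : ev f ≠ 0)
    (hge : g ∈ 𝒜 e) (he : 0 < e) (hg : ev g ≠ 0) :
    projPoint 𝒜 ev f hfd hd hf = projPoint 𝒜 ev g hge he hg := by
  rw [projPoint_eq_mul 𝒜 ev hfd hd hf hge hg, projPoint_eq_mul 𝒜 ev hge he hg hfd hf]
  simp only [mul_comm f g, add_comm d e]

end ProjPoint

section ProjMv

attribute [local instance] MvPolynomial.gradedAlgebra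

variable (σ : Type) [Finite σ]

/-- The projective space with homogeneous coordinates indexed by `σ`. -/
abbrev projMv : Scheme.{0} := Proj (MvPolynomial.homogeneousSubmodule σ ℂ)

/-- The structure morphism of projective space. -/
abbrev projMvToSpec : projMv σ ⟶ Spec (.of ℂ) :=
  Proj.toSpecZero (MvPolynomial.homogeneousSubmodule σ ℂ) ≫ Spec.map (CommRingCat.ofHom
    (algebraMap ℂ (MvPolynomial.homogeneousSubmodule σ ℂ 0)))

instance : IsProper (projMvToSpec σ) := by
  have h0 : IsScalarTower ℂ (MvPolynomial.homogeneousSubmodule σ ℂ 0) (MvPolynomial σ ℂ) :=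
    ⟨fun r a m => smul_assoc r (a : MvPolynomial σ ℂ) m⟩
  have h1 : Algebra.FiniteType (MvPolynomial.homogeneousSubmodule σ ℂ 0) (MvPolynomial σ ℂ) :=
    Algebra.FiniteType.of_restrictScalars_finiteType ℂ _ _
  -- The degree zero part of the polynomial ring consists of the constants.
  have h2 : IsClosedImmersion (Spec.map (CommRingCat.ofHom
      (algebraMap ℂ (MvPolynomial.homogeneousSubmodule σ ℂ 0)))) := by
    apply IsClosedImmersion.spec_of_surjective
    rintro ⟨p, hp⟩
    rw [MvPolynomial.homogeneousSubmodule_zero] at hp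
    obtain ⟨c, rfl⟩ := Submodule.mem_one.1 hp
    exact ⟨c, rfl⟩
  infer_instance

variable {σ} {K : Type} [Field K] [Algebra ℂ K] (x : σ → K)

omit [Finite σ] in
lemma X_mem_homogeneousSubmodule (s : σ) :
    (MvPolynomial.X s : MvPolynomial σ ℂ) ∈ MvPolynomial.homogeneousSubmodule σ ℂ 1 :=
  MvPolynomial.isHomogeneous_X _ _

/-- The standard affine chart of projective space. -/
abbrev projChart (s : σ) :
    Spec (.of (HomogeneousLocalization.Away (MvPolynomial.homogeneousSubmodule σ ℂ)
      (MvPolynomial.X s : MvPolynomial σ ℂ))) ⟶ projMv σ :=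
  Proj.awayι (MvPolynomial.homogeneousSubmodule σ ℂ) (MvPolynomial.X s)
    (X_mem_homogeneousSubmodule s) one_pos

/-- Evaluation of the functions on a standard affine chart at a `K`-valued point. -/
abbrev projEval {s : σ} (hs : x s ≠ 0) :
    HomogeneousLocalization.Away (MvPolynomial.homogeneousSubmodule σ ℂ)
      (MvPolynomial.X s : MvPolynomial σ ℂ) →+* K :=
  evalAway (MvPolynomial.homogeneousSubmodule σ ℂ) (MvPolynomial.aeval x).toRingHom
    (MvPolynomial.X s) (by simpa using hs)

omit [Finite σ] in
lemma projChart_cover (y : projMv σ) : ∃ s, y ∈ Set.range (projChart s) := by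
  have := Proj.iSup_basicOpen_eq_top' (MvPolynomial.homogeneousSubmodule σ ℂ)
    (fun s : σ => MvPolynomial.X s) (fun s => ⟨1, X_mem_homogeneousSubmodule s⟩) (by
      rw [← top_le_iff]
      rintro p -
      have hp : p ∈ Algebra.adjoin ℂ (Set.range (MvPolynomial.X : σ → MvPolynomial σ ℂ)) := by
        rw [MvPolynomial.adjoin_range_X]; trivial
      induction hp using Algebra.adjoin_induction with
      | mem x hx => exact Algebra.subset_adjoin hx
      | algebraMap r =>
        exact Subalgebra.algebraMap_mem _ (algebraMap ℂ (MvPolynomial.homogeneousSubmodule σ ℂ 0) r)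
      | add _ _ _ _ h1 h2 => exact add_mem h1 h2
      | mul _ _ _ _ h1 h2 => exact mul_mem h1 h2)
  have hy : y ∈ (⊤ : (projMv σ).Opens) := trivial
  rw [← this, Opens.mem_iSup] at hy
  obtain ⟨s, hs⟩ := hy
  refine ⟨s, ?_⟩
  rw [← Proj.opensRange_awayι _ _ (X_mem_homogeneousSubmodule s) one_pos] at hs
  exact hs

omit [Finite σ] in
lemma projEval_mk {s : σ} (hs : x s ≠ 0) (m : ℕ) (p : MvPolynomial σ ℂ)
    (hp : p ∈ MvPolynomial.homogeneousSubmodule σ ℂ (m • 1)) :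
    projEval x hs (HomogeneousLocalization.Away.mk _ (X_mem_homogeneousSubmodule s) m p hp) =
      MvPolynomial.aeval (fun t => x t / x s) p := by
  rw [projEval, evalAway_mk]
  have hp' : p.IsHomogeneous m := by simpa using hp
  have h1 : x = fun t => x s * (x t / x s) := by
    funext t; rw [mul_div_cancel₀ _ hs]
  have h2 : MvPolynomial.aeval x p = x s ^ m * MvPolynomial.aeval (fun t => x t / x s) p := by
    conv_lhs => rw [h1]
    rw [MvPolynomial.aeval_def, MvPolynomial.aeval_def, MvPolynomial.eval₂_eq,
      MvPolynomial.eval₂_eq, Finset.mul_sum]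
    refine Finset.sum_congr rfl fun d hd => ?_
    have hd' : d.degree = m := by
      by_contra hne
      exact MvPolynomial.mem_support_iff.1 hd (hp'.coeff_eq_zero hne)
    simp only [mul_pow]
    rw [Finset.prod_mul_distrib, Finset.prod_pow_eq_pow_sum, ← Finsupp.degree_apply, hd']
    ring
  simp only [AlgHom.toRingHom_eq_coe, RingHom.coe_coe, MvPolynomial.aeval_X]
  rw [h2, mul_div_cancel_left₀ _ (pow_ne_zero _ hs)]

omit [Finite σ] in
lemma range_projEval {s : σ} (hs : x s ≠ 0) :
    (projEval x hs).range = (Algebra.adjoin ℂ (Set.range fun t => x t / x s)).toSubring := by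
  apply le_antisymm
  · rintro _ ⟨z, rfl⟩
    obtain ⟨m, p, hp, rfl⟩ :=
      HomogeneousLocalization.Away.mk_surjective _ (X_mem_homogeneousSubmodule s) z
    rw [projEval_mk]
    exact (Algebra.adjoin_range_eq_range_aeval ℂ fun t => x t / x s).ge ⟨p, rfl⟩
  · intro z hz
    replace hz : z ∈ Algebra.adjoin ℂ (Set.range fun t => x t / x s) := hz
    induction hz using Algebra.adjoin_induction with
    | mem z hz =>
      obtain ⟨t, rfl⟩ := hz
      refine ⟨HomogeneousLocalization.Away.mk _ (X_mem_homogeneousSubmodule s) 1 (MvPolynomial.X t)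
        (X_mem_homogeneousSubmodule t), ?_⟩
      rw [projEval_mk, MvPolynomial.aeval_X]
    | algebraMap r =>
      refine ⟨HomogeneousLocalization.Away.mk _ (X_mem_homogeneousSubmodule s) 0 (MvPolynomial.C r)
        (by simp), ?_⟩
      rw [projEval_mk, MvPolynomial.aeval_C]
    | add _ _ _ _ h1 h2 => exact add_mem h1 h2
    | mul _ _ _ _ h1 h2 => exact mul_mem h1 h2

omit [Finite σ] in
lemma projEval_specMap_comp (s t : σ) (hs : x s ≠ 0) (ht : x t ≠ 0) :
    Spec.map (CommRingCat.ofHom (projEval x hs)) ≫ projChart s =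
      Spec.map (CommRingCat.ofHom (projEval x ht)) ≫ projChart t :=
  projPoint_eq _ _ (X_mem_homogeneousSubmodule s) one_pos (by simpa using hs)
    (X_mem_homogeneousSubmodule t) one_pos (by simpa using ht)

omit [Finite σ] in
lemma projEval_specMap_toSpec (s : σ) (hs : x s ≠ 0) :
    Spec.map (CommRingCat.ofHom (projEval x hs)) ≫ projChart s ≫ projMvToSpec σ =
      Spec.map (CommRingCat.ofHom (algebraMap ℂ K)) := by
  rw [projMvToSpec, Proj.awayι_toSpecZero_assoc, ← Spec.map_comp, ← Spec.map_comp]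
  congr 1
  ext r
  have h := projEval_mk x hs 0 (MvPolynomial.C r) (by simp)
  rw [MvPolynomial.aeval_C] at h
  refine Eq.trans ?_ h
  simp only [CommRingCat.hom_comp, CommRingCat.hom_ofHom, RingHom.comp_apply]
  congr 1

end ProjMv

/-! ### The closure of the graph of a rational map to the projective line. -/

section Line

attribute [local instance] MvPolynomial.gradedAlgebra

/-- The coordinate ring of a standard affine chart of projective space. -/
abbrev AwayMv (σ : Type) (s : σ) : Type :=
  HomogeneousLocalization.Away (MvPolynomial.homogeneousSubmodule σ ℂ)
    (MvPolynomial.X s : MvPolynomial σ ℂ)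

instance awayMvAlgebra (σ : Type) (s : σ) : Algebra ℂ (AwayMv σ s) :=
  ((HomogeneousLocalization.fromZeroRingHom (MvPolynomial.homogeneousSubmodule σ ℂ)
    (Submonoid.powers (MvPolynomial.X s : MvPolynomial σ ℂ))).comp
      (algebraMap ℂ (MvPolynomial.homogeneousSubmodule σ ℂ 0))).toAlgebra

lemma projChart_toSpec (σ : Type) (s : σ) : projChart s ≫ projMvToSpec σ =
    Spec.map (CommRingCat.ofHom (algebraMap ℂ (AwayMv σ s))) := by
  rw [projMvToSpec, Proj.awayι_toSpecZero_assoc, ← Spec.map_comp]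
  rfl

variable {K : Type} [Field K] [Algebra ℂ K]

lemma projEval_algebraMap {σ : Type} (x : σ → K) {s : σ} (hs : x s ≠ 0) (r : ℂ) :
    projEval x hs (algebraMap ℂ (AwayMv σ s) r) = algebraMap ℂ K r := by
  have h := projEval_specMap_toSpec x s hs
  rw [projChart_toSpec, ← Spec.map_comp] at h
  have h' := congrArg CommRingCat.Hom.hom (Spec.map_injective h)
  exact DFunLike.congr_fun h' r

/-- `projEval` as a homomorphism of algebras. -/
def projEvalₐ {σ : Type} (x : σ → K) {s : σ} (hs : x s ≠ 0) : AwayMv σ s →ₐ[ℂ] K where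
  __ := projEval x hs
  commutes' := projEval_algebraMap x hs

lemma projEvalₐ_range {σ : Type} (x : σ → K) {s : σ} (hs : x s ≠ 0) :
    (projEvalₐ x hs).range = Algebra.adjoin ℂ (Set.range fun t => x t / x s) := by
  apply SetLike.ext
  intro z
  exact SetLike.ext_iff.1 (range_projEval x hs) z

omit [Algebra ℂ K] in
lemma quasiCompact_of_spec_field {P : Scheme.{0}} (f : Spec (.of K) ⟶ P) : QuasiCompact f := by
  refine ⟨fun U _ _ => ?_⟩
  have : Subsingleton (Spec (.of K)) := inferInstanceAs (Subsingleton (PrimeSpectrum K))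
  exact (Set.subsingleton_of_subsingleton).isCompact

variable {X : Scheme.{0}} (p : X ⟶ Spec (.of ℂ)) (ξ : Spec (.of K) ⟶ X)
  (hξ : ξ ≫ p = Spec.map (CommRingCat.ofHom (algebraMap ℂ K))) (x : Fin 2 → K)
  (hx : ∀ s, x s ≠ 0)

/-- The `K`-valued point of `X × ℙ¹` with components `ξ` and `[x 0 : x 1]`. -/
def linePoint : Spec (.of K) ⟶ pullback p (projMvToSpec (Fin 2)) :=
  pullback.lift ξ (Spec.map (CommRingCat.ofHom (projEval x (hx 0))) ≫ projChart 0)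
    (by rw [hξ, Category.assoc, projEval_specMap_toSpec])

instance : QuasiCompact (linePoint p ξ hξ x hx) := quasiCompact_of_spec_field _

/-- The closure of the graph of the rational map `[x 0 : x 1]` from `X` to `ℙ¹`. -/
abbrev graph : Scheme.{0} := (linePoint p ξ hξ x hx).image

/-- The projection of the graph to `X`. -/
def graphFst : graph p ξ hξ x hx ⟶ X := (linePoint p ξ hξ x hx).imageι ≫ pullback.fst _ _

/-- The projection of the graph to `ℙ¹`. -/
def graphSnd : graph p ξ hξ x hx ⟶ projMv (Fin 2) :=
  (linePoint p ξ hξ x hx).imageι ≫ pullback.snd _ _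

/-- The generic point of the graph. -/
def graphPoint : Spec (.of K) ⟶ graph p ξ hξ x hx := (linePoint p ξ hξ x hx).toImage

instance : IsProper (graphFst p ξ hξ x hx) := by
  unfold graphFst
  infer_instance

lemma graphPoint_fst : graphPoint p ξ hξ x hx ≫ graphFst p ξ hξ x hx = ξ := by
  rw [graphPoint, graphFst, Scheme.Hom.toImage_imageι_assoc, linePoint, pullback.lift_fst]

/-- The product of the charts of `X` and of $\mathbb P^1$ is the spectrum of a tensor product. The
closure of the generic point in it has as coordinate ring the image of the tensor product in `K`,
which is the ring of the chart of `X` with the quotient `x s.rev / x s` adjoined. Any `B` embedded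
in `K` with this image can serve as the chart, in particular a polynomial ring. -/
lemma exists_graph_chart {A B : Type} [CommRing A] [Algebra ℂ A] [CommRing B] [Algebra ℂ B]
    (j : Spec (.of A) ⟶ X) [IsOpenImmersion j] (φ : A →ₐ[ℂ] K) (hφ : Function.Injective φ)
    (hj : Spec.map (CommRingCat.ofHom φ.toRingHom) ≫ j = ξ)
    (s : Fin 2) (ψ : B →ₐ[ℂ] K) (hψ : Function.Injective ψ)
    (hr : ψ.range = φ.range ⊔ Algebra.adjoin ℂ {x s.rev / x s}) :
    ∃ (i : Spec (.of B) ⟶ graph p ξ hξ x hx) (_ : IsOpenImmersion i) (incl : A →+* B)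
      (κ : AwayMv (Fin 2) s →+* B), (∀ a, ψ (incl a) = φ a) ∧
      (∀ z, ψ (κ z) = projEval x (hx s) z) ∧
      i ≫ graphFst p ξ hξ x hx = Spec.map (CommRingCat.ofHom incl) ≫ j ∧
      i ≫ graphSnd p ξ hξ x hx = Spec.map (CommRingCat.ofHom κ) ≫ projChart s ∧
      Spec.map (CommRingCat.ofHom ψ.toRingHom) ≫ i = graphPoint p ξ hξ x hx ∧
      ∀ y, y ∈ Set.range i ↔ graphFst p ξ hξ x hx y ∈ Set.range j ∧
        graphSnd p ξ hξ x hx y ∈ Set.range (projChart s) := by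
  -- The chart is a morphism over $\mathbb C$ because it is one at the generic point and `φ` is
  -- injective.
  have hjp : j ≫ p = Spec.map (CommRingCat.ofHom (algebraMap ℂ A)) := by
    obtain ⟨α, hα⟩ := Spec.map_surjective (j ≫ p)
    rw [← hα]
    congr 1
    ext r
    apply hφ
    have h := hξ
    rw [← hj, Category.assoc, ← hα, ← Spec.map_comp] at h
    exact (ConcreteCategory.congr_hom (Spec.map_injective h) r).trans (φ.commutes r).symm
  let m : pullback (Spec.map (CommRingCat.ofHom (algebraMap ℂ A)))
      (Spec.map (CommRingCat.ofHom (algebraMap ℂ (AwayMv (Fin 2) s)))) ⟶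
        pullback p (projMvToSpec (Fin 2)) :=
    pullback.map _ _ _ _ j (projChart s) (𝟙 _) (by rw [hjp, Category.comp_id])
      (by rw [projChart_toSpec, Category.comp_id])
  let i₀ : Spec (.of (TensorProduct ℂ A (AwayMv (Fin 2) s))) ⟶ pullback p (projMvToSpec (Fin 2)) :=
    (pullbackSpecIso ℂ A (AwayMv (Fin 2) s)).inv ≫ m
  have hfst : i₀ ≫ pullback.fst _ _ =
      Spec.map (CommRingCat.ofHom Algebra.TensorProduct.includeLeftRingHom) ≫ j := by
    simp only [i₀, m, Category.assoc, pullback.lift_fst, pullback.map]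
    rw [pullbackSpecIso_inv_fst_assoc]
  have hsnd : i₀ ≫ pullback.snd _ _ =
      Spec.map (CommRingCat.ofHom (Algebra.TensorProduct.includeRight
        (R := ℂ) (A := A) (B := AwayMv (Fin 2) s)).toRingHom) ≫ projChart s := by
    simp only [i₀, m, Category.assoc, pullback.lift_snd, pullback.map]
    rw [pullbackSpecIso_inv_snd_assoc]
    rfl
  let θ := Algebra.TensorProduct.productMap φ (projEvalₐ x (hx s))
  have hθ : Spec.map (CommRingCat.ofHom θ.toRingHom) ≫ i₀ = linePoint p ξ hξ x hx := by
    apply pullback.hom_ext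
    · rw [Category.assoc, hfst, linePoint, pullback.lift_fst, ← Spec.map_comp_assoc, ← hj]
      congr 2
      ext a
      simp [θ]
    · rw [Category.assoc, hsnd, linePoint, pullback.lift_snd, ← Spec.map_comp_assoc,
        projEval_specMap_comp x 0 s (hx 0) (hx s)]
      congr 2
      ext a
      simp [θ]
      rfl
  have hrange : ψ.toRingHom.range = θ.toRingHom.range := by
    have h1 : θ.range = ψ.range := by
      rw [hr, Algebra.TensorProduct.productMap_range, projEvalₐ_range]
      congr 1
      apply le_antisymm <;> rw [Algebra.adjoin_le_iff]
      · rintro _ ⟨t, rfl⟩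
        obtain rfl | rfl := finTwo_eq_or_rev s t
        · simp only [div_self (hx t)]
          exact one_mem _
        · exact Algebra.subset_adjoin rfl
      · rintro _ rfl
        exact Algebra.subset_adjoin ⟨s.rev, rfl⟩
    ext z
    exact (SetLike.ext_iff.1 h1 z).symm
  obtain ⟨i, hi, ρ, hρ, hiι, hiψ, hmem⟩ :=
    exists_image_chart (A := .of B) (linePoint p ξ hξ x hx) i₀ θ.toRingHom hθ ψ.toRingHom hψ hrange
  have hρ' : ∀ z, ψ (ρ.hom z) = θ z := fun z => DFunLike.congr_fun hρ z
  refine ⟨i, hi, ρ.hom.comp Algebra.TensorProduct.includeLeftRingHom,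
    ρ.hom.comp (Algebra.TensorProduct.includeRight
        (R := ℂ) (A := A) (B := AwayMv (Fin 2) s)).toRingHom, fun a => ?_, fun z => ?_, ?_, ?_,
        hiψ, fun y => ?_⟩
  · rw [RingHom.comp_apply, hρ']
    simp [θ]
  · rw [RingHom.comp_apply, hρ']
    simp [θ]
    rfl
  · rw [graphFst, ← Category.assoc, hiι, Category.assoc, hfst, ← Spec.map_comp_assoc]
    rfl
  · rw [graphSnd, ← Category.assoc, hiι, Category.assoc, hsnd, ← Spec.map_comp_assoc]
    rfl
  · rw [hmem]
    have h1 : Set.range i₀ = Set.range m := by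
      have := Scheme.Hom.opensRange_comp_of_isIso (pullbackSpecIso ℂ A (AwayMv (Fin 2) s)).inv m
      exact congrArg SetLike.coe this
    rw [h1, Scheme.Pullback.range_map]
    rfl

/-- `τ` is the pullback of the affine coordinate on the chart `s` of $\mathbb P^1$. Where it does
not vanish, the other homogeneous coordinate does not vanish either. -/
lemma mem_range_projChart_rev {s : Fin 2} {B : CommRingCat.{0}}
    (κ : AwayMv (Fin 2) s →+* B) (ψ : B →+* K) (hψ : Function.Injective ψ)
    (hκ : ∀ z, ψ (κ z) = projEval x (hx s) z) (τ : B) (hτ : ψ τ = x s.rev / x s) (q : Spec B)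
    (hq : τ ∉ q.asIdeal) :
    (Spec.map (CommRingCat.ofHom κ) ≫ projChart s) q ∈ Set.range (projChart s.rev) := by
  have h1 := Proj.awayι_preimage_basicOpen (MvPolynomial.homogeneousSubmodule (Fin 2) ℂ)
    (X_mem_homogeneousSubmodule s) one_pos (X_mem_homogeneousSubmodule s.rev) one_pos
  have h2 : Set.range (projChart s.rev) = (Proj.basicOpen (MvPolynomial.homogeneousSubmodule
      (Fin 2) ℂ) (MvPolynomial.X s.rev) : Set _) :=
    congrArg SetLike.coe (Proj.opensRange_awayι _ _ (X_mem_homogeneousSubmodule s.rev) one_pos)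
  rw [h2, Scheme.Hom.comp_apply]
  change Spec.map (CommRingCat.ofHom κ) q ∈ projChart s ⁻¹ᵁ
    Proj.basicOpen (MvPolynomial.homogeneousSubmodule (Fin 2) ℂ) (MvPolynomial.X s.rev)
  rw [projChart, h1]
  change κ _ ∉ q.asIdeal
  convert hq
  apply hψ
  rw [hκ, hτ, projEval_mk]
  simp

end Line

/-! ### The generic point of the quadric and the coordinate rings of the charts. -/

section QuadricPoint

/-- The prime ideal generated by a set of variables. -/
lemma isPrime_span_X_image {σ R : Type*} [CommRing R] [IsDomain R] (s : Set σ) :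
    (Ideal.span (MvPolynomial.X '' s : Set (MvPolynomial σ R))).IsPrime := by
  classical
  -- The endomorphism killing the variables in `s` and fixing the others is the identity modulo the
  -- ideal, so the ideal is its kernel. Its target is a domain.
  let f : MvPolynomial σ R →ₐ[R] MvPolynomial σ R :=
    MvPolynomial.aeval fun i => if i ∈ s then 0 else MvPolynomial.X i
  have h : RingHom.ker f = Ideal.span (MvPolynomial.X '' s) := by
    apply le_antisymm
    · intro p hp
      let q := Ideal.Quotient.mkₐ R (Ideal.span (MvPolynomial.X '' s : Set (MvPolynomial σ R)))
      have hq : q.comp f = q := by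
        ext i
        by_cases hi : i ∈ s
        · simp only [f, AlgHom.comp_apply, MvPolynomial.aeval_X, if_pos hi, map_zero]
          exact (Ideal.Quotient.eq_zero_iff_mem.2
            (Ideal.subset_span (Set.mem_image_of_mem MvPolynomial.X hi))).symm
        · simp [f, hi]
      apply Ideal.Quotient.eq_zero_iff_mem.1
      have h1 := DFunLike.congr_fun hq p
      rw [AlgHom.comp_apply, show f p = 0 from hp, map_zero] at h1
      exact h1.symm
    · rw [Ideal.span_le]
      rintro _ ⟨i, hi, rfl⟩
      simp [f, hi]
  rw [← h]
  exact RingHom.ker_isPrime _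

lemma X_mem_span_X_image_iff {σ R : Type*} [CommRing R] [Nontrivial R] {s : Set σ} {i : σ} :
    (MvPolynomial.X i : MvPolynomial σ R) ∈ Ideal.span (MvPolynomial.X '' s) ↔ i ∈ s := by
  classical
  rw [MvPolynomial.mem_ideal_span_X_image, MvPolynomial.support_X]
  simp [Finsupp.single_apply]

/-- Homogeneous coordinates in `K` of the generic point of the quadric. -/
structure QuadricPoint (n : ℕ) (K : Type) [Field K] [Algebra ℂ K] where
  x : Fin (n + 1) → Fin 2 → K
  ne_zero : ∀ i s, x i s ≠ 0
  sum_eq : ∑ i, x i 0 * x i 1 = 0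
  generates : ∀ F : IntermediateField ℂ K, (∀ i s j t, x i s / x j t ∈ F) → F = ⊤
  le_trdeg : ((2 * n : ℕ) : Cardinal) ≤ Algebra.trdeg ℂ K

/-- The labels of the coordinates on the affine charts with index `j`. -/
abbrev Var {n : ℕ} (j : Fin (n + 1)) : Type := {i : Fin (n + 1) // i ≠ j} × Fin 2

lemma card_var {n : ℕ} (j : Fin (n + 1)) : Fintype.card (Var j) = 2 * n := by
  rw [Fintype.card_prod, Fintype.card_subtype_compl]
  simp [mul_comm]

namespace QuadricPoint

variable {n : ℕ} {K : Type} [Field K] [Algebra ℂ K] (P : QuadricPoint n K)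
  (D : Set (Fin (n + 1))) (j : Fin (n + 1)) (ε : Fin (n + 1) → Fin 2)

lemma mul_eq_mul_rev (i : Fin (n + 1)) (s : Fin 2) :
    P.x i s * P.x i s.rev = P.x i 0 * P.x i 1 := by
  obtain rfl | rfl := finTwo_eq_or_rev 0 s
  · rfl
  · exact mul_comm _ _

open Classical in
/-- The coordinates on the chart with indices `j`, `ε` after blowing up the centres with index
in `D`. -/
def coord (v : Var j) : K :=
  if v.2 = 0 then P.x v.1 (ε v.1) / P.x j (ε j)
  else if (v.1 : Fin (n + 1)) ∈ D then P.x v.1 (ε v.1).rev / P.x v.1 (ε v.1)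
  else P.x v.1 (ε v.1).rev / P.x j (ε j)

/-- The inclusion of the coordinate ring of a chart in `K`. -/
def chartHom : MvPolynomial (Var j) ℂ →ₐ[ℂ] K := MvPolynomial.aeval (P.coord D j ε)

variable {D j ε}

lemma chartHom_X_zero (i : {i // i ≠ j}) : P.chartHom D j ε (MvPolynomial.X (i, 0)) =
    P.x i (ε i) / P.x j (ε j) := by
  simp [chartHom, coord]

lemma chartHom_X_one_of_mem (i : {i // i ≠ j}) (hi : (i : Fin (n + 1)) ∈ D) :
    P.chartHom D j ε (MvPolynomial.X (i, 1)) = P.x i (ε i).rev / P.x i (ε i) := by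
  simp [chartHom, coord, hi]

lemma chartHom_X_one_of_notMem (i : {i // i ≠ j}) (hi : (i : Fin (n + 1)) ∉ D) :
    P.chartHom D j ε (MvPolynomial.X (i, 1)) = P.x i (ε i).rev / P.x j (ε j) := by
  simp [chartHom, coord, hi]

lemma range_chartHom :
    (P.chartHom D j ε).range = Algebra.adjoin ℂ (Set.range (P.coord D j ε)) :=
  (Algebra.adjoin_range_eq_range_aeval ℂ _).symm

variable (D j ε)

lemma mem_range_of_eq (i : Fin (n + 1)) :
    P.x i (ε i) / P.x j (ε j) ∈ (P.chartHom D j ε).range := by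
  by_cases h : i = j
  · subst h
    rw [div_self (P.ne_zero _ _)]
    exact one_mem _
  · exact ⟨_, P.chartHom_X_zero ⟨i, h⟩⟩

lemma mem_range_of_ne (i : Fin (n + 1)) (hi : i ≠ j) :
    P.x i (ε i).rev / P.x j (ε j) ∈ (P.chartHom D j ε).range := by
  by_cases h : i ∈ D
  · have h1 := (P.chartHom_X_one_of_mem (ε := ε) ⟨i, hi⟩ h)
    have h2 := (P.chartHom_X_zero (ε := ε) (D := D) ⟨i, hi⟩)
    refine ⟨MvPolynomial.X (⟨i, hi⟩, 1) * MvPolynomial.X (⟨i, hi⟩, 0), ?_⟩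
    change P.chartHom D j ε _ = _
    rw [map_mul, h1, h2, div_mul_div_cancel₀ (P.ne_zero _ _)]
  · exact ⟨_, P.chartHom_X_one_of_notMem ⟨i, hi⟩ h⟩

/-- The equation of the quadric divided by $x_{j,\varepsilon(j)}^2$. It is the reason why only the
indices $i\ne j$ provide chart coordinates. -/
lemma x_rev_div_eq : P.x j (ε j).rev / P.x j (ε j) =
    -∑ i : {i // i ≠ j}, P.x i (ε i) / P.x j (ε j) * (P.x i (ε i).rev / P.x j (ε j)) := by
  classical
  have h := P.sum_eq
  rw [← Finset.add_sum_erase _ _ (Finset.mem_univ j), ← P.mul_eq_mul_rev j (ε j)] at h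
  have h2 : ∑ i : {i // i ≠ j}, P.x i (ε i) / P.x j (ε j) * (P.x i (ε i).rev / P.x j (ε j)) =
      (∑ i ∈ Finset.univ.erase j, P.x i 0 * P.x i 1) / P.x j (ε j) ^ 2 := by
    rw [Finset.sum_div, Finset.sum_subtype (p := fun i => i ≠ j) _ (by simp)]
    refine Finset.sum_congr rfl fun i _ => ?_
    rw [← P.mul_eq_mul_rev i (ε i), div_mul_div_comm, sq]
  rw [h2, eq_neg_of_add_eq_zero_right h]
  have := P.ne_zero j (ε j)
  field_simp

lemma exists_chartHom_eq (i : Fin (n + 1)) (s : Fin 2) :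
    ∃ a, P.chartHom D j ε a = P.x i s / P.x j (ε j) := by
  change P.x i s / P.x j (ε j) ∈ (P.chartHom D j ε).range
  obtain rfl | rfl := finTwo_eq_or_rev (ε i) s
  · exact P.mem_range_of_eq D j ε i
  · by_cases h : i = j
    · subst h
      rw [x_rev_div_eq]
      exact neg_mem (sum_mem fun k _ => mul_mem (P.mem_range_of_eq D i ε k)
        (P.mem_range_of_ne D i ε k k.2))
    · exact P.mem_range_of_ne D j ε i h

lemma adjoin_coord_eq_top : IntermediateField.adjoin ℂ (Set.range (P.coord D j ε)) = ⊤ := by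
  have h : ∀ i s, P.x i s / P.x j (ε j) ∈
      IntermediateField.adjoin ℂ (Set.range (P.coord D j ε)) := fun i s => by
    have h1 : P.x i s / P.x j (ε j) ∈ (P.chartHom D j ε).range := P.exists_chartHom_eq D j ε i s
    rw [range_chartHom] at h1
    exact IntermediateField.algebra_adjoin_le_adjoin _ _ h1
  refine P.generates _ fun i s k t => ?_
  rw [← div_div_div_cancel_right₀ (P.ne_zero j (ε j))]
  exact div_mem (h i s) (h k t)

lemma exists_chartHom_div_eq (z : K) : ∃ a b, P.chartHom D j ε b ≠ 0 ∧
    z = P.chartHom D j ε a / P.chartHom D j ε b := by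
  have hz : z ∈ IntermediateField.adjoin ℂ (Set.range (P.coord D j ε)) := by
    rw [adjoin_coord_eq_top]; trivial
  rw [IntermediateField.mem_adjoin_iff_div] at hz
  obtain ⟨a, ha, b, hb, rfl⟩ := hz
  rw [← range_chartHom] at ha hb
  obtain ⟨a, rfl⟩ := ha
  obtain ⟨b, rfl⟩ := hb
  -- `mem_adjoin_iff_div` allows the denominator 0, in which case the quotient is 0.
  by_cases h : P.chartHom D j ε b = 0
  · exact ⟨0, 1, by simp, by simpa using Or.inr h⟩
  · exact ⟨a, b, h, rfl⟩

/-- `K` is algebraic over the algebra generated by the $2n$ coordinates, being made of quotients of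
its elements, and has transcendence degree at least $2n$. So many generators cannot satisfy a
relation. -/
lemma algebraicIndependent_coord : AlgebraicIndependent ℂ (P.coord D j ε) := by
  have h1 : Algebra.IsAlgebraic (Algebra.adjoin ℂ (Set.range (P.coord D j ε))) K := by
    refine ⟨fun z => ?_⟩
    obtain ⟨a, b, -, rfl⟩ := P.exists_chartHom_div_eq D j ε z
    have h (a) : IsAlgebraic (Algebra.adjoin ℂ (Set.range (P.coord D j ε)))
        (P.chartHom D j ε a) := by
      have : P.chartHom D j ε a ∈ (P.chartHom D j ε).range := ⟨a, rfl⟩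
      rw [range_chartHom] at this
      exact isAlgebraic_algebraMap (⟨_, this⟩ : Algebra.adjoin ℂ (Set.range (P.coord D j ε)))
    rw [div_eq_mul_inv]
    exact (h a).mul (h b).inv
  refine (Algebra.IsAlgebraic.isTranscendenceBasis_of_le_trdeg_of_finite ℂ (P.coord D j ε) ?_).1
  rw [Cardinal.mk_fintype, card_var]
  exact P.le_trdeg

lemma chartHom_injective : Function.Injective (P.chartHom D j ε) :=
  P.algebraicIndependent_coord D j ε

/-- For $k\ne j$ the old coordinate $x_{k,1-\varepsilon(k)}/x_{j,\varepsilon(j)}$ is the product of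
the new one with $x_{k,\varepsilon(k)}/x_{j,\varepsilon(j)}$. For $k=j$ the adjoined quotient is
already in the ring. -/
lemma range_chartHom_insert (k : Fin (n + 1)) :
    (P.chartHom (insert k D) j ε).range =
      (P.chartHom D j ε).range ⊔ Algebra.adjoin ℂ {P.x k (ε k).rev / P.x k (ε k)} := by
  apply le_antisymm
  · rw [range_chartHom (D := insert k D), Algebra.adjoin_le_iff]
    rintro _ ⟨⟨i, s⟩, rfl⟩
    obtain rfl | rfl := finTwo_eq_or_rev 0 s
    · exact le_sup_left (a := (P.chartHom D j ε).range) ⟨_, P.chartHom_X_zero i⟩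
    · by_cases hk : i = k
      · subst hk
        have : P.coord (insert (i : Fin (n + 1)) D) j ε (i, Fin.rev 0) =
            P.x i (ε i).rev / P.x i (ε i) := by
          simp [coord]
        rw [this]
        exact le_sup_right (a := (P.chartHom D j ε).range) (Algebra.subset_adjoin rfl)
      · have : P.coord (insert k D) j ε (i, Fin.rev 0) = P.coord D j ε (i, Fin.rev 0) := by
          have hm : (i : Fin (n + 1)) ∈ insert k D ↔ (i : Fin (n + 1)) ∈ D := by
            rw [Set.mem_insert_iff, or_iff_right hk]
          by_cases hD : (i : Fin (n + 1)) ∈ D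
          · simp [coord, hD]
          · simp [coord, hD, mt hm.1 hD]
        rw [this]
        apply le_sup_left (a := (P.chartHom D j ε).range)
        rw [range_chartHom]
        exact Algebra.subset_adjoin ⟨_, rfl⟩
  · refine sup_le ?_ ?_
    · rw [range_chartHom, Algebra.adjoin_le_iff]
      rintro _ ⟨⟨i, s⟩, rfl⟩
      obtain rfl | rfl := finTwo_eq_or_rev 0 s
      · exact ⟨_, P.chartHom_X_zero i⟩
      · by_cases hk : (i : Fin (n + 1)) ∈ D
        · exact ⟨MvPolynomial.X (i, 1), by simp [chartHom, coord, Set.mem_insert_iff, hk]⟩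
        · have : P.coord D j ε (i, Fin.rev 0) = P.x i (ε i).rev / P.x j (ε j) := by
            simp [coord, hk]
          rw [this]
          exact P.mem_range_of_ne _ j ε i i.2
    · rw [Algebra.adjoin_le_iff]
      rintro _ rfl
      by_cases hk : k = j
      · subst hk
        exact P.exists_chartHom_eq _ k ε k _
      · exact ⟨_, P.chartHom_X_one_of_mem ⟨k, hk⟩ (Set.mem_insert _ _)⟩

end QuadricPoint

/-- The function field of the quadric. -/
abbrev QuadricField (n : ℕ) : Type := FractionRing (MvPolynomial (Fin n × Fin 2) ℂ)

/-- The generic point of the quadric. -/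
def genericCoord (n : ℕ) : Fin (n + 1) → Fin 2 → QuadricField n :=
  Fin.cons ![1, -∑ i : Fin n, algebraMap (MvPolynomial (Fin n × Fin 2) ℂ) (QuadricField n)
    (MvPolynomial.X (i, 0) * MvPolynomial.X (i, 1))]
    (fun i s => algebraMap (MvPolynomial (Fin n × Fin 2) ℂ) (QuadricField n) (MvPolynomial.X (i, s)))

/-- The generic point of the quadric. -/
def QuadricPoint.ofQuadricField (n : ℕ) (hn : n ≠ 0) : QuadricPoint n (QuadricField n) where
  x := genericCoord n
  ne_zero i s := by
    refine Fin.cases ?_ (fun i => ?_) i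
    · obtain rfl | rfl := finTwo_eq_or_rev 0 s
      · simp [genericCoord]
      · have : NeZero n := ⟨hn⟩
        simp only [genericCoord, Fin.cons_zero, ← map_sum]
        change - _ ≠ 0
        rw [neg_ne_zero, map_ne_zero_iff _ (IsFractionRing.injective _ _)]
        intro h
        -- At the point where both variables with index 0 are 1 and all others are 0, the sum takes
        -- the value 1.
        have := congrArg (MvPolynomial.eval (fun p : Fin n × Fin 2 => if p.1 = 0 then (1 : ℂ) else 0)) h
        simp at this
    · rw [genericCoord, Fin.cons_succ, map_ne_zero_iff _ (IsFractionRing.injective _ _)]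
      exact MvPolynomial.X_ne_zero _
  sum_eq := by
    rw [Fin.sum_univ_succ]
    simp [genericCoord]
  generates F hF := by
    rw [eq_top_iff]
    rintro z -
    have h1 : ∀ p : MvPolynomial (Fin n × Fin 2) ℂ, algebraMap _ (QuadricField n) p ∈ F := by
      intro p
      induction p using MvPolynomial.induction_on with
      | C a => exact F.algebraMap_mem a
      | add p q hp hq => rw [map_add]; exact add_mem hp hq
      | mul_X p i hp =>
        rw [map_mul]
        refine mul_mem hp ?_
        have := hF i.1.succ i.2 0 0
        simpa [genericCoord] using this
    obtain ⟨a, b, -, rfl⟩ := IsFractionRing.div_surjective (A := MvPolynomial (Fin n × Fin 2) ℂ) z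
    exact div_mem (h1 a) (h1 b)
  le_trdeg := by
    have h := trdeg_le_of_injective
      (IsScalarTower.toAlgHom ℂ (MvPolynomial (Fin n × Fin 2) ℂ) (QuadricField n))
      (IsFractionRing.injective _ _)
    rw [MvPolynomial.trdeg_of_isDomain] at h
    simpa [mul_comm] using h

end QuadricPoint

/-! ### The stages of the iterated blow-up and their charts. -/

section Stage

variable {n : ℕ} {K : Type} [Field K] [Algebra ℂ K]

/-- A proper birational model of the quadric, covered by the affine charts obtained after blowing
up the centres with index in `D`; `T k` is the total transform of the centre with index `k`. -/
structure Stage (P : QuadricPoint n K) (D : Set (Fin (n + 1))) {X : Scheme.{0}}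
    (p : X ⟶ Spec (.of ℂ)) (T : Fin (n + 1) → Closeds X) where
  [proper : IsProper p]
  ξ : Spec (.of K) ⟶ X
  ξ_comp : ξ ≫ p = Spec.map (CommRingCat.ofHom (algebraMap ℂ K))
  chart (j : Fin (n + 1)) (ε : Fin (n + 1) → Fin 2) : Spec (.of (MvPolynomial (Var j) ℂ)) ⟶ X
  [isOpenImmersion_chart : ∀ j ε, IsOpenImmersion (chart j ε)]
  specMap_chart : ∀ j ε, Spec.map (CommRingCat.ofHom (P.chartHom D j ε).toRingHom) ≫ chart j ε = ξ
  -- Only the values of `ε` on `D` and at `j` matter here. The freedom in the remaining values lets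
  -- the next blow-up prescribe `ε k`.
  cover : ∀ y, ∃ (j : Fin (n + 1)) (ε : Fin (n + 1) → Fin 2), ∀ ε' : Fin (n + 1) → Fin 2,
    (∀ i, i ∈ D ∨ i = j → ε' i = ε i) → y ∈ Set.range (chart j ε')
  mem_T : ∀ j ε k (q : Spec (.of (MvPolynomial (Var j) ℂ))), chart j ε q ∈ T k ↔
    ∀ a s, P.chartHom D j ε a = P.x k s / P.x j (ε j) → a ∈ q.asIdeal

attribute [instance] Stage.isOpenImmersion_chart

namespace QuadricPoint

variable (P : QuadricPoint n K) (D : Set (Fin (n + 1))) (j : Fin (n + 1))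
  (ε : Fin (n + 1) → Fin 2)

/-- The homogeneous coordinates as functions on a chart. -/
def homCoord (k : Fin (n + 1)) (s : Fin 2) : MvPolynomial (Var j) ℂ :=
  (P.exists_chartHom_eq D j ε k s).choose

lemma chartHom_homCoord (k : Fin (n + 1)) (s : Fin 2) :
    P.chartHom D j ε (P.homCoord D j ε k s) = P.x k s / P.x j (ε j) :=
  (P.exists_chartHom_eq D j ε k s).choose_spec

lemma eq_homCoord_iff (k : Fin (n + 1)) (s : Fin 2) (a : MvPolynomial (Var j) ℂ) :
    P.chartHom D j ε a = P.x k s / P.x j (ε j) ↔ a = P.homCoord D j ε k s := by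
  rw [← P.chartHom_homCoord D j ε, (P.chartHom_injective D j ε).eq_iff]

lemma homCoord_ne_zero (k : Fin (n + 1)) (s : Fin 2) : P.homCoord D j ε k s ≠ 0 := by
  rw [← map_ne_zero_iff _ (P.chartHom_injective D j ε), chartHom_homCoord]
  exact div_ne_zero (P.ne_zero _ _) (P.ne_zero _ _)

lemma homCoord_self : P.homCoord D j ε j (ε j) = 1 := by
  symm
  rw [← eq_homCoord_iff, div_self (P.ne_zero _ _), map_one]

lemma homCoord_of_ne (k : {i // i ≠ j}) : P.homCoord D j ε k (ε k) = MvPolynomial.X (k, 0) := by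
  symm
  rw [← eq_homCoord_iff, chartHom_X_zero]

lemma homCoord_rev_of_ne (k : {i // i ≠ j}) (hk : (k : Fin (n + 1)) ∉ D) :
    P.homCoord D j ε k (ε k).rev = MvPolynomial.X (k, 1) := by
  symm
  rw [← eq_homCoord_iff, chartHom_X_one_of_notMem _ _ hk]

lemma span_homCoord_self : Ideal.span (Set.range (P.homCoord D j ε j)) = ⊤ :=
  Ideal.eq_top_of_isUnit_mem _ (Ideal.subset_span ⟨ε j, rfl⟩) (by simp [homCoord_self])

lemma span_homCoord_of_ne (k : {i // i ≠ j}) (hk : (k : Fin (n + 1)) ∉ D) :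
    Ideal.span (Set.range (P.homCoord D j ε k)) =
      Ideal.span (MvPolynomial.X '' {v : Var j | v.1 = k}) := by
  congr 1
  ext a
  constructor
  · rintro ⟨s, rfl⟩
    obtain h | h := finTwo_eq_or_rev (ε k) s
    · rw [h, homCoord_of_ne]
      exact ⟨_, rfl, rfl⟩
    · rw [h, homCoord_rev_of_ne _ _ _ _ _ hk]
      exact ⟨_, rfl, rfl⟩
  · rintro ⟨⟨_, t⟩, rfl, rfl⟩
    obtain rfl | rfl := finTwo_eq_or_rev 0 t
    · exact ⟨_, P.homCoord_of_ne D j ε _⟩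
    · exact ⟨_, P.homCoord_rev_of_ne D j ε _ hk⟩

lemma isRadical_span_homCoord (k : Fin (n + 1)) (hk : k ∉ D) :
    (Ideal.span (Set.range (P.homCoord D j ε k))).IsRadical := by
  by_cases h : k = j
  · subst h
    rw [span_homCoord_self]
    exact fun _ _ => trivial
  · rw [P.span_homCoord_of_ne D j ε ⟨k, h⟩ hk]
    exact (isPrime_span_X_image _).isRadical

lemma span_homCoord_le_iff (k : Fin (n + 1)) (I : Ideal (MvPolynomial (Var j) ℂ)) :
    Ideal.span (Set.range (P.homCoord D j ε k)) ≤ I ↔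
      ∀ a s, P.chartHom D j ε a = P.x k s / P.x j (ε j) → a ∈ I := by
  rw [Ideal.span_le]
  constructor
  · rintro h a s ha
    rw [eq_homCoord_iff] at ha
    exact h ⟨s, ha.symm⟩
  · rintro h _ ⟨s, rfl⟩
    exact h _ s (P.chartHom_homCoord D j ε k s)

end QuadricPoint

namespace Stage

variable {P : QuadricPoint n K} {D : Set (Fin (n + 1))} {X : Scheme.{0}}
  {p : X ⟶ Spec (.of ℂ)} {T : Fin (n + 1) → Closeds X} (S : Stage P D p T)

include S in
lemma exists_mem_range_chart (y : X) : ∃ j ε, y ∈ Set.range (S.chart j ε) := by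
  obtain ⟨j, ε, h⟩ := S.cover y
  exact ⟨j, ε, h ε fun _ _ => rfl⟩

/-- The centre carries its reduced structure. The two homogeneous coordinates cut it out on the
chart and span a radical ideal, so they generate its ideal. -/
lemma pullIdeal_chart (j : Fin (n + 1)) (ε : Fin (n + 1) → Fin 2) (k : Fin (n + 1)) (hk : k ∉ D) :
    pullIdeal (Scheme.IdealSheafData.vanishingIdeal (T k)) (S.chart j ε) =
      Ideal.span (Set.range (P.homCoord D j ε k)) := by
  refine pullIdeal_vanishingIdeal (A := .of (MvPolynomial (Var j) ℂ)) _ _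
    (P.isRadical_span_homCoord D j ε k hk) fun q => ?_
  rw [S.mem_T, ← P.span_homCoord_le_iff]

/-- The total and strict transforms of a centre agree. -/
lemma strictTransform_eq {k m : Fin (n + 1)} (hkm : k ≠ m) {X' : Scheme.{0}} (π : X' ⟶ X)
    {p' : X' ⟶ Spec (.of ℂ)}
    (S' : Stage P (insert k D) p' fun i => (T i).preimage π.continuous) (hm : m ∉ D) :
    strictTransform π (T k) (T m) = (T m).preimage π.continuous := by
  apply SetLike.coe_injective
  apply Set.Subset.antisymm
  · refine closure_minimal (Set.preimage_mono Set.sdiff_subset) ?_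
    exact ((T m).preimage π.continuous).isClosed
  · intro y hy
    obtain ⟨j, ε, q, rfl⟩ := S'.exists_mem_range_chart y
    have hm' : m ∉ insert k D := by
      rintro (h | h)
      exacts [hkm h.symm, hm h]
    have hq := (P.span_homCoord_le_iff _ j ε m q.asIdeal).2 ((S'.mem_T j ε m q).1 hy)
    have hmj : m ≠ j := by
      rintro rfl
      rw [P.span_homCoord_self, top_le_iff] at hq
      exact q.isPrime.ne_top hq
    have hspan := P.span_homCoord_of_ne (insert k D) j ε ⟨m, hmj⟩ hm'
    -- The generic point of the centre `T m` on the chart. It lies outside `T k`: the variable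
    -- $x_{k,\varepsilon(k)}/x_{j,\varepsilon(j)}$ is not in this prime ideal, or equals 1 if $k=j$.
    -- So `T m` is the closure of its part outside `T k`.
    let q' : Spec (.of (MvPolynomial (Var j) ℂ)) :=
      ⟨Ideal.span (MvPolynomial.X '' {v : Var j | v.1 = ⟨m, hmj⟩}), isPrime_span_X_image _⟩
    have hs : q' ⤳ q := by
      refine (PrimeSpectrum.le_iff_specializes q' q).1 ?_
      change Ideal.span _ ≤ q.asIdeal
      rw [← hspan]
      exact hq
    have h1 : S'.chart j ε q' ∈ (T m).preimage π.continuous := by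
      rw [S'.mem_T, ← P.span_homCoord_le_iff]
      exact hspan.le
    have h2 : S'.chart j ε q' ∉ (T k).preimage π.continuous := by
      rw [S'.mem_T, ← P.span_homCoord_le_iff]
      intro h
      have h3 : P.homCoord (insert k D) j ε k (ε k) ∈ q'.asIdeal := h (Ideal.subset_span ⟨_, rfl⟩)
      by_cases hkj : k = j
      · subst hkj
        rw [P.homCoord_self] at h3
        exact q'.isPrime.one_notMem h3
      · rw [P.homCoord_of_ne _ _ _ ⟨k, hkj⟩] at h3
        have := (X_mem_span_X_image_iff (R := ℂ)).1 h3
        exact hkm (congrArg (fun z : {i // i ≠ j} => (z : Fin (n + 1))) this)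
    have h3 : S'.chart j ε q' ⤳ S'.chart j ε q := hs.map (S'.chart j ε).continuous
    exact h3.mem_closed isClosed_closure (subset_closure ⟨h1, h2⟩)

section Blowup

variable (k : Fin (n + 1))

/-- The blow-up of a total transform. -/
abbrev blowup : Scheme.{0} := graph p S.ξ S.ξ_comp (P.x k) (P.ne_zero k)

/-- The projection of the blow-up. -/
abbrev blowupπ : S.blowup k ⟶ X := graphFst p S.ξ S.ξ_comp (P.x k) (P.ne_zero k)

/-- Of the two charts of the graph, the one with `s = ε k` has a polynomial ring as coordinate ring,
by `range_chartHom_insert`. The other one is reached by changing `ε k`. -/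
lemma exists_chart (j : Fin (n + 1)) (ε : Fin (n + 1) → Fin 2) :
    ∃ (i : Spec (.of (MvPolynomial (Var j) ℂ)) ⟶ S.blowup k) (_ : IsOpenImmersion i)
      (incl : MvPolynomial (Var j) ℂ →+* MvPolynomial (Var j) ℂ),
      (∀ a, P.chartHom (insert k D) j ε (incl a) = P.chartHom D j ε a) ∧
      i ≫ S.blowupπ k = Spec.map (CommRingCat.ofHom incl) ≫ S.chart j ε ∧
      Spec.map (CommRingCat.ofHom (P.chartHom (insert k D) j ε).toRingHom) ≫ i =
        graphPoint p S.ξ S.ξ_comp (P.x k) (P.ne_zero k) ∧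
      ∀ y, y ∈ Set.range i ↔ S.blowupπ k y ∈ Set.range (S.chart j ε) ∧
        graphSnd p S.ξ S.ξ_comp (P.x k) (P.ne_zero k) y ∈ Set.range (projChart (ε k)) := by
  obtain ⟨i, hi, incl, κ, h1, -, h3, -, h5, h6⟩ := exists_graph_chart p S.ξ S.ξ_comp (P.x k)
    (P.ne_zero k) (S.chart j ε) (P.chartHom D j ε) (P.chartHom_injective D j ε)
    (S.specMap_chart j ε) (ε k) (P.chartHom (insert k D) j ε) (P.chartHom_injective _ j ε)
    (P.range_chartHom_insert D j ε k)
  exact ⟨i, hi, incl, h1, h3, h5, h6⟩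

/-- The ring of functions on a chart of the blow-up, as a subalgebra of the function field. -/
abbrev blowupRing (P : QuadricPoint n K) (D : Set (Fin (n + 1))) (k j : Fin (n + 1))
    (ε : Fin (n + 1) → Fin 2) (s : Fin 2) : Subalgebra ℂ K :=
  (P.chartHom D j ε).range ⊔ Algebra.adjoin ℂ {P.x k s.rev / P.x k s}

lemma exists_eval₂_eq {R : Type} [CommRing R] [Algebra ℂ R] (φ : R →ₐ[ℂ] K) (t : K) (b : K)
    (hb : b ∈ φ.range ⊔ Algebra.adjoin ℂ {t}) :
    ∃ F : Polynomial R, F.eval₂ φ.toRingHom t = b := by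
  let f : Polynomial R →ₐ[ℂ] K :=
    { Polynomial.eval₂RingHom φ.toRingHom t with
      commutes' := fun r => by
        change Polynomial.eval₂ φ.toRingHom t (algebraMap ℂ (Polynomial R) r) = _
        rw [Polynomial.algebraMap_apply, Polynomial.eval₂_C]
        exact φ.commutes r }
  have h : φ.range ⊔ Algebra.adjoin ℂ {t} ≤ f.range := by
    refine sup_le ?_ ?_
    · rintro _ ⟨a, rfl⟩
      exact ⟨Polynomial.C a, Polynomial.eval₂_C _ _⟩
    · rw [Algebra.adjoin_le_iff]
      rintro _ rfl
      exact ⟨Polynomial.X, Polynomial.eval₂_X _ _⟩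
  exact h hb

/-- The charts of the blow-up. -/
lemma nonempty_blowupChart (hk : k ∉ D) (j : Fin (n + 1)) (ε : Fin (n + 1) → Fin 2) :
    ∃ d : BlowupChart (S.blowupπ k) (Scheme.IdealSheafData.vanishingIdeal (T k)) K,
      Set.range d.j = Set.range (S.chart j ε) := by
  choose i hi incl κ h1 h2 h3 h4 h5 h6 using fun s => exists_graph_chart p S.ξ S.ξ_comp (P.x k)
    (P.ne_zero k) (S.chart j ε) (P.chartHom D j ε) (P.chartHom_injective D j ε)
    (S.specMap_chart j ε) s (blowupRing P D k j ε s).val Subtype.val_injective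
    (Subalgebra.range_val _)
  have hτ (s) : P.x k s.rev / P.x k s ∈ blowupRing P D k j ε s :=
    le_sup_right (a := (P.chartHom D j ε).range) (Algebra.subset_adjoin rfl)
  refine ⟨{
    A := .of (MvPolynomial (Var j) ℂ)
    j := S.chart j ε
    φ := (P.chartHom D j ε).toRingHom
    φ_injective := P.chartHom_injective D j ε
    a := P.homCoord D j ε k
    a_ne_zero := P.homCoord_ne_zero D j ε k
    pullIdeal_eq := S.pullIdeal_chart j ε k hk
    B := fun s => .of (blowupRing P D k j ε s)
    i := i
    open_i := hi
    ψ := fun s => (blowupRing P D k j ε s).val.toRingHom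
    ψ_injective := fun s => Subtype.val_injective
    incl := fun s => CommRingCat.ofHom (incl s)
    ψ_incl := fun s => RingHom.ext (h1 s)
    τ := fun s => (⟨P.x k s.rev / P.x k s, hτ s⟩ : blowupRing P D k j ε s)
    ψ_τ := fun s => ?_
    surj := fun s b => ?_
    comm := h3
    cover := fun y hy => ?_
    overlap := fun s q hq => ?_ }, rfl⟩
  · change P.x k s.rev / P.x k s = P.chartHom D j ε _ / P.chartHom D j ε _
    rw [P.chartHom_homCoord, P.chartHom_homCoord, div_div_div_cancel_right₀ (P.ne_zero _ _)]
  · obtain ⟨F, hF⟩ := exists_eval₂_eq (P.chartHom D j ε) (P.x k s.rev / P.x k s) b.1 b.2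
    refine ⟨F, Subtype.val_injective ?_⟩
    rw [← hF]
    change (blowupRing P D k j ε s).val.toRingHom _ = _
    rw [Polynomial.hom_eval₂]
    congr 1
    exact RingHom.ext (h1 s)
  · obtain ⟨s, hs⟩ := projChart_cover (graphSnd p S.ξ S.ξ_comp (P.x k) (P.ne_zero k) y)
    exact ⟨s, (h6 s y).2 ⟨hy, hs⟩⟩
  · refine (h6 s.rev _).2 ⟨((h6 s _).1 ⟨q, rfl⟩).1, ?_⟩
    rw [← Scheme.Hom.comp_apply, h4]
    exact mem_range_projChart_rev (P.x k) (P.ne_zero k) (B := .of (blowupRing P D k j ε s))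
      (κ s) (blowupRing P D k j ε s).val.toRingHom Subtype.val_injective (h2 s) _ rfl q hq

lemma isBlowupAlong (hk : k ∉ D) : IsBlowupAlong (T k) (S.blowupπ k) := by
  refine isBlowup_of_charts K fun y => ?_
  obtain ⟨j, ε, hy⟩ := S.exists_mem_range_chart y
  obtain ⟨d, hd⟩ := S.nonempty_blowupChart k hk j ε
  exact ⟨d, hd ▸ hy⟩

/-- The fractional coordinate is invertible on the charts with index `k`. -/
lemma graphSnd_mem_range (ε : Fin (n + 1) → Fin 2) (y : S.blowup k)
    (hy : S.blowupπ k y ∈ Set.range (S.chart k ε)) :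
    graphSnd p S.ξ S.ξ_comp (P.x k) (P.ne_zero k) y ∈ Set.range (projChart (ε k)) := by
  obtain ⟨s, hs⟩ := projChart_cover (graphSnd p S.ξ S.ξ_comp (P.x k) (P.ne_zero k) y)
  obtain h | h := finTwo_eq_or_rev s (ε k)
  · rwa [h]
  obtain ⟨i, hi, incl, κ, h1, h2, h3, h4, h5, h6⟩ := exists_graph_chart p S.ξ S.ξ_comp (P.x k)
    (P.ne_zero k) (S.chart k ε) (P.chartHom D k ε) (P.chartHom_injective D k ε)
    (S.specMap_chart k ε) s (blowupRing P D k k ε s).val Subtype.val_injective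
    (Subalgebra.range_val _)
  obtain ⟨q, rfl⟩ := (h6 y).2 ⟨hy, hs⟩
  rw [← Scheme.Hom.comp_apply, h4, h]
  have hτ : P.x k s.rev / P.x k s ∈ blowupRing P D k k ε s :=
    le_sup_right (a := (P.chartHom D k ε).range) (Algebra.subset_adjoin rfl)
  -- The centre does not meet a chart with index `k`: here `s.rev = ε k`, so this ratio is regular
  -- there already, and it inverts `τ`.
  have hτ' : P.x k s / P.x k s.rev ∈ blowupRing P D k k ε s := by
    rw [← h]
    exact le_sup_left (a := (P.chartHom D k ε).range) (P.exists_chartHom_eq D k ε k s)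
  refine mem_range_projChart_rev (P.x k) (P.ne_zero k) (B := .of (blowupRing P D k k ε s))
    κ (blowupRing P D k k ε s).val.toRingHom Subtype.val_injective h2 ⟨_, hτ⟩ rfl q ?_
  refine fun hq => q.isPrime.ne_top (Ideal.eq_top_of_isUnit_mem _ hq ?_)
  refine IsUnit.of_mul_eq_one ⟨_, hτ'⟩ (Subtype.val_injective ?_)
  change P.x k s.rev / P.x k s * (P.x k s / P.x k s.rev) = 1
  rw [div_mul_div_cancel₀ (P.ne_zero _ _), div_self (P.ne_zero _ _)]

/-- The charts of the blow-up of a total transform. -/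
lemma nonempty_stage_blowup (hk : k ∉ D) :
    Nonempty (Stage P (insert k D) (S.blowupπ k ≫ p)
      fun m => (T m).preimage (S.blowupπ k).continuous) := by
  choose i hi incl h1 h2 h3 h4 using S.exists_chart k
  have := S.proper
  refine ⟨{
    proper := inferInstance
    ξ := graphPoint p S.ξ S.ξ_comp (P.x k) (P.ne_zero k)
    ξ_comp := by rw [← Category.assoc, graphPoint_fst, S.ξ_comp]
    chart := i
    isOpenImmersion_chart := hi
    specMap_chart := h3
    cover := fun y => ?cov
    mem_T := fun j ε m q => ?mem }⟩
  case cov =>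
    obtain ⟨j, ε, h⟩ := S.cover (S.blowupπ k y)
    by_cases hkj : k = j
    · subst hkj
      refine ⟨k, ε, fun ε' h' => (h4 k ε' y).2 ⟨h ε' fun l hl => h' l (hl.imp .inr id), ?_⟩⟩
      exact S.graphSnd_mem_range k ε' y (h ε' fun l hl => h' l (hl.imp .inr id))
    · obtain ⟨s, hs⟩ := projChart_cover (graphSnd p S.ξ S.ξ_comp (P.x k) (P.ne_zero k) y)
      -- Since `k` is neither in `D` nor equal to `j`, changing `ε` at `k` does not affect whether
      -- the chart below contains the point.
      refine ⟨j, Function.update ε k s, fun ε' h' => (h4 j ε' y).2 ⟨h ε' fun l hl => ?_, ?_⟩⟩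
      · rw [h' l (hl.imp .inr id), Function.update_of_ne]
        rintro rfl
        exact hl.elim hk hkj
      · rw [h' k (.inl (.inl rfl)), Function.update_self]
        exact hs
  case mem =>
    have h5 : S.blowupπ k (i j ε q) = S.chart j ε (Spec.map (CommRingCat.ofHom (incl j ε)) q) := by
      rw [← Scheme.Hom.comp_apply, h2, Scheme.Hom.comp_apply]
    change S.blowupπ k (i j ε q) ∈ T m ↔ _
    rw [h5, S.mem_T]
    constructor
    · intro h a s ha
      have : a = incl j ε (P.homCoord D j ε m s) := by
        apply P.chartHom_injective (insert k D) j ε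
        rw [h1, P.chartHom_homCoord, ha]
      rw [this]
      exact h _ s (P.chartHom_homCoord D j ε m s)
    · intro h a s ha
      exact h _ s ((h1 j ε a).trans ha)

end Blowup

/-- The iterated blow-up of total transforms. -/
lemma exists_isIteratedBlowup (l : List (Fin (n + 1))) (hl : l.Nodup) (D : Set (Fin (n + 1)))
    (hD : ∀ k ∈ l, k ∉ D) {X : Scheme.{0}} (p : X ⟶ Spec (.of ℂ)) (T : Fin (n + 1) → Closeds X)
    (S : Stage P D p T) :
    ∃ (W : Scheme.{0}) (π : W ⟶ X) (T' : Fin (n + 1) → Closeds W),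
      IsIteratedBlowup (l.map T) π ∧ Nonempty (Stage P ({k | k ∈ l} ∪ D) (π ≫ p) T') := by
  induction l generalizing D X with
  | nil =>
    refine ⟨X, 𝟙 X, T, .nil X, ?_⟩
    simpa using ⟨S⟩
  | cons k l ih =>
    have hk : k ∉ D := hD k (by simp)
    obtain ⟨S'⟩ := S.nonempty_stage_blowup k hk
    obtain ⟨W, ρ, T', h1, h2⟩ := ih (List.nodup_cons.1 hl).2 (insert k D) (fun m hm => by
      rintro (rfl | h)
      · exact (List.nodup_cons.1 hl).1 hm
      · exact hD m (by simp [hm]) h) _ _ S'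
    refine ⟨W, ρ ≫ S.blowupπ k, T', ?_, ?_⟩
    · refine .cons _ _ _ _ (S.isBlowupAlong k hk) ?_
      -- The definition asks for strict transforms and the stage provides total transforms. They
      -- agree for the centres still to be blown up.
      convert h1 using 1
      rw [List.map_map]
      refine List.map_congr_left fun m hm => ?_
      exact strictTransform_eq (by rintro rfl; exact (List.nodup_cons.1 hl).1 hm) _ S'
        (hD m (by simp [hm]))
    · rw [Category.assoc]
      convert h2 using 2
      ext m
      simp only [Set.mem_union, Set.mem_ofPred_eq, List.mem_cons, Set.mem_insert_iff]
      tauto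

end Stage

end Stage

/-! ### Coordinate rings of the affine charts of projective space. -/

section AwayMv

attribute [local instance] MvPolynomial.gradedAlgebra

variable {σ : Type}

/-- The affine coordinates on a standard affine chart of projective space. -/
def awayX (s t : σ) : AwayMv σ s :=
  HomogeneousLocalization.Away.mk _ (X_mem_homogeneousSubmodule s) 1 (MvPolynomial.X t)
    (X_mem_homogeneousSubmodule t)

lemma projEvalₐ_mk {K : Type} [Field K] [Algebra ℂ K] (x : σ → K) {s : σ} (hs : x s ≠ 0) (m : ℕ)
    (f : MvPolynomial σ ℂ) (hf : f ∈ MvPolynomial.homogeneousSubmodule σ ℂ (m • 1)) :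
    projEvalₐ x hs (HomogeneousLocalization.Away.mk _ (X_mem_homogeneousSubmodule s) m f hf) =
      MvPolynomial.aeval (fun t => x t / x s) f :=
  projEval_mk x hs m f hf

lemma projEvalₐ_awayX {K : Type} [Field K] [Algebra ℂ K] (x : σ → K) {s : σ} (hs : x s ≠ 0)
    (t : σ) : projEvalₐ x hs (awayX s t) = x t / x s := by
  rw [awayX, projEvalₐ_mk, MvPolynomial.aeval_X]

/-- Both sides have the same value at the generic point of projective space, and evaluation there is
injective. -/
lemma away_mk_eq_aeval (s : σ) (m : ℕ) (f : MvPolynomial σ ℂ)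
    (hf : f ∈ MvPolynomial.homogeneousSubmodule σ ℂ (m • 1)) :
    HomogeneousLocalization.Away.mk _ (X_mem_homogeneousSubmodule s) m f hf =
      MvPolynomial.aeval (awayX s) f := by
  let x : σ → FractionRing (MvPolynomial σ ℂ) := fun t =>
    algebraMap (MvPolynomial σ ℂ) (FractionRing (MvPolynomial σ ℂ)) (MvPolynomial.X t)
  have hx : (MvPolynomial.aeval x : MvPolynomial σ ℂ →ₐ[ℂ] _) =
      IsScalarTower.toAlgHom ℂ (MvPolynomial σ ℂ) (FractionRing (MvPolynomial σ ℂ)) := by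
    ext t
    simp [x]
  have hs : x s ≠ 0 := (map_ne_zero_iff _ (IsFractionRing.injective _ _)).2 (MvPolynomial.X_ne_zero s)
  have hinj : Function.Injective (projEvalₐ x hs) := by
    rw [injective_iff_map_eq_zero]
    intro z hz
    obtain ⟨m, p, hp, rfl⟩ :=
      HomogeneousLocalization.Away.mk_surjective _ (X_mem_homogeneousSubmodule s) z
    have h1 : projEval x hs (HomogeneousLocalization.Away.mk _ (X_mem_homogeneousSubmodule s)
      m p hp) = 0 := hz
    rw [projEval, evalAway_mk, div_eq_zero_iff, or_iff_left (pow_ne_zero _ (by simpa using hs))] at h1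
    change MvPolynomial.aeval x p = 0 at h1
    rw [hx] at h1
    have h2 : p = 0 := IsFractionRing.injective (MvPolynomial σ ℂ)
      (FractionRing (MvPolynomial σ ℂ)) (h1.trans (map_zero _).symm)
    subst h2
    apply HomogeneousLocalization.val_injective
    rw [HomogeneousLocalization.Away.val_mk, HomogeneousLocalization.val_zero,
      Localization.mk_zero]
  apply hinj
  rw [projEvalₐ_mk, ← AlgHom.comp_apply, MvPolynomial.comp_aeval]
  congr 2
  funext t
  rw [projEvalₐ_awayX]

lemma awayX_self (s : σ) : awayX s s = 1 := by
  apply HomogeneousLocalization.val_injective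
  rw [awayX, HomogeneousLocalization.Away.val_mk, HomogeneousLocalization.val_one]
  simp only [pow_one]
  exact Localization.mk_self (⟨MvPolynomial.X s, Submonoid.mem_powers _⟩ :
    Submonoid.powers (MvPolynomial.X s : MvPolynomial σ ℂ))

lemma aeval_awayX_surjective (s : σ) :
    Function.Surjective (MvPolynomial.aeval (R := ℂ) (awayX (σ := σ) s)) := by
  intro z
  obtain ⟨m, p, hp, rfl⟩ :=
    HomogeneousLocalization.Away.mk_surjective _ (X_mem_homogeneousSubmodule s) z
  exact ⟨p, (away_mk_eq_aeval s m p hp).symm⟩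

lemma mem_projChart_iff (s : σ) {m : ℕ} (hm : 0 < m) (f : MvPolynomial σ ℂ)
    (hf : f ∈ MvPolynomial.homogeneousSubmodule σ ℂ m) (q : Spec (.of (AwayMv σ s))) :
    f ∈ (projChart s q).asHomogeneousIdeal ↔ MvPolynomial.aeval (awayX s) f ∈ q.asIdeal := by
  have h1 := Proj.awayι_preimage_basicOpen (MvPolynomial.homogeneousSubmodule σ ℂ)
    (X_mem_homogeneousSubmodule s) one_pos hf hm
  have h2 : projChart s q ∈ Proj.basicOpen (MvPolynomial.homogeneousSubmodule σ ℂ) f ↔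
      q ∈ PrimeSpectrum.basicOpen (HomogeneousLocalization.Away.isLocalizationElem
        (X_mem_homogeneousSubmodule s) hf) := by
    rw [← h1]
    rfl
  rw [← not_iff_not]
  refine h2.trans (not_congr ?_)
  rw [HomogeneousLocalization.Away.isLocalizationElem, away_mk_eq_aeval, pow_one]

end AwayMv

/-! ### The quadric itself as the initial stage. -/

section QuadricStage

attribute [local instance] MvPolynomial.gradedAlgebra

variable {n : ℕ} {K : Type} [Field K] [Algebra ℂ K] (P : QuadricPoint n K)

namespace QuadricPoint

/-- The coordinates as a family indexed by pairs. -/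
abbrev pt (v : Fin (n + 1) × Fin 2) : K := P.x v.1 v.2

lemma pt_ne_zero (v : Fin (n + 1) × Fin 2) : P.pt v ≠ 0 := P.ne_zero _ _

/-- The generic point of the quadric as a point of projective space. -/
def ζ : Spec (.of K) ⟶ projMv (Fin (n + 1) × Fin 2) :=
  Spec.map (CommRingCat.ofHom (projEval P.pt (P.pt_ne_zero (0, 0)))) ≫ projChart (0, 0)

instance : QuasiCompact P.ζ := quasiCompact_of_spec_field _

lemma ζ_eq (v : Fin (n + 1) × Fin 2) :
    Spec.map (CommRingCat.ofHom (projEval P.pt (P.pt_ne_zero v))) ≫ projChart v = P.ζ :=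
  projEval_specMap_comp _ _ _ _ _

/-- Modulo the dehomogenized quadratic form, the coordinate paired with the one set to 1 is
expressed through the others. The quotient is thus generated by the $2n$ remaining coordinates,
whose values in `K` are algebraically independent, so nothing further is killed. -/
lemma ker_projEval (v : Fin (n + 1) × Fin 2) : RingHom.ker (projEvalₐ P.pt (P.pt_ne_zero v)) =
    Ideal.span {MvPolynomial.aeval (awayX v) (quadraticForm n)} := by
  obtain ⟨j, e⟩ := v
  set I := Ideal.span {MvPolynomial.aeval (awayX (j, e)) (quadraticForm n)} with hI
  have hQ : MvPolynomial.aeval (awayX (j, e)) (quadraticForm n) =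
      ∑ i, awayX (j, e) (i, 0) * awayX (j, e) (i, 1) := by
    simp [quadraticForm]
  apply le_antisymm
  · let q := Ideal.Quotient.mkₐ ℂ I
    let g : MvPolynomial (Var j) ℂ →ₐ[ℂ] AwayMv (Fin (n + 1) × Fin 2) (j, e) :=
      MvPolynomial.aeval fun v => awayX (j, e) (v.1, if v.2 = 0 then e else e.rev)
    have hg : (projEvalₐ P.pt (P.pt_ne_zero (j, e))).comp g = P.chartHom ∅ j fun _ => e := by
      ext v
      simp only [g, AlgHom.comp_apply, MvPolynomial.aeval_X, projEvalₐ_awayX, chartHom, coord]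
      split_ifs <;> simp_all
    have h1 : ∀ (i : {i // i ≠ j}) (s : Fin 2), awayX (j, e) ((i : Fin (n + 1)), s) ∈ g.range := by
      intro i s
      obtain rfl | rfl := finTwo_eq_or_rev e s
      · exact ⟨MvPolynomial.X (i, 0), by simp [g]⟩
      · exact ⟨MvPolynomial.X (i, 1), by simp [g]⟩
    have h2 : (⊤ : Subalgebra ℂ (AwayMv (Fin (n + 1) × Fin 2) (j, e))) ≤
        ((q.comp g).range).comap q := by
      have : (⊤ : Subalgebra ℂ (AwayMv (Fin (n + 1) × Fin 2) (j, e))) =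
          Algebra.adjoin ℂ (Set.range (awayX (j, e))) := by
        rw [Algebra.adjoin_range_eq_range_aeval]
        exact ((AlgHom.range_eq_top _).2 (aeval_awayX_surjective (j, e))).symm
      rw [this, Algebra.adjoin_le_iff]
      have h3 : ∀ z ∈ g.range, z ∈ ((q.comp g).range).comap q := by
        rintro _ ⟨a, rfl⟩
        exact ⟨a, rfl⟩
      rintro _ ⟨⟨i, s⟩, rfl⟩
      by_cases hi : i = j
      · subst hi
        obtain rfl | rfl := finTwo_eq_or_rev e s
        · rw [awayX_self]
          exact one_mem _
        · have h4 : awayX (i, e) (i, e.rev) = MvPolynomial.aeval (awayX (i, e)) (quadraticForm n) -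
              ∑ k ∈ Finset.univ.erase i, awayX (i, e) (k, 0) * awayX (i, e) (k, 1) := by
            rw [hQ, ← Finset.add_sum_erase _ _ (Finset.mem_univ i), add_sub_cancel_right]
            obtain rfl | rfl := finTwo_eq_or_rev 0 e
            · rw [awayX_self, one_mul]
              rfl
            · change _ = awayX (i, 1) (i, 0) * awayX (i, 1) (i, 1)
              rw [awayX_self, mul_one]
              rfl
          rw [h4]
          refine sub_mem ?_ (sum_mem fun k hk => mul_mem ?_ ?_)
          · change q _ ∈ (q.comp g).range
            rw [show q (MvPolynomial.aeval (awayX (i, e)) (quadraticForm n)) = 0 from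
              Ideal.Quotient.eq_zero_iff_mem.2 (Ideal.subset_span rfl)]
            exact zero_mem _
          · exact h3 _ (h1 ⟨k, Finset.ne_of_mem_erase hk⟩ 0)
          · exact h3 _ (h1 ⟨k, Finset.ne_of_mem_erase hk⟩ 1)
      · exact h3 _ (h1 ⟨i, hi⟩ s)
    have hle : I ≤ RingHom.ker (projEvalₐ P.pt (P.pt_ne_zero (j, e))) := by
      rw [hI, Ideal.span_singleton_le_iff_mem, RingHom.mem_ker, hQ, map_sum]
      simp only [map_mul, projEvalₐ_awayX, div_mul_div_comm]
      rw [← Finset.sum_div]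
      exact div_eq_zero_iff.2 (.inl P.sum_eq)
    intro z hz
    obtain ⟨a, ha⟩ := h2 (Algebra.mem_top (x := z))
    have h5 : z - g a ∈ I := by
      rw [← Ideal.Quotient.eq]
      exact ha.symm
    have h6 : a = 0 := by
      apply P.chartHom_injective ∅ j fun _ => e
      rw [map_zero, ← hg, AlgHom.comp_apply]
      have h7 := hle h5
      rw [RingHom.mem_ker, map_sub, show projEvalₐ P.pt (P.pt_ne_zero (j, e)) z = 0 from hz,
        zero_sub, neg_eq_zero] at h7
      exact h7
    rw [h6, map_zero, sub_zero] at h5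
    exact h5
  · rw [hI, Ideal.span_singleton_le_iff_mem, RingHom.mem_ker, hQ, map_sum]
    simp only [map_mul, projEvalₐ_awayX, div_mul_div_comm]
    rw [← Finset.sum_div]
    exact div_eq_zero_iff.2 (.inl P.sum_eq)

lemma quadraticForm_mem : quadraticForm n ∈
    MvPolynomial.homogeneousSubmodule (Fin (n + 1) × Fin 2) ℂ 2 :=
  sum_mem fun _ _ => (MvPolynomial.isHomogeneous_X _ _).mul (MvPolynomial.isHomogeneous_X _ _)

/-- Both ideal sheaves are radical, so it is enough to compare supports. On each affine chart both
are the zero locus of the dehomogenized quadratic form, by `ker_projEval`. -/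
lemma quadricIdeal_eq : quadricIdeal n = P.ζ.ker := by
  have h1 : P.ζ.ker.radical = P.ζ.ker := by
    ext1
    funext U
    rw [Scheme.IdealSheafData.radical_ideal, Scheme.Hom.ker_apply]
    refine le_antisymm ?_ Ideal.le_radical
    rintro a ⟨m, hm⟩
    rw [RingHom.mem_ker, map_pow] at hm
    exact eq_zero_of_pow_eq_zero hm
  rw [← h1, ← Scheme.IdealSheafData.vanishingIdeal_support, quadricIdeal]
  congr 1
  apply SetLike.ext
  intro y
  obtain ⟨v, q, rfl⟩ := projChart_cover y
  have hz : QuasiCompact (Spec.map (CommRingCat.ofHom (projEval P.pt (P.pt_ne_zero v))) ≫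
      projChart v) := quasiCompact_of_spec_field _
  have h2 : RingHom.ker (projEval P.pt (P.pt_ne_zero v)) = _ := P.ker_projEval v
  have h3 : projChart v q ∈ P.ζ.ker.support ↔
      MvPolynomial.aeval (awayX v) (quadraticForm n) ∈ q.asIdeal := by
    rw [← pullIdeal_le_asIdeal_iff, ← P.ζ_eq v, pullIdeal, ker_comap_of_isOpenImmersion,
      specIdeal_ker, CommRingCat.hom_ofHom, h2, Ideal.span_singleton_le_iff_mem]
  exact Set.singleton_subset_iff.trans
    ((mem_projChart_iff v two_pos _ quadraticForm_mem q).trans h3.symm)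

lemma range_chartHom_empty (j : Fin (n + 1)) (ε : Fin (n + 1) → Fin 2) :
    (P.chartHom ∅ j ε).toRingHom.range = (projEval P.pt (P.pt_ne_zero (j, ε j))).range := by
  rw [range_projEval]
  have : (P.chartHom ∅ j ε).range = Algebra.adjoin ℂ
      (Set.range fun t => P.pt t / P.pt (j, ε j)) := by
    apply le_antisymm
    · rw [range_chartHom, Algebra.adjoin_le_iff]
      rintro _ ⟨v, rfl⟩
      apply Algebra.subset_adjoin
      simp only [coord]
      split_ifs with h1 h2
      · exact ⟨(v.1, ε v.1), rfl⟩
      · exact h2.elim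
      · exact ⟨(v.1, (ε v.1).rev), rfl⟩
    · rw [Algebra.adjoin_le_iff]
      rintro _ ⟨t, rfl⟩
      exact P.exists_chartHom_eq ∅ j ε t.1 t.2
  exact congrArg Subalgebra.toSubring this

lemma exists_quadricChart (j : Fin (n + 1)) (ε : Fin (n + 1) → Fin 2) :
    ∃ (c : Spec (.of (MvPolynomial (Var j) ℂ)) ⟶ P.ζ.image) (_ : IsOpenImmersion c)
      (ρ : AwayMv (Fin (n + 1) × Fin 2) (j, ε j) →+* MvPolynomial (Var j) ℂ),
      (∀ z, P.chartHom ∅ j ε (ρ z) = projEval P.pt (P.pt_ne_zero (j, ε j)) z) ∧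
      c ≫ P.ζ.imageι = Spec.map (CommRingCat.ofHom ρ) ≫ projChart (j, ε j) ∧
      Spec.map (CommRingCat.ofHom (P.chartHom ∅ j ε).toRingHom) ≫ c = P.ζ.toImage ∧
      ∀ y, y ∈ Set.range c ↔ P.ζ.imageι y ∈ Set.range (projChart (j, ε j)) := by
  have hr := P.range_chartHom_empty j ε
  obtain ⟨c, hc, ρ, h1, h2, h3, h4⟩ := exists_image_chart (A := .of (MvPolynomial (Var j) ℂ))
    (B := .of (AwayMv (Fin (n + 1) × Fin 2) (j, ε j)))
    P.ζ (projChart (j, ε j)) (projEval P.pt (P.pt_ne_zero (j, ε j))) (P.ζ_eq (j, ε j))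
    (P.chartHom ∅ j ε).toRingHom (P.chartHom_injective ∅ j ε) hr
  exact ⟨c, hc, ρ.hom, fun z => DFunLike.congr_fun h1 z, h2, h3, h4⟩

lemma nonempty_stage_image : Nonempty (Stage P ∅ (P.ζ.imageι ≫ projMvToSpec (Fin (n + 1) × Fin 2))
    fun i => (projZeros {MvPolynomial.X (i, 0), MvPolynomial.X (i, 1)}).preimage
      P.ζ.imageι.continuous) := by
  choose c hc ρ h1 h2 h3 h4 using P.exists_quadricChart
  refine ⟨{
    proper := inferInstance
    ξ := P.ζ.toImage
    ξ_comp := ?comp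
    chart := c
    isOpenImmersion_chart := hc
    specMap_chart := h3
    cover := fun y => ?cov
    mem_T := fun j ε k q => ?mem }⟩
  case comp =>
    rw [Scheme.Hom.toImage_imageι_assoc]
    rw [ζ, Category.assoc, projEval_specMap_toSpec]
  case cov =>
    obtain ⟨⟨j, e⟩, hv⟩ := projChart_cover (P.ζ.imageι y)
    refine ⟨j, fun _ => e, fun ε' h => (h4 j ε' y).2 ?_⟩
    rw [h j (.inr rfl)]
    exact hv
  case mem =>
    have h5 : P.ζ.imageι (c j ε q) = projChart (j, ε j) (Spec.map (CommRingCat.ofHom (ρ j ε)) q) := by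
      rw [← Scheme.Hom.comp_apply, h2, Scheme.Hom.comp_apply]
    have h6 (s : Fin 2) : MvPolynomial.X (k, s) ∈
        (projChart (j, ε j) (Spec.map (CommRingCat.ofHom (ρ j ε)) q)).asHomogeneousIdeal ↔
          P.homCoord ∅ j ε k s ∈ q.asIdeal := by
      rw [mem_projChart_iff _ one_pos _ (X_mem_homogeneousSubmodule _), MvPolynomial.aeval_X]
      have : ρ j ε (awayX (j, ε j) (k, s)) = P.homCoord ∅ j ε k s := by
        rw [← eq_homCoord_iff]
        refine (h1 j ε _).trans ?_
        exact projEvalₐ_awayX _ (P.pt_ne_zero (j, ε j)) _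
      rw [← this]
      rfl
    rw [← P.span_homCoord_le_iff, Ideal.span_le, Set.range_subset_iff]
    change P.ζ.imageι (c j ε q) ∈ (projZeros _ : Closeds (projSpace n)) ↔ _
    rw [h5]
    refine Iff.trans (b := ∀ s : Fin 2, MvPolynomial.X (k, s) ∈
        (projChart (j, ε j) (Spec.map (CommRingCat.ofHom (ρ j ε)) q)).asHomogeneousIdeal) ?_ (forall_congr' h6)
    rw [Fin.forall_fin_two]
    exact Set.insert_subset_iff.trans (and_congr Iff.rfl Set.singleton_subset_iff)

lemma nonempty_stage : Nonempty (Stage P ∅ (quadricToSpec n) (center n)) := by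
  have h := P.nonempty_stage_image
  have key (I : (projSpace n).IdealSheafData) (hI : I = P.ζ.ker) :
      Nonempty (Stage P ∅ (I.subschemeι ≫ projSpaceToSpec n)
    fun i => (projZeros {MvPolynomial.X (i, 0), MvPolynomial.X (i, 1)}).preimage
      I.subschemeι.continuous) := by
    subst hI
    exact h
  exact key _ P.quadricIdeal_eq

end QuadricPoint

end QuadricStage

/-! ### Uniqueness of iterated blow-ups. -/

section Uniqueness

lemma IsBlowup.exists_iso {X₁ X₂ Y₁ Y₂ : Scheme.{u}} {I₁ : X₁.IdealSheafData}
    {I₂ : X₂.IdealSheafData} {π₁ : Y₁ ⟶ X₁} {π₂ : Y₂ ⟶ X₂} (h₁ : IsBlowup I₁ π₁)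
    (h₂ : IsBlowup I₂ π₂) (e : X₁ ≅ X₂) (he : I₂.comap e.hom = I₁) :
    ∃ e' : Y₁ ≅ Y₂, e'.hom ≫ π₂ = π₁ ≫ e.hom := by
  obtain ⟨g, hg, -⟩ := h₂.2 _ (π₁ ≫ e.hom) (by
    rw [Scheme.IdealSheafData.comap_comp, he]; exact h₁.1)
  obtain ⟨g', hg', -⟩ := h₁.2 _ (π₂ ≫ e.inv) (by
    rw [← he, ← Scheme.IdealSheafData.comap_comp, Category.assoc, e.inv_hom_id, Category.comp_id]
    exact h₂.1)
  refine ⟨⟨g, g', ?_, ?_⟩, hg⟩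
  · refine (h₁.2 _ π₁ h₁.1).unique ?_ (Category.id_comp _)
    rw [Category.assoc, hg', ← Category.assoc, hg, Category.assoc, e.hom_inv_id, Category.comp_id]
  · refine (h₂.2 _ π₂ h₂.1).unique ?_ (Category.id_comp _)
    rw [Category.assoc, hg, ← Category.assoc, hg', Category.assoc, e.inv_hom_id, Category.comp_id]

lemma comap_vanishingIdeal_of_iso {X Y : Scheme.{u}} (e : X ≅ Y) (C : Closeds Y) :
    (Scheme.IdealSheafData.vanishingIdeal C).comap e.hom =
      Scheme.IdealSheafData.vanishingIdeal (C.preimage e.hom.continuous) := by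
  refine eq_of_forall_le_iff fun J => ?_
  have h : J ≤ (Scheme.IdealSheafData.vanishingIdeal C).comap e.hom ↔
      J.comap e.inv ≤ Scheme.IdealSheafData.vanishingIdeal C := by
    constructor <;> intro h
    · have := Scheme.IdealSheafData.comap_mono e.inv h
      simpa only [← Scheme.IdealSheafData.comap_comp, e.inv_hom_id,
        Scheme.IdealSheafData.comap_id] using this
    · have := Scheme.IdealSheafData.comap_mono e.hom h
      simpa only [← Scheme.IdealSheafData.comap_comp, e.hom_inv_id,
        Scheme.IdealSheafData.comap_id] using this
  rw [h, ← Scheme.IdealSheafData.le_support_iff_le_vanishingIdeal,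
    ← Scheme.IdealSheafData.le_support_iff_le_vanishingIdeal, Scheme.IdealSheafData.support_comap]
  constructor
  · intro h x hx
    have : e.inv (e.hom x) ∈ J.support := h hx
    rwa [← Scheme.Hom.comp_apply, e.hom_inv_id] at this
  · intro h x hx
    refine h (show e.hom (e.inv x) ∈ C from ?_)
    rwa [← Scheme.Hom.comp_apply, e.inv_hom_id]

lemma IsIteratedBlowup.exists_iso {W₁ X₁ W₂ X₂ : Scheme.{u}} {L₁ : List (Closeds X₁)}
    {L₂ : List (Closeds X₂)} {π₁ : W₁ ⟶ X₁} {π₂ : W₂ ⟶ X₂} (h₁ : IsIteratedBlowup L₁ π₁)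
    (h₂ : IsIteratedBlowup L₂ π₂) (e : X₁ ≅ X₂)
    (he : L₁ = L₂.map fun C => C.preimage e.hom.continuous) :
    ∃ e' : W₁ ≅ W₂, e'.hom ≫ π₂ = π₁ ≫ e.hom := by
  induction h₁ generalizing W₂ X₂ with
  | nil =>
    cases h₂ with
    | nil => exact ⟨e, by simp⟩
    | cons => simp at he
  | @cons X₁' X₁ C₁ L₁ π₁ ρ₁ hπ₁ hρ₁ ih =>
    cases h₂ with
    | nil => simp at he
    | @cons X₂' _ C₂ L₂ π₂ ρ₂ hπ₂ hρ₂ =>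
      rw [List.map_cons, List.cons.injEq] at he
      obtain ⟨hC, hL⟩ := he
      obtain ⟨e', he'⟩ := IsBlowup.exists_iso hπ₁ hπ₂ e
        (by rw [comap_vanishingIdeal_of_iso, hC])
      obtain ⟨e'', he''⟩ := ih hρ₂ e' (by
        rw [hL, List.map_map, List.map_map]
        refine List.map_congr_left fun Z _ => SetLike.coe_injective ?_
        -- Strict transforms are defined by the underlying topology and the blow-up map alone, so
        -- the isomorphism between the blow-ups carries one to the other.
        have h := e'.hom.homeomorph.preimage_closure (π₂ ⁻¹' ((Z : Set X₂) \ C₂))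
        refine Eq.trans ?_ h.symm
        change closure _ = closure _
        rw [hC]
        congr 1
        ext y
        have h3 : e.hom (π₁ y) = π₂ (e'.hom y) := by
          rw [← Scheme.Hom.comp_apply, ← he', Scheme.Hom.comp_apply]
        change (e.hom (π₁ y) ∈ Z ∧ ¬ e.hom (π₁ y) ∈ C₂) ↔
          (π₂ (e'.hom y) ∈ Z ∧ ¬ π₂ (e'.hom y) ∈ C₂)
        rw [h3])
      refine ⟨e'', ?_⟩
      rw [← Category.assoc, he'', Category.assoc, he', Category.assoc]

variable {n : ℕ} {K : Type} [Field K] [Algebra ℂ K]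

/-- Transport of the charts along an isomorphism. -/
def Stage.ofIso {P : QuadricPoint n K} {D : Set (Fin (n + 1))} {X Y : Scheme.{0}}
    {p : X ⟶ Spec (.of ℂ)} {T : Fin (n + 1) → Closeds X} (S : Stage P D p T) (e : Y ≅ X) :
    Stage P D (e.hom ≫ p) fun i => (T i).preimage e.hom.continuous where
  proper := have := S.proper; inferInstance
  ξ := S.ξ ≫ e.inv
  ξ_comp := by rw [Category.assoc, e.inv_hom_id_assoc, S.ξ_comp]
  chart j ε := S.chart j ε ≫ e.inv
  specMap_chart j ε := by rw [← Category.assoc, S.specMap_chart]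
  cover y := by
    obtain ⟨j, ε, h⟩ := S.cover (e.hom y)
    refine ⟨j, ε, fun ε' h' => ?_⟩
    obtain ⟨q, hq⟩ := h ε' h'
    refine ⟨q, ?_⟩
    rw [Scheme.Hom.comp_apply, hq, ← Scheme.Hom.comp_apply, e.hom_inv_id]
    rfl
  mem_T j ε k q := by
    rw [← S.mem_T]
    change e.hom ((S.chart j ε ≫ e.inv) q) ∈ T k ↔ _
    rw [← Scheme.Hom.comp_apply, Category.assoc, e.inv_hom_id, Category.comp_id]

lemma exists_isWonderfulCompactification (P : QuadricPoint n K) :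
    ∃ (W : Scheme.{0}) (π : W ⟶ quadric n) (T : Fin (n + 1) → Closeds W),
      IsWonderfulCompactification π ∧ Nonempty (Stage P Set.univ (π ≫ quadricToSpec n) T) := by
  obtain ⟨S⟩ := P.nonempty_stage
  obtain ⟨W, π, T, h1, h2⟩ := Stage.exists_isIteratedBlowup (List.finRange (n + 1))
    (List.nodup_finRange _) ∅ (by simp) _ _ S
  refine ⟨W, π, T, ?_, ?_⟩
  · rwa [← List.ofFn_eq_map] at h1
  · have : {k | k ∈ List.finRange (n + 1)} ∪ (∅ : Set (Fin (n + 1))) = Set.univ := by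
      ext; simp
    rwa [this] at h2

/-- An arbitrary wonderful compactification is isomorphic over the quadric to the constructed one
and inherits its charts. -/
lemma IsWonderfulCompactification.exists_stage (P : QuadricPoint n K) {W : Scheme.{0}}
    {π : W ⟶ quadric n} (h : IsWonderfulCompactification π) :
    ∃ T : Fin (n + 1) → Closeds W, Nonempty (Stage P Set.univ (π ≫ quadricToSpec n) T) := by
  obtain ⟨W', π', T, h', ⟨S⟩⟩ := exists_isWonderfulCompactification P
  obtain ⟨e, he⟩ := IsIteratedBlowup.exists_iso h h' (Iso.refl _) (by
    refine (List.map_id _).symm.trans (List.map_congr_left fun C _ => ?_)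
    rfl)
  rw [Iso.refl_hom, Category.comp_id] at he
  have := S.ofIso e
  rw [← Category.assoc, he] at this
  exact ⟨_, ⟨this⟩⟩

end Uniqueness

/-! ### Smoothness of affine space, stalks, and a separatedness argument. -/

section AffineSpace

/-- The presentation of a polynomial ring without relations. -/
def mvPolynomialPresentation (R σ : Type) [CommRing R] :
    Algebra.SubmersivePresentation R (MvPolynomial σ R) σ Empty where
  __ := Algebra.Generators.mvPolynomial R σ
  relation := Empty.elim
  span_range_relation_eq_ker := by
    rw [Algebra.Generators.ker_mvPolynomial, Set.range_eq_empty, Ideal.span_empty]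
  map := Empty.elim
  map_inj a := a.elim
  jacobian_isUnit := by
    rw [Algebra.PreSubmersivePresentation.jacobian_eq_jacobiMatrix_det, Matrix.det_isEmpty, map_one]
    exact isUnit_one

lemma smoothOfRelativeDimension_mvPolynomial (σ : Type) [Fintype σ] :
    SmoothOfRelativeDimension (Fintype.card σ)
      (Spec.map (CommRingCat.ofHom (algebraMap ℂ (MvPolynomial σ ℂ)))) := by
  have h : Algebra.IsStandardSmoothOfRelativeDimension (Fintype.card σ) ℂ (MvPolynomial σ ℂ) :=
    (mvPolynomialPresentation ℂ σ).isStandardSmoothOfRelativeDimension (by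
      simp [Algebra.Presentation.dimension])
  rw [HasRingHomProperty.Spec_iff (P := @SmoothOfRelativeDimension (Fintype.card σ))]
  refine RingHom.locally_of RingHom.isStandardSmoothOfRelativeDimension_respectsIso _ ?_
  exact (RingHom.isStandardSmoothOfRelativeDimension_algebraMap _).2 h

instance (n : ℕ) : IsZariskiLocalAtSource (@SmoothOfRelativeDimension.{0} n) :=
  HasRingHomProperty.instIsZariskiLocalAtSource
    (Q := RingHom.Locally (RingHom.IsStandardSmoothOfRelativeDimension n))

lemma exists_mul_eq_of_toStalk {A : Type} [CommRing A] {q : PrimeSpectrum A} {B : CommRingCat.{0}}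
    (γ : .of A ⟶ B) (e : B ⟶ (Spec (.of A)).presheaf.stalk q) [IsIso e]
    (h : γ ≫ e = StructureSheaf.toStalk A q) (z : B) :
    ∃ a b : A, IsUnit (γ.hom b) ∧ z * γ.hom b = γ.hom a := by
  have h1 (w : (Spec.structureSheaf A).presheaf.stalk q) : ∃ a b : A,
      IsUnit (algebraMap A ((Spec.structureSheaf A).presheaf.stalk q) b) ∧
        w * algebraMap A _ b = algebraMap A _ a := by
    obtain ⟨⟨a, b⟩, hab⟩ := IsLocalization.surj (M := q.asIdeal.primeCompl) w
    exact ⟨a, b, IsLocalization.map_units (M := q.asIdeal.primeCompl) _ b, hab⟩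
  obtain ⟨a, b, h2, h3⟩ := h1 (e.hom z)
  have h4 (a) : e.hom (γ.hom a) = algebraMap A ((Spec.structureSheaf A).presheaf.stalk q) a :=
    ConcreteCategory.congr_hom h a
  refine ⟨a, b, ?_, (ConcreteCategory.bijective_of_isIso e).1 ?_⟩
  · rw [← h4] at h2
    exact (isUnit_map_iff (asIso e).commRingCatIsoToRingEquiv (γ.hom b)).1 h2
  · exact (map_mul e.hom _ _).trans (by rw [h4]; exact h3.trans (h4 a).symm)

/-- Injectivity of `σ` makes `Spec.map σ` dominant, and morphisms from a reduced scheme to a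
separated one are determined on a dominant source. Their being morphisms over the same base also
follows from injectivity. -/
lemma eq_of_specMap_comp_eq {X : Scheme.{0}} {K C B : CommRingCat.{0}} [IsReduced (Spec B)]
    (p : X ⟶ Spec C) [IsSeparated p] (f g : Spec B ⟶ X) (σ : B ⟶ K)
    (hσ : Function.Injective σ.hom) (h : Spec.map σ ≫ f = Spec.map σ ≫ g) : f = g := by
  have hd : IsDominant (Spec.map σ) := by
    refine ⟨(PrimeSpectrum.denseRange_comap_iff_ker_le_nilRadical _).2 ?_⟩
    rw [(RingHom.injective_iff_ker_eq_bot _).1 hσ]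
    exact bot_le
  refine ext_of_isDominant_of_isSeparated p ?_ (Spec.map σ) h
  obtain ⟨β, hβ⟩ := Spec.map_surjective (f ≫ p)
  obtain ⟨β', hβ'⟩ := Spec.map_surjective (g ≫ p)
  rw [← hβ, ← hβ']
  congr 1
  have : Mono σ := ConcreteCategory.mono_of_injective _ hσ
  rw [← cancel_mono σ]
  apply Spec.map_injective
  rw [Spec.map_comp, Spec.map_comp, hβ, hβ', ← Category.assoc, h, Category.assoc]

lemma exists_toStalk_of_isOpenImmersion {X : Scheme.{0}} {A : Type} [CommRing A]
    (c : Spec (.of A) ⟶ X) [IsOpenImmersion c] (q : Spec (.of A)) :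
    ∃ γ : .of A ⟶ X.presheaf.stalk (c q), Spec.map γ ≫ c = X.fromSpecStalk (c q) ∧
      ∀ z, ∃ a b : A, IsUnit (γ.hom b) ∧ z * γ.hom b = γ.hom a := by
  have hr : Set.range (X.fromSpecStalk (c q)) ⊆ Set.range c := by
    rw [Scheme.range_fromSpecStalk]
    intro y hy
    exact Specializes.mem_open hy c.isOpenEmbedding.isOpen_range ⟨q, rfl⟩
  obtain ⟨γ, hγ⟩ := Spec.map_surjective (IsOpenImmersion.lift c (X.fromSpecStalk (c q)) hr)
  have h1 : Spec.map γ ≫ c = X.fromSpecStalk (c q) := by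
    rw [hγ, IsOpenImmersion.lift_fac]
  refine ⟨γ, h1, exists_mul_eq_of_toStalk γ (c.stalkMap q) ?_⟩
  apply Spec.map_injective
  rw [← cancel_mono c, Spec.map_comp, Category.assoc, h1, Scheme.SpecMap_stalkMap_fromSpecStalk,
    Spec.fromSpecStalk_eq']
  rfl

end AffineSpace

/-! ### Integrality, smoothness, and the local rings inside the function field. -/

namespace QuadricPoint

variable {n : ℕ} {K F : Type} [Field K] [Algebra ℂ K] [Field F] [Algebra ℂ F]

/-- Transport of homogeneous coordinates along an isomorphism. -/
def map (P : QuadricPoint n K) (e : K ≃ₐ[ℂ] F) : QuadricPoint n F where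
  x i s := e (P.x i s)
  ne_zero i s := (map_ne_zero_iff _ e.injective).2 (P.ne_zero i s)
  sum_eq := by
    simp only [← map_mul, ← map_sum, P.sum_eq, map_zero]
  generates L hL := by
    have h := P.generates (L.comap e.toAlgHom) fun i s j t => by
      change e (P.x i s / P.x j t) ∈ L
      rw [map_div₀]
      exact hL i s j t
    rw [eq_top_iff]
    rintro z -
    have hz : e.symm z ∈ L.comap e.toAlgHom := by rw [h]; trivial
    simpa using (show e (e.symm z) ∈ L from hz)
  le_trdeg := e.trdeg_eq ▸ P.le_trdeg

lemma map_chartHom (P : QuadricPoint n K) (e : K ≃ₐ[ℂ] F) (D : Set (Fin (n + 1)))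
    (j : Fin (n + 1)) (ε : Fin (n + 1) → Fin 2) (a : MvPolynomial (Var j) ℂ) :
    (P.map e).chartHom D j ε a = e (P.chartHom D j ε a) := by
  have h : (P.map e).chartHom D j ε = e.toAlgHom.comp (P.chartHom D j ε) := by
    ext v
    simp only [chartHom, MvPolynomial.aeval_X, AlgHom.comp_apply, coord, map]
    split_ifs <;> exact (map_div₀ e _ _).symm
  rw [h]
  rfl

end QuadricPoint

namespace Stage

variable {n : ℕ} {K : Type} [Field K] [Algebra ℂ K]
  {P : QuadricPoint n K} {D : Set (Fin (n + 1))} {X : Scheme.{0}}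
  {p : X ⟶ Spec (.of ℂ)} {T : Fin (n + 1) → Closeds X} (S : Stage P D p T)

/-- The generic point. -/
abbrev pt : X := S.ξ (IsLocalRing.closedPoint (CommRingCat.of K))

lemma pt_specializes (x : X) : S.pt ⤳ x := by
  obtain ⟨j, ε, q, rfl⟩ := S.exists_mem_range_chart x
  let b : Spec (.of (MvPolynomial (Var j) ℂ)) :=
    Spec.map (CommRingCat.ofHom (P.chartHom D j ε).toRingHom) (IsLocalRing.closedPoint K)
  have h : S.pt = S.chart j ε b := by
    have := Scheme.Hom.comp_apply (Spec.map (CommRingCat.ofHom (P.chartHom D j ε).toRingHom))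
      (S.chart j ε) (IsLocalRing.closedPoint K)
    rw [S.specMap_chart] at this
    exact this
  have hb : b ⤳ q := by
    refine (PrimeSpectrum.le_iff_specializes b q).1 ?_
    intro a ha
    have h1 : P.chartHom D j ε a ∈ IsLocalRing.maximalIdeal K := ha
    rw [IsLocalRing.maximalIdeal_eq_bot, Ideal.mem_bot,
      map_eq_zero_iff _ (P.chartHom_injective D j ε)] at h1
    rw [h1]
    exact zero_mem _
  rw [h]
  exact hb.map (S.chart j ε).continuous

include S in
lemma isIntegral : IsIntegral X := by
  have h1 : IrreducibleSpace X := by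
    have hc : closure {S.pt} = Set.univ := by
      ext x
      simpa [← specializes_iff_mem_closure] using S.pt_specializes x
    have : PreirreducibleSpace X := ⟨hc ▸ isIrreducible_singleton.closure.isPreirreducible⟩
    exact ⟨⟨S.pt⟩⟩
  have h2 : IsReduced X := by
    choose j ε hx using S.exists_mem_range_chart
    let 𝒰 := pointCover X (fun x => Spec (.of (MvPolynomial (Var (j x)) ℂ)))
      (fun x => S.chart (j x) (ε x)) hx
    have : ∀ i, IsReduced (𝒰.X i) := fun i =>
      inferInstanceAs (IsReduced (Spec (.of (MvPolynomial (Var (j i)) ℂ))))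
    exact IsReduced.of_openCover X 𝒰
  exact isIntegral_of_irreducibleSpace_of_isReduced X

lemma chart_comp (j : Fin (n + 1)) (ε : Fin (n + 1) → Fin 2) : S.chart j ε ≫ p =
    Spec.map (CommRingCat.ofHom (algebraMap ℂ (MvPolynomial (Var j) ℂ))) := by
  obtain ⟨α, hα⟩ := Spec.map_surjective (S.chart j ε ≫ p)
  rw [← hα]
  congr 1
  refine CommRingCat.hom_ext (RingHom.ext fun r => ?_)
  apply P.chartHom_injective D j ε
  have h := S.ξ_comp
  rw [← S.specMap_chart j ε, Category.assoc, ← hα, ← Spec.map_comp] at h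
  exact (ConcreteCategory.congr_hom (Spec.map_injective h) r).trans
    ((P.chartHom D j ε).commutes r).symm

include S in
lemma smoothOfRelativeDimension : SmoothOfRelativeDimension (2 * n) p := by
  choose j ε hx using S.exists_mem_range_chart
  let 𝒰 := pointCover X (fun x => Spec (.of (MvPolynomial (Var (j x)) ℂ)))
    (fun x => S.chart (j x) (ε x)) hx
  rw [IsZariskiLocalAtSource.iff_of_openCover (P := @SmoothOfRelativeDimension (2 * n)) 𝒰]
  intro x
  change SmoothOfRelativeDimension (2 * n) (S.chart (j x) (ε x) ≫ p)
  rw [chart_comp, ← card_var (j x)]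
  exact smoothOfRelativeDimension_mvPolynomial (Var (j x))

variable [IsIntegral X]

/-- The embedding of the function field in `K`. -/
def fieldHom : X.functionField ⟶ .of K :=
  X.presheaf.stalkSpecializes ((S.pt_specializes (genericPoint X))) ≫
    Scheme.stalkClosedPointTo S.ξ

/-- The embedding of the local rings in `K`. -/
def stalkHom (x : X) : X.presheaf.stalk x ⟶ .of K :=
  X.presheaf.stalkSpecializes ((genericPoint_spec X).specializes trivial) ≫ S.fieldHom

lemma specMap_fieldHom : Spec.map S.fieldHom ≫ X.fromSpecStalk (genericPoint X) = S.ξ := by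
  rw [fieldHom, Spec.map_comp, Category.assoc, Scheme.SpecMap_stalkSpecializes_fromSpecStalk]
  exact Scheme.Spec_stalkClosedPointTo_fromSpecStalk S.ξ

lemma specMap_stalkHom (x : X) : Spec.map (S.stalkHom x) ≫ X.fromSpecStalk x = S.ξ := by
  rw [stalkHom, Spec.map_comp, Category.assoc, Scheme.SpecMap_stalkSpecializes_fromSpecStalk, specMap_fieldHom]

lemma stalkHom_injective (x : X) : Function.Injective (S.stalkHom x).hom :=
  S.fieldHom.hom.injective.comp (IsFractionRing.injective (X.presheaf.stalk x) X.functionField)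

lemma exists_chartToStalk (j : Fin (n + 1)) (ε : Fin (n + 1) → Fin 2)
    (q : Spec (.of (MvPolynomial (Var j) ℂ))) :
    ∃ γ : MvPolynomial (Var j) ℂ →+* X.presheaf.stalk (S.chart j ε q),
      (∀ a, (S.stalkHom (S.chart j ε q)).hom (γ a) = P.chartHom D j ε a) ∧
      ∀ z, ∃ a b, IsUnit (γ b) ∧ z * γ b = γ a := by
  obtain ⟨γ, h1, h⟩ := exists_toStalk_of_isOpenImmersion (S.chart j ε) q
  have h2 : γ ≫ S.stalkHom (S.chart j ε q) = CommRingCat.ofHom (P.chartHom D j ε).toRingHom := by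
    apply Spec.map_injective
    rw [← cancel_mono (S.chart j ε), Spec.map_comp, Category.assoc, h1, specMap_stalkHom,
      S.specMap_chart]
  have h3 := congrArg CommRingCat.Hom.hom h2
  exact ⟨γ.hom, fun a => DFunLike.congr_fun h3 a, h⟩

lemma fieldHom_algebraMap (r : ℂ) :
    S.fieldHom.hom (algebraMap ℂ (FunctionField p) r) = algebraMap ℂ K r := by
  have h : ((Scheme.ΓSpecIso (.of ℂ)).inv ≫ p.appTop ≫
      X.presheaf.germ ⊤ (genericPoint X) trivial) ≫ S.fieldHom =
      CommRingCat.ofHom (algebraMap ℂ K) := by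
    apply Spec.map_injective
    rw [← S.ξ_comp, Spec.map_comp, Spec.map_comp, Spec.map_comp,
      ← Scheme.fromSpecStalk_toSpecΓ X (genericPoint X), Category.assoc, Category.assoc,
      ← Category.assoc, S.specMap_fieldHom, ← Scheme.toSpecΓ_naturality_assoc]
    simp
  have h' := congrArg CommRingCat.Hom.hom h
  exact DFunLike.congr_fun h' r

lemma fieldHom_surjective : Function.Surjective S.fieldHom.hom := by
  intro z
  obtain ⟨j, ε, q, -⟩ := S.exists_mem_range_chart S.pt
  obtain ⟨γ, hγ, -⟩ := S.exists_chartToStalk j ε q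
  have h (a) : ∃ w, S.fieldHom.hom w = P.chartHom D j ε a := ⟨_, hγ a⟩
  obtain ⟨a, b, -, rfl⟩ := P.exists_chartHom_div_eq D j ε z
  obtain ⟨v, hv⟩ := h a
  obtain ⟨w, hw⟩ := h b
  refine ⟨v / w, ?_⟩
  rw [map_div₀, hv, hw]

/-- The embedding of the function field in `K` is an isomorphism. -/
def fieldEquiv : FunctionField p ≃ₐ[ℂ] K :=
  AlgEquiv.ofBijective (⟨S.fieldHom.hom, S.fieldHom_algebraMap⟩ : FunctionField p →ₐ[ℂ] K)
    ⟨S.fieldHom.hom.injective, S.fieldHom_surjective⟩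

/-- The homogeneous coordinates of the generic point, in the function field. -/
def point : QuadricPoint n (FunctionField p) := P.map S.fieldEquiv.symm

lemma fieldEquiv_chartHom (j : Fin (n + 1)) (ε : Fin (n + 1) → Fin 2)
    (a : MvPolynomial (Var j) ℂ) :
    S.fieldEquiv (S.point.chartHom D j ε a) = P.chartHom D j ε a := by
  rw [point, QuadricPoint.map_chartHom, AlgEquiv.apply_symm_apply]

lemma algebraMap_eq_chartHom {x : X} (j : Fin (n + 1)) (ε : Fin (n + 1) → Fin 2)
    (a : MvPolynomial (Var j) ℂ) (z : X.presheaf.stalk x)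
    (h : (S.stalkHom x).hom z = P.chartHom D j ε a) :
    algebraMap (X.presheaf.stalk x) X.functionField z = S.point.chartHom D j ε a := by
  apply S.fieldEquiv.injective
  rw [fieldEquiv_chartHom, ← h]
  rfl

lemma chartHom_mem_localRing (j : Fin (n + 1)) (ε : Fin (n + 1) → Fin 2) {x : X}
    (hx : x ∈ Set.range (S.chart j ε)) (a : MvPolynomial (Var j) ℂ) :
    S.point.chartHom D j ε a ∈ localRing p x := by
  obtain ⟨q, rfl⟩ := hx
  obtain ⟨γ, hγ, -⟩ := S.exists_chartToStalk j ε q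
  exact ⟨γ a, S.algebraMap_eq_chartHom j ε a _ (hγ a)⟩

lemma exists_eq_div_of_mem_localRing (j : Fin (n + 1)) (ε : Fin (n + 1) → Fin 2) {x : X}
    (hx : x ∈ Set.range (S.chart j ε)) {z : FunctionField p} (hz : z ∈ localRing p x) :
    ∃ a b, (S.point.chartHom D j ε b)⁻¹ ∈ localRing p x ∧ b ≠ 0 ∧
      z = S.point.chartHom D j ε a / S.point.chartHom D j ε b := by
  obtain ⟨q, rfl⟩ := hx
  obtain ⟨γ, hγ, h⟩ := S.exists_chartToStalk j ε q
  obtain ⟨w, rfl⟩ := hz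
  obtain ⟨a, b, hb, hab⟩ := h w
  have h1 (a) := S.algebraMap_eq_chartHom j ε a _ (hγ a)
  obtain ⟨c, hc⟩ := hb.exists_right_inv
  let c' : FunctionField p := algebraMap (X.presheaf.stalk (S.chart j ε q)) X.functionField c
  have h2 : S.point.chartHom D j ε b * c' = 1 := by
    rw [← h1]
    refine (map_mul (algebraMap (X.presheaf.stalk (S.chart j ε q)) X.functionField) _ _).symm.trans ?_
    rw [hc, map_one]
    rfl
  have h3 : S.point.chartHom D j ε b ≠ 0 := left_ne_zero_of_mul_eq_one h2
  refine ⟨a, b, ⟨c, (inv_eq_of_mul_eq_one_right h2).symm⟩, ?_, ?_⟩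
  · rintro rfl
    exact h3 (map_zero _)
  · rw [eq_div_iff h3, ← h1, ← h1, ← hab]
    exact (map_mul _ _ _).symm

/-- If the coordinates of the chart are regular at `x`, they define a morphism from the spectrum of
the local ring to the chart. It agrees generically with the canonical morphism to `X`, hence
everywhere by separatedness, and the closed point goes to `x`. -/
lemma mem_range_chart (j : Fin (n + 1)) (ε : Fin (n + 1) → Fin 2) {x : X}
    (h : ∀ a, S.point.chartHom D j ε a ∈ localRing p x) : x ∈ Set.range (S.chart j ε) := by
  obtain ⟨α, hα⟩ := exists_hom_of_range_le (algebraMap (X.presheaf.stalk x) X.functionField)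
    (IsFractionRing.injective _ _) (S.point.chartHom D j ε).toRingHom (by
      rintro _ ⟨a, rfl⟩
      exact h a)
  obtain ⟨β, hβ⟩ : ∃ β : .of (MvPolynomial (Var j) ℂ) ⟶ X.presheaf.stalk x, β.hom = α :=
    ⟨CommRingCat.ofHom α, rfl⟩
  have h1 : β ≫ S.stalkHom x = CommRingCat.ofHom (P.chartHom D j ε).toRingHom := by
    refine CommRingCat.hom_ext (RingHom.ext fun a => ?_)
    have h2 : algebraMap (X.presheaf.stalk x) X.functionField (β.hom a) =
        S.point.chartHom D j ε a := by
      rw [hβ]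
      exact DFunLike.congr_fun hα a
    have h3 := congrArg S.fieldEquiv h2
    rw [fieldEquiv_chartHom] at h3
    exact h3
  have hp := S.proper
  have hr : IsReduced (Spec (X.presheaf.stalk x)) := inferInstance
  have h4 := eq_of_specMap_comp_eq p (Spec.map β ≫ S.chart j ε) (X.fromSpecStalk x)
    (S.stalkHom x) (S.stalkHom_injective x) (by
      rw [← Category.assoc, ← Spec.map_comp, h1, S.specMap_chart, specMap_stalkHom])
  have h5 := Scheme.fromSpecStalk_closedPoint (X := X) (x := x)
  rw [← h4] at h5
  exact ⟨_, h5⟩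

end Stage

/-! ### Column operations and lattices for alternating maps. -/

section AlternatingMap

variable {R M N ι : Type*} [CommRing R] [AddCommGroup M] [Module R M] [AddCommGroup N] [Module R N]
  [DecidableEq ι]

/-- The value of an alternating map does not change if multiples of some entries are added to other
entries. -/
lemma map_add_smul_comp (f : M [⋀^ι]→ₗ[R] N) (v : ι → M) (c : ι → R) (g : ι → ι) (s : Finset ι)
    (hg : ∀ i ∈ s, g i ∉ s) :
    f (fun i => if i ∈ s then v i + c i • v (g i) else v i) = f v := by
  induction s using Finset.induction_on with
  | empty => simp
  | insert a s ha ih =>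
    have hg' : ∀ i ∈ s, g i ∉ s := fun i hi h =>
      hg i (Finset.mem_insert_of_mem hi) (Finset.mem_insert_of_mem h)
    have h0 := hg a (Finset.mem_insert_self a s)
    rw [Finset.mem_insert, not_or] at h0
    let w : ι → M := fun i => if i ∈ s then v i + c i • v (g i) else v i
    have h1 : (fun i => if i ∈ insert a s then v i + c i • v (g i) else v i) =
        Function.update w a (v a + c a • v (g a)) := by
      funext i
      by_cases hi : i = a
      · subst hi; simp
      · simp [hi, w]
    have h2 : w a = v a := if_neg ha
    have h3 : w (g a) = v (g a) := if_neg h0.2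
    rw [h1, f.map_update_add, f.map_update_smul, ← h2, Function.update_eq_self, ← h3,
      f.map_update_self _ (Ne.symm h0.1), smul_zero, add_zero]
    exact ih hg'

/-- Expand every `u i` in the vectors `b`. Terms with a repeated vector vanish, and the others are
permutations of `b`, contributing $\pm f(b)$ with coefficients in `L`. -/
lemma map_mem_span_of_forall_mem_span [Fintype ι] (L : Subring R) (f : M [⋀^ι]→ₗ[R] N) (b u : ι → M)
    (hu : ∀ i, u i ∈ Submodule.span L (Set.range b)) : f u ∈ Submodule.span L {f b} := by
  simp only [Submodule.mem_span_range_iff_exists_fun] at hu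
  choose h hh using hu
  have h1 : f u = ∑ r : ι → ι, (∏ i, h i (r i)) • f (fun i => b (r i)) := by
    rw [← funext hh]
    refine (f.toMultilinearMap.map_sum _).trans (Finset.sum_congr rfl fun r _ => ?_)
    refine (f.map_smul_univ (fun i => (h i (r i) : R)) _).trans ?_
    rw [Subring.smul_def]
    simp
  rw [h1]
  refine sum_mem fun r _ => Submodule.smul_mem _ _ ?_
  by_cases hr : Function.Injective r
  · have h2 := f.map_perm b (Equiv.ofBijective r (Finite.injective_iff_bijective.1 hr))
    have h3 : f (fun i => b (r i)) = f b ∨ f (fun i => b (r i)) = -f b := by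
      rcases Int.units_eq_one_or (Equiv.Perm.sign
        (Equiv.ofBijective r (Finite.injective_iff_bijective.1 hr))) with h | h
      · rw [h, one_smul] at h2
        exact Or.inl h2
      · rw [h, Units.neg_smul, one_smul] at h2
        exact Or.inr h2
    obtain h | h := h3 <;> rw [h]
    · exact Submodule.mem_span_singleton_self _
    · exact neg_mem (Submodule.mem_span_singleton_self _)
  · rw [f.map_eq_zero_of_not_injective _ fun h => hr fun x y hxy => h (congrArg b hxy)]
    exact zero_mem _

end AlternatingMap

/-! ### An alternating form attached to vectors with one linear relation. -/

section Relations

variable {F M N κ I : Type*} [Field F] [AddCommGroup M] [Module F M] [AddCommGroup N] [Module F N]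
  [Fintype κ] [DecidableEq κ] (f : M [⋀^κ]→ₗ[F] N) (l : I → M) (w : I → F)

/-- The value of `f` on the differences of all but one of the vectors `l`, normalized by the
coefficient of the remaining vector. -/
def normalizedForm (σ : Option (Option κ) ≃ I) : N :=
  (w (σ none))⁻¹ • f fun k => l (σ (some (some k))) - l (σ (some none))

variable {l w} [Fintype I] (hw : ∀ t, w t ≠ 0) (h0 : ∑ t, w t = 0) (h1 : ∑ t, w t • l t = 0)

-- As the weights sum to zero, the relation also holds for the differences from the base vector. It
-- expresses the omitted difference through the others, and in slot `k` only the `k`-th of them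
-- survives, with a minus sign and the ratio of weights that the normalization absorbs.
include hw h0 h1 in
lemma normalizedForm_swap_none (σ : Option (Option κ) ≃ I) (k : κ) :
    normalizedForm f l w ((Equiv.swap none (some (some k))).trans σ) = -normalizedForm f l w σ := by
  let v : κ → M := fun k => l (σ (some (some k))) - l (σ (some none))
  have e1 : (∑ i, w (σ (some (some i))) • v i) +
      w (σ none) • (l (σ none) - l (σ (some none))) = 0 := by
    have h : ∑ t, w t • (l t - l (σ (some none))) = 0 := by
      simp only [smul_sub, Finset.sum_sub_distrib, ← Finset.sum_smul, h0, h1]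
      simp
    rw [← σ.sum_comp, Fintype.sum_option, Fintype.sum_option, sub_self, smul_zero, zero_add,
      add_comm] at h
    exact h
  have e2 : (fun i => l ((Equiv.swap none (some (some k))).trans σ (some (some i))) -
      l ((Equiv.swap none (some (some k))).trans σ (some none))) =
      Function.update v k (l (σ none) - l (σ (some none))) := by
    funext i
    have h : (Equiv.swap none (some (some k)) (some none) : Option (Option κ)) = some none :=
      Equiv.swap_apply_of_ne_of_ne (by simp) (by simp)
    by_cases hi : i = k
    · subst hi
      simp [h]
    · have h' : (Equiv.swap none (some (some k)) (some (some i)) : Option (Option κ)) =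
          some (some i) := Equiv.swap_apply_of_ne_of_ne (by simp) (by simpa using hi)
      simp [h, h', hi, v]
  have e3 : w (σ none) • f (Function.update v k (l (σ none) - l (σ (some none)))) =
      -(w (σ (some (some k))) • f v) := by
    rw [← f.map_update_smul, eq_neg_of_add_eq_zero_right e1, f.map_update_neg, f.map_update_sum,
      Finset.sum_eq_single k]
    · rw [f.map_update_smul, Function.update_eq_self]
    · intro i _ hi
      rw [f.map_update_smul, f.map_update_self _ hi.symm, smul_zero]
    · simp
  rw [normalizedForm, e2, normalizedForm, Equiv.trans_apply, Equiv.swap_apply_left, inv_smul_eq_iff₀ (hw _),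
    smul_neg, smul_comm, eq_comm, ← smul_neg, inv_smul_eq_iff₀ (hw _), e3]

-- Taking the `k`-th vector as the new base replaces $v_k$ by $-v_k$ and every other $v_i$ by
-- $v_i-v_k$. Adding multiples of one entry to the others does not change an alternating form.
omit [Fintype I] in
lemma normalizedForm_swap_some (σ : Option (Option κ) ≃ I) (k : κ) :
    normalizedForm f l w ((Equiv.swap (some none) (some (some k))).trans σ) =
      -normalizedForm f l w σ := by
  let v : κ → M := fun k => l (σ (some (some k))) - l (σ (some none))
  have e1 := map_add_smul_comp f (Function.update v k (-v k)) (fun _ => 1) (fun _ => k)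
    (Finset.univ.erase k) (by simp)
  have e2 : (fun i => l ((Equiv.swap (some none) (some (some k))).trans σ (some (some i))) -
      l ((Equiv.swap (some none) (some (some k))).trans σ (some none))) =
      fun i => if i ∈ Finset.univ.erase k then Function.update v k (-v k) i +
        (1 : F) • Function.update v k (-v k) k else Function.update v k (-v k) i := by
    funext i
    by_cases hi : i = k
    · subst hi
      simp [v]
    · have h' : (Equiv.swap (some none) (some (some k)) (some (some i)) : Option (Option κ)) =
          some (some i) := Equiv.swap_apply_of_ne_of_ne (by simp) (by simpa using hi)
      simp [h', hi, v]
  have h : (Equiv.swap (some none) (some (some k)) none : Option (Option κ)) = none :=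
    Equiv.swap_apply_of_ne_of_ne (by simp) (by simp)
  rw [normalizedForm, e2, e1, f.map_update_neg, Function.update_eq_self, smul_neg,
    Equiv.trans_apply, h, normalizedForm]

include hw h0 h1 in
/-- Up to sign, the normalized form is independent of the choices. -/
lemma normalizedForm_eq_or_eq_neg [Nonempty κ] (σ τ : Option (Option κ) ≃ I) :
    normalizedForm f l w σ = normalizedForm f l w τ ∨
      normalizedForm f l w σ = -normalizedForm f l w τ := by
  let Q (g : Equiv.Perm (Option (Option κ))) : Prop := ∀ σ : Option (Option κ) ≃ I,
    normalizedForm f l w (g.trans σ) = normalizedForm f l w σ ∨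
      normalizedForm f l w (g.trans σ) = -normalizedForm f l w σ
  have mul {a b} (ha : Q a) (hb : Q b) : Q (a * b) := by
    intro σ
    change normalizedForm f l w (b.trans (a.trans σ)) = _ ∨
      normalizedForm f l w (b.trans (a.trans σ)) = _
    obtain h | h := hb (a.trans σ) <;> obtain h' | h' := ha σ <;> simp [h, h']
  have conj {x y z : Option (Option κ)} (hxy : x ≠ y) (hxz : x ≠ z) (h : Q (Equiv.swap y z))
      (h' : Q (Equiv.swap x y)) : Q (Equiv.swap z x) := by
    rw [← Equiv.swap_mul_swap_mul_swap hxy hxz]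
    exact mul (mul h h') h
  have swap1 (k : κ) : Q (Equiv.swap none (some (some k))) := fun σ =>
    Or.inr (normalizedForm_swap_none f hw h0 h1 σ k)
  have swap2 (k : κ) : Q (Equiv.swap (some (some k)) (some none)) := fun σ => by
    rw [Equiv.swap_comm]
    exact Or.inr (normalizedForm_swap_some f σ k)
  have swap3 (x : Option κ) : Q (Equiv.swap (some x) none) := by
    cases x with
    | some k => rw [Equiv.swap_comm]; exact swap1 k
    | none =>
      -- The omitted label and the base label are exchanged by way of a third label.
      obtain ⟨k⟩ := ‹Nonempty κ›
      exact conj (by simp) (by simp) (swap2 k) (swap1 k)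
  have swap4 (x y : Option (Option κ)) (hxy : x ≠ y) : Q (Equiv.swap x y) := by
    cases x with
    | none =>
      cases y with
      | none => exact absurd rfl hxy
      | some y => rw [Equiv.swap_comm]; exact swap3 y
    | some x =>
      cases y with
      | none => exact swap3 x
      | some y =>
        refine conj (by simp) hxy.symm ?_ (swap3 y)
        rw [Equiv.swap_comm]; exact swap3 x
  have h (g) : Q g := by
    induction g using Equiv.Perm.swap_induction_on with
    | one => exact fun σ => Or.inl rfl
    | swap_mul f x y hxy hf => exact mul (swap4 x y hxy) hf
  have := h (σ.trans τ.symm) τ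
  rwa [Equiv.trans_assoc, Equiv.symm_trans_self, Equiv.trans_refl] at this

end Relations

/-! ### The canonical form on the charts. -/

namespace QuadricPoint

variable {n : ℕ} {K : Type} [Field K] [Algebra ℂ K] (P : QuadricPoint n K)
  (j : Fin (n + 1)) (ε : Fin (n + 1) → Fin 2)

local notation "d" => KaehlerDifferential.D ℂ K

/-- A numbering of the coordinates of a chart. -/
def varEquiv : Fin (2 * n) ≃ Var j := (Fintype.equivFinOfCardEq (card_var j)).symm

/-- The labels of the homogeneous coordinates, arranged according to a chart. -/
def labelFun : Option (Option (Fin (2 * n))) → Fin (n + 1) × Fin 2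
  | none => (j, (ε j).rev)
  | some none => (j, ε j)
  | some (some k) => ((varEquiv j k).1,
      if (varEquiv j k).2 = 0 then ε (varEquiv j k).1 else (ε (varEquiv j k).1).rev)

lemma finTwo_rev_ne (s : Fin 2) : s.rev ≠ s := by
  revert s; decide

lemma labelFun_injective : Function.Injective (labelFun j ε) := by
  have h1 (k : Fin (2 * n)) : ((varEquiv j k).1 : Fin (n + 1)) ≠ j := (varEquiv j k).1.2
  rintro (_ | _ | k) (_ | _ | k') h
  · rfl
  · exact absurd (congrArg Prod.snd h) (finTwo_rev_ne _)
  · exact absurd (congrArg Prod.fst h).symm (h1 k')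
  · exact absurd (congrArg Prod.snd h).symm (finTwo_rev_ne _)
  · rfl
  · exact absurd (congrArg Prod.fst h).symm (h1 k')
  · exact absurd (congrArg Prod.fst h) (h1 k)
  · exact absurd (congrArg Prod.fst h) (h1 k)
  · have e1 : (varEquiv j k).1 = (varEquiv j k').1 := Subtype.ext (congrArg Prod.fst h)
    have e2 : (varEquiv j k).2 = (varEquiv j k').2 := by
      have h2 := congrArg Prod.snd h
      simp only [labelFun] at h2
      rw [e1] at h2
      have e3 := finTwo_rev_ne (ε (varEquiv j k').1)
      obtain h3 | h3 := finTwo_eq_or_rev 0 (varEquiv j k).2 <;>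
        obtain h4 | h4 := finTwo_eq_or_rev 0 (varEquiv j k').2 <;>
        simp [h3, h4, e3, e3.symm] at h2 ⊢
    rw [(varEquiv j).injective (Prod.ext e1 e2)]

/-- The labels of the homogeneous coordinates, arranged according to a chart. -/
def labelEquiv : Option (Option (Fin (2 * n))) ≃ Fin (n + 1) × Fin 2 :=
  Equiv.ofBijective (labelFun j ε) ((Fintype.bijective_iff_injective_and_card _).2
    ⟨labelFun_injective j ε, by simp; ring⟩)

/-- The logarithmic differentials of the homogeneous coordinates. -/
def dlog (t : Fin (n + 1) × Fin 2) : Ω[K⁄ℂ] := (P.x t.1 t.2)⁻¹ • d (P.x t.1 t.2)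

/-- The summands of the quadratic form. -/
def weight (t : Fin (n + 1) × Fin 2) : K := P.x t.1 0 * P.x t.1 1

lemma weight_ne_zero (t : Fin (n + 1) × Fin 2) : P.weight t ≠ 0 :=
  mul_ne_zero (P.ne_zero _ _) (P.ne_zero _ _)

lemma sum_weight : ∑ t, P.weight t = 0 := by
  rw [Fintype.sum_prod_type]
  simp [weight, ← Finset.mul_sum, P.sum_eq]

/-- This is the differential of the equation of the quadric, since $x_{i,0}x_{i,1}\,d\log
x_{i,s}=x_{i,1-s}\,dx_{i,s}$. -/
lemma sum_weight_smul_dlog : ∑ t, P.weight t • P.dlog t = 0 := by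
  rw [Fintype.sum_prod_type, ← map_zero d, ← P.sum_eq, map_sum]
  refine Finset.sum_congr rfl fun i _ => ?_
  have h0 := P.ne_zero i 0
  have h1 := P.ne_zero i 1
  rw [Fin.sum_univ_two, Derivation.leibniz]
  simp only [weight, dlog, smul_smul]
  rw [add_comm, mul_inv_cancel_right₀ h1, mul_comm (P.x i 0), mul_inv_cancel_right₀ h0]

lemma dlog_div (a b : K) (ha : a ≠ 0) (hb : b ≠ 0) :
    d (a / b) = (a / b) • (a⁻¹ • d a - b⁻¹ • d b) := by
  rw [Derivation.leibniz_div, smul_sub, smul_sub, smul_smul, smul_smul, smul_smul, smul_smul]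
  congr 2 <;> field_simp

/-- The generator of the regular forms on a chart. -/
def chartForm : ⋀[K]^(2 * n) Ω[K⁄ℂ] :=
  exteriorPower.ιMulti K (2 * n) fun k => d (P.coord Set.univ j ε (varEquiv j k))

/-- The local equation of the canonical divisor on a chart. -/
def chartEqn : K := P.x j (ε j) ^ (n - 1) * ∏ i, P.x i (ε i)

lemma chartEqn_ne_zero : P.chartEqn j ε ≠ 0 :=
  mul_ne_zero (pow_ne_zero _ (P.ne_zero _ _)) (Finset.prod_ne_zero_iff.2 fun _ _ => P.ne_zero _ _)

/-- Each coordinate $a/b$ has differential $(a/b)(d\log a-d\log b)$. The partners have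
$b=x_{i,\varepsilon(i)}$ in place of $x_{j,\varepsilon(j)}$, which is corrected by subtracting the
row of $x_{i,\varepsilon(i)}$. -/
lemma chartForm_eq_prod_smul : P.chartForm j ε = (∏ v, P.coord Set.univ j ε v) •
    exteriorPower.ιMulti K (2 * n) fun k => P.dlog (labelEquiv j ε (some (some k))) -
      P.dlog (labelEquiv j ε (some none)) := by
  let l (k : Fin (2 * n)) : Ω[K⁄ℂ] := P.dlog (labelEquiv j ε (some (some k))) -
      P.dlog (labelEquiv j ε (some none))
  let g (k : Fin (2 * n)) : Fin (2 * n) := (varEquiv j).symm ((varEquiv j k).1, 0)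
  let s : Finset (Fin (2 * n)) := Finset.univ.filter fun k => (varEquiv j k).2 = 1
  have h := map_add_smul_comp (exteriorPower.ιMulti K (2 * n)) l (fun _ => (-1 : K)) g s
    (by simp [s, g])
  change _ = _ • exteriorPower.ιMulti K (2 * n) l
  rw [← h, ← (varEquiv j).prod_comp, ← AlternatingMap.map_smul_univ, chartForm]
  congr 1
  funext k
  have hg : varEquiv j (g k) = ((varEquiv j k).1, 0) := Equiv.apply_symm_apply _ _
  obtain hk | hk := finTwo_eq_or_rev 0 (varEquiv j k).2
  · have hs : k ∉ s := by simp [s, hk]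
    rw [if_neg hs]
    simp only [coord, hk, if_true]
    rw [dlog_div _ _ (P.ne_zero _ _) (P.ne_zero _ _)]
    simp [l, labelEquiv, labelFun, dlog, hk]
  · have hs : k ∈ s := by simp [s, hk]
    rw [if_pos hs]
    simp only [coord, hk]
    rw [if_neg (by decide), if_pos (Set.mem_univ _), dlog_div _ _ (P.ne_zero _ _) (P.ne_zero _ _)]
    simp [l, labelEquiv, labelFun, dlog, hk, hg]

lemma prod_coord_mul_weight (hn : n ≠ 0) : (∏ v, P.coord Set.univ j ε v) * P.weight (j, (ε j).rev) *
    P.chartEqn j ε = ∏ i, P.x i 0 * P.x i 1 := by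
  classical
  have h1 (i : {i // i ≠ j}) : ∏ s, P.coord Set.univ j ε (i, s) =
      P.x i (ε i).rev / P.x j (ε j) := by
    rw [Fin.prod_univ_two]
    simp only [coord, if_true, Set.mem_univ]
    rw [if_neg (by decide), mul_comm, div_mul_div_cancel₀ (P.ne_zero _ _)]
  have h2 : Fintype.card {i // i ≠ j} = n := by simp [Fintype.card_subtype_compl]
  rw [Fintype.prod_prod_type, Fintype.prod_congr _ _ h1, Finset.prod_div_distrib,
    Finset.prod_const, Finset.card_univ, h2, chartEqn, weight,
    ← Finset.mul_prod_erase _ (fun i => P.x i (ε i)) (Finset.mem_univ j),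
    ← Finset.mul_prod_erase _ (fun i => P.x i 0 * P.x i 1) (Finset.mem_univ j),
    ← Finset.prod_subtype (p := fun i => i ≠ j) (Finset.univ.erase j) (by simp)
      (fun i => P.x i (ε i).rev)]
  have h3 : ∏ i ∈ Finset.univ.erase j, P.x i 0 * P.x i 1 =
      (∏ i ∈ Finset.univ.erase j, P.x i (ε i)) * ∏ i ∈ Finset.univ.erase j, P.x i (ε i).rev := by
    rw [← Finset.prod_mul_distrib]
    exact Finset.prod_congr rfl fun i _ => (P.mul_eq_mul_rev i (ε i)).symm
  have h4 := P.ne_zero j (ε j)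
  obtain ⟨m, rfl⟩ : ∃ m, n = m + 1 := Nat.exists_eq_succ_of_ne_zero hn
  rw [h3, Nat.add_sub_cancel, div_mul_eq_mul_div, div_mul_eq_mul_div, div_eq_iff (pow_ne_zero _ h4)]
  ring

/-- The factor in front is the same for all charts, and `normalizedForm` depends on the chart only
up to sign. The exponent $n-1$ in `chartEqn` is what makes the powers of $x_{j,\varepsilon(j)}$
balance. -/
lemma chartEqn_smul_chartForm (hn : n ≠ 0) : P.chartEqn j ε • P.chartForm j ε = (∏ i, P.x i 0 * P.x i 1) •
    normalizedForm (exteriorPower.ιMulti K (2 * n)) P.dlog P.weight (labelEquiv j ε) := by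
  rw [chartForm_eq_prod_smul, ← prod_coord_mul_weight _ j ε hn, normalizedForm, smul_smul, smul_smul]
  congr 1
  have h := P.weight_ne_zero (j, (ε j).rev)
  change _ = _ * (P.weight (j, (ε j).rev))⁻¹
  field_simp

lemma chartEqn_smul_chartForm_eq_or_eq_neg (hn : n ≠ 0) (j' : Fin (n + 1))
    (ε' : Fin (n + 1) → Fin 2) :
    P.chartEqn j ε • P.chartForm j ε = P.chartEqn j' ε' • P.chartForm j' ε' ∨
    P.chartEqn j ε • P.chartForm j ε = -(P.chartEqn j' ε' • P.chartForm j' ε') := by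
  have : Nonempty (Fin (2 * n)) := ⟨⟨0, by omega⟩⟩
  simp only [chartEqn_smul_chartForm _ _ _ hn]
  obtain h | h := normalizedForm_eq_or_eq_neg (exteriorPower.ιMulti K (2 * n)) P.weight_ne_zero
    P.sum_weight P.sum_weight_smul_dlog (labelEquiv j ε) (labelEquiv j' ε')
  · exact Or.inl (by rw [h])
  · exact Or.inr (by rw [h, smul_neg])

/-- The differentials of the coordinates of a chart are a basis of the differentials. -/
lemma exists_basis : ∃ b : Module.Basis (Var j) K Ω[K⁄ℂ], ∀ v, b v = d (P.coord Set.univ j ε v) := by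
  let A := MvPolynomial (Var j) ℂ
  algebraize [(P.chartHom Set.univ j ε).toRingHom]
  have : IsScalarTower ℂ A K := IsScalarTower.of_algebraMap_eq fun r =>
    ((P.chartHom Set.univ j ε).commutes r).symm
  have inj : Function.Injective (algebraMap A K) := P.chartHom_injective Set.univ j ε
  have : FaithfulSMul A K := (faithfulSMul_iff_algebraMap_injective A K).2 inj
  have : IsFractionRing A K := IsFractionRing.of_field A K fun z => by
    obtain ⟨a, b, -, rfl⟩ := P.exists_chartHom_div_eq Set.univ j ε z
    exact ⟨a, b, rfl⟩
  -- `K` is the fraction field of the polynomial ring of the chart, and Kähler differentials commute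
  -- with localization.
  refine ⟨(KaehlerDifferential.mvPolynomialBasis ℂ (Var j)).ofIsLocalizedModule K
    (nonZeroDivisors A) (KaehlerDifferential.map ℂ ℂ A K), fun v => ?_⟩
  rw [Module.Basis.ofIsLocalizedModule_apply, KaehlerDifferential.mvPolynomialBasis_apply,
    KaehlerDifferential.map_D]
  congr 1
  exact MvPolynomial.aeval_X _ _

lemma chartForm_ne_zero : P.chartForm j ε ≠ 0 := by
  obtain ⟨b, hb⟩ := P.exists_basis j ε
  let b' := b.reindex (varEquiv j).symm
  intro h
  have h1 := congrArg (exteriorPower.alternatingMapLinearEquiv b'.det) h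
  have h2 : (fun k => d (P.coord Set.univ j ε (varEquiv j k))) = b' := by
    funext k
    simp [b', hb]
  rw [chartForm, exteriorPower.alternatingMapLinearEquiv_apply_ιMulti, h2, b'.det_self, map_zero] at h1
  exact one_ne_zero h1

end QuadricPoint

/-! ### Quotients of the local equations. -/

namespace QuadricPoint

variable {n : ℕ} {K : Type} [Field K] [Algebra ℂ K] (P : QuadricPoint n K)
  (j : Fin (n + 1)) (ε : Fin (n + 1) → Fin 2)

lemma exists_chartHom_eq_self (i : Fin (n + 1)) (s : Fin 2) :
    ∃ a, P.chartHom Set.univ j ε a = P.x i s / P.x i (ε i) := by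
  obtain rfl | rfl := finTwo_eq_or_rev (ε i) s
  · exact ⟨1, by rw [map_one, div_self (P.ne_zero _ _)]⟩
  · by_cases h : i = j
    · subst h
      exact P.exists_chartHom_eq _ i ε i _
    · exact ⟨_, P.chartHom_X_one_of_mem ⟨i, h⟩ (Set.mem_univ _)⟩

lemma chartEqn_div_chartEqn (j' : Fin (n + 1)) (ε' : Fin (n + 1) → Fin 2) :
    P.chartEqn j ε / P.chartEqn j' ε' = (P.x j (ε j) / P.x j' (ε' j')) ^ (n - 1) *
      ∏ i, P.x i (ε i) / P.x i (ε' i) := by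
  rw [chartEqn, chartEqn, Finset.prod_div_distrib, div_pow, div_mul_div_comm]

variable (L : Subring K) {j' : Fin (n + 1)} {ε' : Fin (n + 1) → Fin 2}
  (hL : ∀ a, P.chartHom Set.univ j' ε' a ∈ L)

include hL

lemma div_mem (i : Fin (n + 1)) (s : Fin 2) : P.x i s / P.x j' (ε' j') ∈ L := by
  obtain ⟨a, ha⟩ := P.exists_chartHom_eq Set.univ j' ε' i s
  rw [← ha]
  exact hL a

lemma div_self_mem (i : Fin (n + 1)) (s : Fin 2) : P.x i s / P.x i (ε' i) ∈ L := by
  obtain ⟨a, ha⟩ := P.exists_chartHom_eq_self j' ε' i s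
  rw [← ha]
  exact hL a

lemma chartEqn_div_mem : P.chartEqn j ε / P.chartEqn j' ε' ∈ L := by
  rw [chartEqn_div_chartEqn]
  exact mul_mem (pow_mem (P.div_mem L hL _ _) _) (prod_mem fun i _ => P.div_self_mem L hL _ _)

/-- The quotient of the two equations is a product of ratios lying in `L`. If its inverse is in `L`
too, every factor is a unit of `L`, and all coordinates of the chart `j`, `ε` follow. For the factor
$x_{j,\varepsilon(j)}/x_{j',\varepsilon'(j')}$ this requires a positive exponent $n-1$. -/
lemma chartHom_mem_of_chartEqn_div_mem (hn : 2 ≤ n)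
    (h : P.chartEqn j' ε' / P.chartEqn j ε ∈ L) (a) : P.chartHom Set.univ j ε a ∈ L := by
  classical
  have h0 := P.ne_zero j (ε j)
  have h0' := P.ne_zero j' (ε' j')
  have h1 : (P.x j (ε j) / P.x j' (ε' j')) ^ (n - 1) * (∏ i, P.x i (ε i) / P.x i (ε' i)) *
      (P.chartEqn j' ε' / P.chartEqn j ε) = 1 := by
    rw [← chartEqn_div_chartEqn, div_mul_div_cancel₀ (P.chartEqn_ne_zero _ _),
      div_self (P.chartEqn_ne_zero _ _)]
  have h2 : P.x j' (ε' j') / P.x j (ε j) ∈ L := by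
    rw [← inv_div, inv_eq_of_mul_eq_one_right (b := (P.x j (ε j) / P.x j' (ε' j')) ^ (n - 2) *
      (∏ i, P.x i (ε i) / P.x i (ε' i)) * (P.chartEqn j' ε' / P.chartEqn j ε))]
    · exact mul_mem (mul_mem (pow_mem (P.div_mem L hL _ _) _)
        (prod_mem fun i _ => P.div_self_mem L hL _ _)) h
    · rw [← h1, show n - 1 = n - 2 + 1 by omega, pow_succ]
      ring
  have h3 (i) : P.x i (ε' i) / P.x i (ε i) ∈ L := by
    rw [← inv_div, inv_eq_of_mul_eq_one_right (b := (P.x j (ε j) / P.x j' (ε' j')) ^ (n - 1) *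
      (∏ i ∈ Finset.univ.erase i, P.x i (ε i) / P.x i (ε' i)) *
        (P.chartEqn j' ε' / P.chartEqn j ε))]
    · exact mul_mem (mul_mem (pow_mem (P.div_mem L hL _ _) _)
        (prod_mem fun i _ => P.div_self_mem L hL _ _)) h
    · rw [← h1, ← Finset.mul_prod_erase _ (fun i => P.x i (ε i) / P.x i (ε' i))
        (Finset.mem_univ i)]
      ring
  have h4 (i s) : P.x i s / P.x j (ε j) ∈ L := by
    rw [← div_mul_div_cancel₀ h0']
    exact mul_mem (P.div_mem L hL _ _) h2
  have h5 (i s) : P.x i s / P.x i (ε i) ∈ L := by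
    rw [← div_mul_div_cancel₀ (P.ne_zero i (ε' i))]
    exact mul_mem (P.div_self_mem L hL _ _) (h3 i)
  induction a using MvPolynomial.induction_on with
  | C r =>
    have := hL (MvPolynomial.C r)
    rwa [chartHom, MvPolynomial.aeval_C] at this ⊢
  | add a b ha hb => rw [map_add]; exact add_mem ha hb
  | mul_X a v ha =>
    rw [map_mul]
    refine mul_mem ha ?_
    obtain ⟨i, s⟩ := v
    obtain rfl | rfl := finTwo_eq_or_rev 0 s
    · rw [chartHom_X_zero]
      exact h4 _ _
    · exact (P.chartHom_X_one_of_mem (D := Set.univ) (ε := ε) i (Set.mem_univ _)) ▸ h5 _ _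

end QuadricPoint

/-! ### The canonical divisor and the ampleness of its negative. -/

namespace Stage

variable {n : ℕ} {K : Type} [Field K] [Algebra ℂ K] {P : QuadricPoint n K} {X : Scheme.{0}}
  {p : X ⟶ Spec (.of ℂ)} {T : Fin (n + 1) → Closeds X} (S : Stage P Set.univ p T) [IsIntegral X]

/-- A function regular at `x` is a quotient of polynomials in the chart coordinates with denominator
invertible at `x`, so the Leibniz and quotient rules apply. -/
lemma D_mem_span (j : Fin (n + 1)) (ε : Fin (n + 1) → Fin 2) {x : X}
    (hx : x ∈ Set.range (S.chart j ε)) {z : FunctionField p} (hz : z ∈ localRing p x) :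
    KaehlerDifferential.D ℂ (FunctionField p) z ∈ Submodule.span (localRing p x)
      (Set.range fun v => KaehlerDifferential.D ℂ (FunctionField p)
        (S.point.coord Set.univ j ε v)) := by
  set N := Submodule.span (localRing p x) (Set.range fun v =>
    KaehlerDifferential.D ℂ (FunctionField p) (S.point.coord Set.univ j ε v)) with hN
  have smul {r : FunctionField p} (hr : r ∈ localRing p x) {m : Ω[FunctionField p⁄ℂ]} (hm : m ∈ N) :
      r • m ∈ N := N.smul_mem ⟨r, hr⟩ hm
  have mem (a) := S.chartHom_mem_localRing j ε hx a
  have h (a) : KaehlerDifferential.D ℂ (FunctionField p) (S.point.chartHom Set.univ j ε a) ∈ N := by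
    induction a using MvPolynomial.induction_on with
    | C r =>
      rw [QuadricPoint.chartHom, MvPolynomial.aeval_C, Derivation.map_algebraMap]
      exact zero_mem _
    | add a b ha hb => rw [map_add, map_add]; exact add_mem ha hb
    | mul_X a v ha =>
      rw [map_mul, Derivation.leibniz]
      refine add_mem (smul (mem _) ?_) (smul (mem _) ha)
      rw [QuadricPoint.chartHom, MvPolynomial.aeval_X]
      exact Submodule.subset_span ⟨v, rfl⟩
  obtain ⟨a, b, hb, -, rfl⟩ := S.exists_eq_div_of_mem_localRing j ε hx hz
  rw [Derivation.leibniz_div]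
  exact smul (pow_mem hb _) (sub_mem (smul (mem _) (h _)) (smul (mem _) (h _)))

lemma regularForms_eq (j : Fin (n + 1)) (ε : Fin (n + 1) → Fin 2) {x : X}
    (hx : x ∈ Set.range (S.chart j ε)) :
    regularForms p (2 * n) x = Submodule.span (localRing p x) {S.point.chartForm j ε} := by
  apply le_antisymm
  · refine Submodule.span_le.2 ?_
    rintro _ ⟨a, ha, rfl⟩
    refine map_mem_span_of_forall_mem_span (localRing p x)
      (exteriorPower.ιMulti (FunctionField p) (2 * n)) _ _ fun i => ?_
    have h := S.D_mem_span j ε hx (ha i)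
    rwa [← (QuadricPoint.varEquiv j).surjective.range_comp] at h
  · rw [Submodule.span_singleton_le_iff_mem]
    refine Submodule.subset_span ⟨_, fun k => ?_, rfl⟩
    have h := S.chartHom_mem_localRing j ε hx (MvPolynomial.X (QuadricPoint.varEquiv j k))
    rwa [QuadricPoint.chartHom, MvPolynomial.aeval_X] at h

/-- The indices of a chart containing a given point. -/
def index (x : X) : Fin (n + 1) × (Fin (n + 1) → Fin 2) :=
  ⟨(S.exists_mem_range_chart x).choose, (S.exists_mem_range_chart x).choose_spec.choose⟩

omit [IsIntegral X] in
lemma mem_range_index (x : X) : x ∈ Set.range (S.chart (S.index x).1 (S.index x).2) :=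
  (S.exists_mem_range_chart x).choose_spec.choose_spec

/-- The local equations of the canonical divisor. -/
def eqn (x : X) : FunctionField p := S.point.chartEqn (S.index x).1 (S.index x).2

lemma eqn_ne_zero (x : X) : S.eqn x ≠ 0 := S.point.chartEqn_ne_zero _ _

lemma eqn_div_mem (x y : X) : S.eqn x / S.eqn y ∈ localRing p y :=
  S.point.chartEqn_div_mem _ _ _ (S.chartHom_mem_localRing _ _ (S.mem_range_index y))

lemma isUnitAt_eqn_div (x y : X) (hy : y ∈ Set.range (S.chart (S.index x).1 (S.index x).2)) :
    IsUnitAt p y (S.eqn x / S.eqn y) := by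
  refine ⟨div_ne_zero (S.eqn_ne_zero x) (S.eqn_ne_zero y), S.eqn_div_mem x y, ?_⟩
  rw [inv_div]
  exact S.point.chartEqn_div_mem _ _ _ (S.chartHom_mem_localRing _ _ hy)

/-- The canonical divisor. -/
def canonicalDivisor : CartierDivisor p where
  eqn := S.eqn
  eqn_ne_zero := S.eqn_ne_zero
  locally_eq x := by
    refine ⟨(S.chart (S.index x).1 (S.index x).2).opensRange, S.mem_range_index x, fun y hy => ?_⟩
    obtain ⟨h1, h2, h3⟩ := S.isUnitAt_eqn_div x y hy
    rw [← inv_div]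
    exact ⟨inv_ne_zero h1, h3, by rwa [inv_inv]⟩

lemma isCanonicalDivisor_canonicalDivisor (hn : n ≠ 0) :
    IsCanonicalDivisor (2 * n) S.canonicalDivisor := by
  refine ⟨S.point.chartEqn 0 0 • S.point.chartForm 0 0,
    smul_ne_zero (S.point.chartEqn_ne_zero _ _) (S.point.chartForm_ne_zero _ _), fun x => ?_⟩
  have h := S.regularForms_eq _ _ (S.mem_range_index x)
  obtain h' | h' := S.point.chartEqn_smul_chartForm_eq_or_eq_neg 0 0 hn (S.index x).1 (S.index x).2
  · exact ⟨_, h, h'⟩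
  -- The sign by which the chart disagrees with the fixed global form is absorbed into the
  -- generator.
  · refine ⟨-S.point.chartForm (S.index x).1 (S.index x).2, ?_, h'.trans (smul_neg _ _).symm⟩
    rw [h, ← Set.neg_singleton, Submodule.span_neg]

/-- The equation of the chart around `x` is a global section of $-K$ by `eqn_div_mem`. It generates
$-K$ on its chart, and any point where it generates lies in that chart by `mem_range_chart`. -/
lemma isAmple_neg_canonicalDivisor (hn : 2 ≤ n) : S.canonicalDivisor.neg.IsAmple := by
  intro x
  have e (y : X) : S.eqn x * S.canonicalDivisor.neg.eqn y ^ 1 = S.eqn x / S.eqn y := by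
    rw [pow_one, div_eq_mul_inv]
    rfl
  refine ⟨1, le_rfl, S.eqn x, fun y => ?_, (S.chart (S.index x).1 (S.index x).2).opensRange,
    isAffineOpen_opensRange _, S.mem_range_index x, fun y => ⟨fun hy => ?_, fun hy => ?_⟩⟩
  · rw [e]
    exact S.eqn_div_mem x y
  · rw [e]
    exact S.isUnitAt_eqn_div x y hy
  · rw [e] at hy
    obtain ⟨-, -, h⟩ := hy
    rw [inv_div] at h
    exact S.mem_range_chart _ _ (S.point.chartHom_mem_of_chartEqn_div_mem _ _ _
      (S.chartHom_mem_localRing _ _ (S.mem_range_index y)) hn h)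

omit [IsIntegral X] in
include S in
lemma isFano (hn : 2 ≤ n) : IsFano p (2 * n) where
  isIntegral := S.isIntegral
  smooth := S.smoothOfRelativeDimension
  proper := S.proper
  ample_neg_canonical :=
    have := S.isIntegral
    ⟨S.canonicalDivisor, S.isCanonicalDivisor_canonicalDivisor (by omega),
      S.isAmple_neg_canonicalDivisor hn⟩

end Stage

end

end WonderfulQuadric

theorem mainTheorem7 (n : ℕ) (hn : 2 ≤ n) :
    (∃ (W : Scheme.{0}) (π : W ⟶ WonderfulQuadric.quadric n),
      WonderfulQuadric.IsWonderfulCompactification π) ∧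
    ∀ (W : Scheme.{0}) (π : W ⟶ WonderfulQuadric.quadric n),
      WonderfulQuadric.IsWonderfulCompactification π →
        WonderfulQuadric.IsFano (π ≫ WonderfulQuadric.quadricToSpec n) (2 * n) := by
  let P := WonderfulQuadric.QuadricPoint.ofQuadricField n (by omega)
  refine ⟨?_, fun W π h => ?_⟩
  · obtain ⟨W, π, -, h, -⟩ := WonderfulQuadric.exists_isWonderfulCompactification P
    exact ⟨W, π, h⟩
  · obtain ⟨T, ⟨S⟩⟩ := h.exists_stage P
    exact S.isFano hn
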